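/- Let $X=\{1<2<3<\cdots\}$ and $X'=\{1'<1<2'<2<\cdots\}$. The shifted diagram of a strict partition $\lambda_1>\dots>\lambda_l>0$ has $\lambda_i$ cells in row $i$, and row $i$ starts in column $i$ (so it starts on the main diagonal). *Mixed insertion.* Let $w=w_1\cdots w_n$ be a word in the alphabet $X$. Starting from the empty tableau $T_0$, the tableau $T_i$ (a filling of a shifted diagram with letters of $X'$) is obtained from $T_{i-1}$ by inserting $w_i$ into the first row, where a letter $x$ is inserted into a row (or column) as follows. If no entry of the row (column) is strictly greater than $x$, then $x$ is placed at its end and the process stops. Otherwise $x$ replaces the smallest entry $a>x$ (the leftmost, respectively topmost, one if this letter occurs several times). If $a$ was on the main diagonal, it is unprimed; it is then primed and inserted into the next column to the right of the one it was in. If $a$ was off the main diagonal, then it is inserted into the row below the one it was in if it is unprimed, and into the next column to the right if it is primed. The shapes of $T_{i-1}$ and $T_i$ differ by one cell; the mixed recording tableau $Q_{\mathrm{mix}}(w)$ is the filling of the shape of $T_n$ having the entry $i$ in that cell, for $i=1,\dots,n$. *SK insertion.* A hook word is a word $u=y_1\cdots y_s$ in $X$ with $y_1>\cdots>y_k\le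 y_{k+1}\le\cdots\le y_s$ for some $1\le k\le s$; write $u{\downarrow}=y_1\cdots y_k$ and $u{\uparrow}=y_{k+1}\cdots y_s$. To insert $x\in X$ into a hook word $u$: if $ux$ is a hook word, replace $u$ by $ux$ and stop. Otherwise let $y_j$ be the leftmost letter of $u{\uparrow}$ that is strictly greater than $x$, and let $y_i$ be the leftmost (that is, the largest) letter of $u{\downarrow}$ with $y_i\le y_j$; replace $y_j$ by $x$ and $y_i$ by $y_j$, so that $y_i$ is bumped out. To insert $x$ into a tableau with rows $u_1,\dots,u_l$ (hook words, from top to bottom), insert $x$ into $u_1$, insert the bumped letter, if any, into $u_2$, and so on; a letter bumped out of $u_l$ forms a new row. Starting from the empty tableau and inserting $w_1,\dots,w_n$ successively yields tableaux $P_{\mathrm{sk}}(w_1\cdots w_i)$, viewed as fillings of shifted diagrams. The shapes of $P_{\mathrm{sk}}(w_1\cdots w_{i-1})$ and $P_{\mathrm{sk}}(w_1\cdots w_i)$ differ by one cell; the SK recording tableau $Q_{\mathrm{sk}}(w)$ is the filling of the shape of $P_{\mathrm{sk}}(w)$ having the entry $i$ in that cell, for $i=1,\dots,n$. **Proposition.**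 For every word $w$ in the alphabet $X$, $Q_{\mathrm{mix}}(w)=Q_{\mathrm{sk}}(w)$. -/

import Mathlib

namespace ShiftedInsertion

/-! ### Alphabets, cells and fillings -/

/-- The alphabet `X = {1 < 2 < 3 < ⋯}`. -/
abbrev Letter : Type := ℕ+

/-- The alphabet `X' = {1' < 1 < 2' < 2 < ⋯}`, ordered lexicographically: `(k, false)` is the
primed letter `k'` and `(k, true)` is the unprimed letter `k`. -/
abbrev PLetter : Type := ℕ+ ×ₗ Bool

/-- The letter `k` of `X`, as an unprimed letter of `X'`. -/
def PLetter.unprimed (k : Letter) : PLetter := toLex (k, true)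

/-- The letter `k'` of `X'`. -/
def PLetter.primed (k : Letter) : PLetter := toLex (k, false)

/-- The letter `k` of which `k` and `k'` are the two versions. -/
def PLetter.base (a : PLetter) : Letter := (ofLex a).1

/-- Whether a letter of `X'` is primed. -/
def PLetter.IsPrimed (a : PLetter) : Prop := (ofLex a).2 = false

instance (a : PLetter) : Decidable a.IsPrimed :=
  inferInstanceAs (Decidable ((ofLex a).2 = false))

/-- A cell `(r, c)`: row `r` (counted from the top) and column `c` (counted from the left), both
starting from `0`. The `r`-th row of a shifted shape starts on the main diagonal, at `(r, r)`. -/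
abbrev Cell : Type := ℕ × ℕ

/-- A finite array of cells filled with elements of `α`. -/
structure Filling (α : Type) where
  /-- The set of cells that are filled: the shape. -/
  shape : Finset Cell
  /-- The content of each cell, `none` for a cell outside of the shape. -/
  entry : Cell → Option α
  mem_shape : ∀ p, p ∈ shape ↔ entry p ≠ none

namespace Filling

variable {α : Type}

/-- The empty filling. -/
def empty : Filling α where
  shape := ∅
  entry := fun _ => none
  mem_shape := by simp

/-- Write `a` into the cell `p`, replacing what was there or adding the cell to the shape. -/
def write (T : Filling α) (p : Cell) (a : α) : Filling α where
  shape := insert p T.shape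
  entry := Function.update T.entry p (some a)
  mem_shape := by
    intro q
    by_cases h : q = p
    · subst h; simp
    · simp [h, T.mem_shape q]

end Filling

/-! ### Mixed insertion -/

/-- A row or a column of the shifted plane. -/
inductive Line where
  | row (r : ℕ)
  | col (c : ℕ)

/-- The `k`-th cell of a line: rows are read from left to right, starting on the main diagonal,
columns are read from top to bottom. -/
def Line.cell : Line → ℕ → Cell
  | .row r, k => (r, r + k)
  | .col c, k => (k, c)

/-- The cell `p` is empty, or its entry is strictly greater than `a`. -/
def Filling.Accepts (T : Filling PLetter) (a : PLetter) (p : Cell) : Prop :=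
  ∀ b ∈ T.entry p, a < b

instance (T : Filling PLetter) (a : PLetter) (p : Cell) : Decidable (T.Accepts a p) :=
  match h : T.entry p with
  | none => isTrue (by simp [Filling.Accepts, h])
  | some b => decidable_of_iff (a < b) (by simp [Filling.Accepts, h])

theorem Line.cell_injective (L : Line) : Function.Injective L.cell := by
  intro i j h
  cases L <;> simpa [Line.cell] using h

theorem Filling.exists_accepts (T : Filling PLetter) (L : Line) (a : PLetter) :
    ∃ k, T.Accepts a (L.cell k) := by
  obtain ⟨p, ⟨k, rfl⟩, hk⟩ :=
    (Set.infinite_range_of_injective L.cell_injective).exists_notMem_finset T.shape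
  refine ⟨k, ?_⟩
  have h : T.entry (L.cell k) = none := by
    by_contra h
    exact hk ((T.mem_shape _).2 h)
  simp [Filling.Accepts, h]

/-- The cell in which `a` is placed when it is inserted into the line `L` of `T`. Lines of a
shifted Young tableau are weakly increasing, so this is the cell of the smallest entry strictly
greater than `a` (the first such cell if that letter is repeated), or the first empty cell of `L`
if there is no such entry. -/
def Filling.target (T : Filling PLetter) (L : Line) (a : PLetter) : Cell :=
  L.cell (Nat.find (T.exists_accepts L a))

/-- What happens to a letter `b` that gets bumped out of the cell `p`: the line into which it is
inserted, and the letter that is inserted there. On the main diagonal, `b` is primed and goes to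
the next column; off the diagonal, it goes to the next row if it is unprimed and to the next column
if it is primed. -/
def afterBump (p : Cell) (b : PLetter) : Line × PLetter :=
  if p.1 = p.2 then (.col (p.2 + 1), PLetter.primed b.base)
  else if b.IsPrimed then (.col (p.2 + 1), b)
  else (.row (p.1 + 1), b)

theorem le_afterBump {a b : PLetter} (p : Cell) (h : a < b) : a ≤ (afterBump p b).2 := by
  have key : a ≤ PLetter.primed b.base := by
    obtain ⟨a₁, a₂⟩ := a
    obtain ⟨b₁, b₂⟩ := b
    rcases Prod.Lex.lt_iff.1 h with h | ⟨h, h2⟩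
    · exact Prod.Lex.le_iff.2 (Or.inl h)
    · refine Prod.Lex.le_iff.2 (Or.inr ⟨h, ?_⟩)
      have h2 : a₂ < b₂ := h2
      change a₂ ≤ false
      revert h2
      cases a₂ <;> cases b₂ <;> decide
  unfold afterBump
  split_ifs
  · exact key
  · exact h.le
  · exact h.le

/-- The cells whose entry is strictly greater than `a`. -/
def Filling.above (T : Filling PLetter) (a : PLetter) : Finset Cell :=
  T.shape.filter fun p => T.Accepts a p

theorem Filling.mem_above (T : Filling PLetter) (a : PLetter) (p : Cell) :
    p ∈ T.above a ↔ p ∈ T.shape ∧ ∀ b ∈ T.entry p, a < b :=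
  Finset.mem_filter

theorem Filling.above_card_lt (T : Filling PLetter) (L : Line) {a b : PLetter}
    (hb : T.entry (T.target L a) = some b) :
    ((T.write (T.target L a) a).above (afterBump (T.target L a) b).2).card < (T.above a).card := by
  have hab : a < b := Nat.find_spec (T.exists_accepts L a) b hb
  have hle := le_afterBump (T.target L a) hab
  generalize T.target L a = p at hb hle ⊢
  generalize (afterBump p b).2 = b' at hle ⊢
  apply Finset.card_lt_card
  refine (Finset.ssubset_iff_of_subset ?_).2 ⟨p, ?_, ?_⟩
  · intro q hq
    rw [mem_above] at hq ⊢
    by_cases hqp : q = p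
    · subst hqp
      exact absurd (hq.2 a (by simp [write])) (not_lt.2 hle)
    · simp only [write, Function.update_of_ne hqp, Finset.mem_insert] at hq
      exact ⟨hq.1.resolve_left hqp, fun x hx => hle.trans_lt (hq.2 x hx)⟩
  · rw [mem_above, T.mem_shape, hb]
    refine ⟨by simp, fun x hx => ?_⟩
    rw [Option.mem_some_iff] at hx
    exact hx ▸ hab
  · rw [mem_above]
    intro h
    exact absurd (h.2 a (by simp [write])) (not_lt.2 hle)

/-- Insert the letter `a` into the line `L` of `T`, and continue with the bumped letters until a
letter is placed into an empty cell. -/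
def Filling.mixInsertLine (T : Filling PLetter) (L : Line) (a : PLetter) : Filling PLetter :=
  match hb : T.entry (T.target L a) with
  | none => T.write (T.target L a) a
  | some b =>
    (T.write (T.target L a) a).mixInsertLine
      (afterBump (T.target L a) b).1 (afterBump (T.target L a) b).2
termination_by (T.above a).card
decreasing_by exact T.above_card_lt L hb

/-- Mixed insertion of the letter `x` of `X` into `T`, starting with the first row. -/
def mixInsert (T : Filling PLetter) (x : Letter) : Filling PLetter :=
  T.mixInsertLine (.row 0) (PLetter.unprimed x)

/-- The mixed insertion tableau `P_mix(w)`. -/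
def mixTableau (w : List Letter) : Filling PLetter :=
  w.foldl mixInsert Filling.empty

/-! ### SK insertion -/

/-- A hook word `w₁ > w₂ > ⋯ > w_k ≤ w_{k+1} ≤ ⋯ ≤ w_l`, for some `1 ≤ k ≤ l`. -/
def IsHookWord (w : List Letter) : Prop :=
  ∃ k ∈ Finset.Icc 1 w.length,
    (w.take k).Pairwise (· > ·) ∧ (w.drop (k - 1)).Pairwise (· ≤ ·)

instance (w : List Letter) : Decidable (IsHookWord w) := by
  unfold IsHookWord; infer_instance

/-- The decreasing part `w₁ ⋯ w_k` of a hook word: its longest strictly decreasing prefix. -/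
def downPart : List Letter → List Letter
  | [] => []
  | [a] => [a]
  | a :: b :: l => if b < a then a :: downPart (b :: l) else [a]

/-- The increasing part `w_{k+1} ⋯ w_l` of a hook word. -/
def upPart (w : List Letter) : List Letter :=
  w.drop (downPart w).length

/-- The number `k` of a hook word is unique, and `downPart`, `upPart` are the two parts. -/
theorem parts_eq {w : List Letter} {k : ℕ} (hk : k ∈ Finset.Icc 1 w.length)
    (hdown : (w.take k).Pairwise (· > ·)) (hup : (w.drop (k - 1)).Pairwise (· ≤ ·)) :
    downPart w = w.take k ∧ upPart w = w.drop k := by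
  have key : downPart w = w.take k := by
    induction w generalizing k with
    | nil => simp [downPart]
    | cons a l ih =>
      obtain ⟨k, rfl⟩ : ∃ m, k = m + 1 := ⟨k - 1, by have := (Finset.mem_Icc.1 hk).1; omega⟩
      cases l with
      | nil => simp [downPart]
      | cons b l =>
        cases k with
        | zero =>
          have h : a ≤ b := by simp at hup; exact hup.1.1
          simp [downPart, h]
        | succ k =>
          have h : b < a := by simp at hdown; exact hdown.1.1
          have := ih (k := k + 1) (by simp at hk ⊢; omega)
            (by simpa using (List.pairwise_cons.1 hdown).2) (by simpa using hup)
          rw [downPart, if_pos h, this]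
          rfl
  refine ⟨key, ?_⟩
  rw [upPart, key, List.length_take, min_eq_left (Finset.mem_Icc.1 hk).2]

/-- The insertion of the letter `x` into a hook word `u`: the new word, and the letter that gets
bumped, if any. If `ux` is not a hook word, let `y` be the leftmost letter of the increasing part
with `x < y`, and `z` the leftmost letter of the decreasing part with `z ≤ y`; then `x` replaces
`y`, and `y` replaces `z`, which gets bumped. (For a hook word `u` such that `ux` is not a hook
word, both `y` and `z` exist.) -/
def skRowInsert (u : List Letter) (x : Letter) : List Letter × Option Letter :=
  if IsHookWord (u ++ [x]) then (u ++ [x], none)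
  else
    match (upPart u).find? (fun y => x < y) with
    | none => (u ++ [x], none)
    | some y =>
      match (downPart u).find? (fun z => z ≤ y) with
      | none => (u ++ [x], none)
      | some z =>
        ((downPart u).set ((downPart u).findIdx (fun z => z ≤ y)) y ++
          (upPart u).set ((upPart u).findIdx (fun y => x < y)) x, some z)

/-- SK insertion of the letter `x` into an array with rows `u₁, u₂, …, u_l` (from top to bottom): a
letter that gets bumped out of a row is inserted into the next one. -/
def skInsert : List (List Letter) → Letter → List (List Letter)
  | [], x => [[x]]
  | u :: us, x =>
    match skRowInsert u x with
    | (u', none) => u' :: us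
    | (u', some y) => u' :: skInsert us y

/-- The rows of the SK insertion tableau, from top to bottom. -/
def skRows (w : List Letter) : List (List Letter) :=
  w.foldl skInsert []

/-- The shifted filling with given rows: the `r`-th row is written from left to right starting on
the main diagonal. -/
def Filling.ofRows {α : Type} (R : List (List α)) : Filling α where
  shape := (Finset.range R.length).biUnion fun r =>
    (Finset.range (R.getD r []).length).image fun j => (r, r + j)
  entry := fun p => if p.1 ≤ p.2 then (R.getD p.1 [])[p.2 - p.1]? else none
  mem_shape := by
    rintro ⟨r, c⟩
    simp only [Finset.mem_biUnion, Finset.mem_range, Finset.mem_image, Prod.mk.injEq]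
    constructor
    · rintro ⟨r', -, j, hj, rfl, rfl⟩
      simpa using hj
    · intro h
      by_cases hrc : r ≤ c
      · have hlt : c - r < (R.getD r []).length := by simpa [hrc] using h
        refine ⟨r, ?_, c - r, hlt, rfl, by omega⟩
        by_contra hr
        simp [not_lt.1 hr] at hlt
      · simp [hrc] at h

/-- The SK insertion tableau `P_sk(w)`. -/
def skTableau (w : List Letter) : Filling Letter :=
  Filling.ofRows (skRows w)

/-! ### Recording tableaux -/

/-- Records the growth of the shape `sh (w₁ ⋯ w_i)`, for `i = 0, …, n`, where `w = w₁ ⋯ w_n`: the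
cell `p` contains `i` if it belongs to `sh (w₁ ⋯ w_i)` and not to `sh (w₁ ⋯ w_{i-1})`. -/
def recording (sh : List Letter → Finset Cell) (w : List Letter) : Cell → Option ℕ := fun p =>
  (List.range' 1 w.length).find? fun i => p ∈ sh (w.take i) ∧ p ∉ sh (w.take (i - 1))

/-- The mixed recording tableau `Q_mix(w)`. -/
def mixRecording (w : List Letter) : Cell → Option ℕ :=
  recording (fun v => (mixTableau v).shape) w

/-- The SK recording tableau `Q_sk(w)`. -/
def skRecording (w : List Letter) : Cell → Option ℕ :=
  recording (fun v => (skTableau v).shape) w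

end ShiftedInsertion

namespace ShiftedInsertion

/-! ### Growth of Young diagrams -/

/-! A recording tableau is determined by the shapes of the tableaux of all prefixes, so it suffices
that both insertions of a word give the same shape (`shape_mixTableau`).

The mixed side is treated through the cells by which the shape grows. The largest letter never
influences the smaller ones; it only gives way when its cell is needed. Hence the growth can be
described by removing the largest letter of the word and letting it travel through the cells of the
smaller ones: `ShiftedGrowth` for mixed insertion, and `Growth` for an unshifted insertion in which
some letters enter by rows and the others by columns. Replacing a shifted diagram by its double, and
each letter `a` by the pair `a' a`, turns the first process into the second, with `a'` inserted by
columns and `a` by rows (`ShiftedGrowth.double`).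

For the unshifted process, a Knuth relation in the signed order (column letters reversed and placed
below row letters) changes the path of new cells by an elementary dual equivalence in the same
window (`Growth.knuth`), so the final diagram does not change. Each four-letter shifted plactic
relation doubles to a chain of Knuth relations (`ShiftedPlactic.growthEquiv`). Hence shifted plactic
relations preserve the mixed shape in any context; this is recorded as `MixEquiv`.

On the SK side, if inserting `x` into a hook word `u` gives `u'` and bumps `z`, then `u x` and `z
u'` are related by shifted plactic relations (`mixEquiv_bump`). Therefore `w` may be replaced by `v
u`, where `u` is the first SK row of `w` and `v` is the word of letters bumped out of it
(`rowRun_spec`), and induction applies to `v`.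

It remains to see that appending `u` to `v` moves the diagram of `v` one step down the diagonal and
adds a first row. The growth detects peaks `x ≤ y > z` (`ShiftedGrowth.peak_iff`). A hook word has
none, so its new cells form a vertical strip followed by a horizontal strip and no diagonal advances
by two cells (`mem_of_diag_mem_mixTableau`). Peaks also show that the first row of the mixed tableau
is no longer than `u` (`lt_length_of_mem_mixTableau`). These two inclusions and a count of cells
give equality. -/

/-- A set of cells closed under going up and to the left. -/
def Low (A : Set Cell) : Prop :=
  ∀ i j, (i, j) ∈ A → ∀ i' ≤ i, ∀ j' ≤ j, (i', j') ∈ A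

/-- Adding the cell `p` to the Young diagram `A` gives a Young diagram. -/
def Addable (A : Set Cell) (p : Cell) : Prop :=
  Low A ∧ p ∉ A ∧ Low (insert p A)

theorem Addable.lt_mem {A : Set Cell} {p : Cell} (h : Addable A p) {i j : ℕ} (hi : i ≤ p.1)
    (hj : j ≤ p.2) (hne : i < p.1 ∨ j < p.2) : (i, j) ∈ A := by
  obtain ⟨a, b⟩ := p
  have := h.2.2 a b (by simp) i hi j hj
  rcases this with h | h
  · simp only [Prod.mk.injEq] at h; simp at hne; omega
  · exact h

theorem addable_of {A : Set Cell} {p : Cell} (hA : Low A) (hp : p ∉ A)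
    (h1 : ∀ i < p.1, (i, p.2) ∈ A) (h2 : ∀ j < p.2, (p.1, j) ∈ A) : Addable A p := by
  refine ⟨hA, hp, ?_⟩
  intro i j hij i' hi' j' hj'
  obtain ⟨a, b⟩ := p
  rcases hij with hij | hij
  · simp only [Prod.mk.injEq] at hij
    obtain ⟨rfl, rfl⟩ := hij
    by_cases e1 : i' < i
    · exact Or.inr (hA _ _ (h1 i' e1) i' le_rfl j' hj')
    · by_cases e2 : j' < j
      · exact Or.inr (hA _ _ (h2 j' e2) i' hi' j' le_rfl)
      · left; simp; omega
  · exact Or.inr (hA _ _ hij i' hi' j' hj')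

theorem Addable.eq_of_row {A : Set Cell} {p p' : Cell} (h : Addable A p) (h' : Addable A p')
    (e : p.1 = p'.1) : p = p' := by
  obtain ⟨a, b⟩ := p
  obtain ⟨a', b'⟩ := p'
  simp only at e
  subst e
  rcases lt_trichotomy b b' with hb | hb | hb
  · exact absurd (h'.lt_mem (i := a) (j := b) le_rfl hb.le (Or.inr hb)) h.2.1
  · rw [hb]
  · exact absurd (h.lt_mem (i := a) (j := b') le_rfl hb.le (Or.inr hb)) h'.2.1

theorem Addable.row_lt_iff {A : Set Cell} {p p' : Cell} (h : Addable A p) (h' : Addable A p') :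
    p.1 < p'.1 ↔ p'.2 < p.2 := by
  obtain ⟨a, b⟩ := p
  obtain ⟨a', b'⟩ := p'
  simp only
  constructor
  · intro hlt
    by_contra hb
    exact h.2.1 (h'.lt_mem (i := a) (j := b) hlt.le (by simp; omega) (Or.inl hlt))
  · intro hlt
    by_contra hb
    exact h'.2.1 (h.lt_mem (i := a') (j := b') (by simp; omega) hlt.le (Or.inr hlt))

theorem Addable.eq_of_col {A : Set Cell} {p p' : Cell} (h : Addable A p) (h' : Addable A p')
    (e : p.2 = p'.2) : p = p' := by
  have h1 := h.row_lt_iff h'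
  have h2 := h'.row_lt_iff h
  exact h.eq_of_row h' (by omega)

theorem Addable.comm {A : Set Cell} {p p' : Cell} (h : Addable A p) (h' : Addable A p')
    (e : p ≠ p') : Addable (insert p A) p' := by
  refine ⟨h.2.2, by simp [h'.2.1, e.symm], ?_⟩
  intro i j hij i' hi j' hj
  rcases hij with hij | hij | hij
  · rcases h'.2.2 i j (Or.inl hij) i' hi j' hj with h | h
    · exact Or.inl h
    · exact Or.inr (Or.inr h)
  · exact Or.inr (h.2.2 i j (Or.inl hij) i' hi j' hj)
  · exact Or.inr (h.2.2 i j (Or.inr hij) i' hi j' hj)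

/-- For consecutive cells of a path, row and column comparisons determine each other, a strict one
corresponding to a weak one. This is what lets statements about rows be transposed. -/
theorem Addable.row_lt_iff_next {A : Set Cell} {p p' : Cell} (h : Addable A p)
    (h' : Addable (insert p A) p') : p.1 < p'.1 ↔ p'.2 ≤ p.2 := by
  obtain ⟨a, b⟩ := p
  obtain ⟨a', b'⟩ := p'
  simp only
  constructor
  · intro hlt
    by_contra hb
    rcases h'.lt_mem (i := a) (j := b + 1) hlt.le (by simp; omega) (Or.inl hlt) with h1 | h1
    · simp at h1
    · exact h.2.1 (h.1 _ _ h1 a le_rfl b (by omega))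
  · intro hle
    by_contra hb
    exact h'.2.1 (h.2.2 a b (by simp) a' (by omega) b' hle)

/-- The cell below `q` is not in `A`, so the next row ends weakly to the left of `q`, under filled
cells. A letter bumped by rows therefore always finds a place. -/
theorem Addable.exists_next_row {A : Set Cell} {q : Cell} (h : Addable A q) :
    ∃ n, Addable (insert q A) n ∧ n.1 = q.1 + 1 := by
  classical
  obtain ⟨a, b⟩ := q
  have hex : ∃ k, (a + 1, k) ∉ A := ⟨b, fun hm => h.2.1 (h.1 _ _ hm a (by omega) b le_rfl)⟩
  have hb : Nat.find hex ≤ b :=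
    Nat.find_min' hex fun hm => h.2.1 (h.1 _ _ hm a (by omega) b le_rfl)
  refine ⟨(a + 1, Nat.find hex), addable_of h.2.2 ?_ ?_ ?_, rfl⟩
  · simpa using Nat.find_spec hex
  · intro i hi
    exact h.2.2 a b (by simp) i (by simp at hi; omega) _ hb
  · intro j hj
    exact Or.inr (not_not.1 (Nat.find_min hex hj))

theorem exists_addable_row_zero {A : Set Cell} (hA : Low A) (hf : A.Finite) :
    ∃ s, Addable A s ∧ s.1 = 0 := by
  classical
  have hex : ∃ k, ((0 : ℕ), k) ∉ A := by
    by_contra hcon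
    push Not at hcon
    exact Set.infinite_of_injective_forall_mem (f := fun k : ℕ => ((0 : ℕ), k))
      (fun a b h => by simpa using h) hcon hf
  refine ⟨(0, Nat.find hex), addable_of hA (Nat.find_spec hex) (by simp) ?_, rfl⟩
  intro j hj
  exact not_not.1 (Nat.find_min hex hj)

/-- The set `A` together with the cells of a list. -/
def addCells (A : Set Cell) (cs : List Cell) : Set Cell := A ∪ {p | p ∈ cs}

@[simp] theorem addCells_nil (A : Set Cell) : addCells A [] = A := by simp [addCells]

@[simp] theorem addCells_cons (A : Set Cell) (c : Cell) (cs : List Cell) :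
    addCells A (c :: cs) = addCells (insert c A) cs := by
  ext p; simp [addCells]; tauto

@[simp] theorem addCells_append (A : Set Cell) (cs ds : List Cell) :
    addCells A (cs ++ ds) = addCells (addCells A cs) ds := by
  ext p; simp [addCells]; tauto

/-- The cells of the list can be added to `A` one after the other. -/
def IsPath : Set Cell → List Cell → Prop
  | _, [] => True
  | A, c :: cs => Addable A c ∧ IsPath (insert c A) cs

theorem isPath_append {A : Set Cell} {cs ds : List Cell} :
    IsPath A (cs ++ ds) ↔ IsPath A cs ∧ IsPath (addCells A cs) ds := by
  induction cs generalizing A with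
  | nil => simp [IsPath]
  | cons c cs ih => simp [IsPath, ih, and_assoc]

theorem IsPath.low {A : Set Cell} {cs : List Cell} (hA : Low A) (h : IsPath A cs) :
    Low (addCells A cs) := by
  induction cs generalizing A with
  | nil => simpa using hA
  | cons c cs ih => simpa using ih h.1.2.2 h.2

/-- The line next to that of `q`, in which a letter bumped out of `q` is placed: the next row or the
next column. -/
def NextLine (t : Bool) (q n : Cell) : Prop :=
  if t then n.1 = q.1 + 1 else n.2 = q.2 + 1

/-- The largest letter, initially in the cell `q`, moves while the smaller letters fill the cells
`cs` one after the other: whenever its cell gets filled, it moves to the next line. Its final cell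
is `q'`, and the successive new cells are `cs'`. -/
inductive Pass (t : Bool) : Set Cell → Cell → List Cell → Cell → List Cell → Prop
  | nil (A : Set Cell) (q : Cell) : Pass t A q [] q []
  | keep {A : Set Cell} {q c q' : Cell} {cs cs' : List Cell} (h : c ≠ q)
      (hp : Pass t (insert c A) q cs q' cs') : Pass t A q (c :: cs) q' (c :: cs')
  | bump {A : Set Cell} {q n q' : Cell} {cs cs' : List Cell} (hn : Addable (insert q A) n)
      (hl : NextLine t q n) (hp : Pass t (insert q A) n cs q' cs') :
      Pass t A q (q :: cs) q' (n :: cs')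

theorem NextLine.eq {t : Bool} {A : Set Cell} {q n n' : Cell} (h : NextLine t q n)
    (h' : NextLine t q n') (hn : Addable A n) (hn' : Addable A n') : n = n' := by
  cases t
  · exact hn.eq_of_col hn' (by simp [NextLine] at h h'; omega)
  · exact hn.eq_of_row hn' (by simp [NextLine] at h h'; omega)

/-- A diagram has at most one addable cell in a given row or column, so every move is forced. -/
theorem Pass.unique {t : Bool} {A : Set Cell} {q q₁ q₂ : Cell} {cs cs₁ cs₂ : List Cell}
    (h₁ : Pass t A q cs q₁ cs₁) (h₂ : Pass t A q cs q₂ cs₂) : q₁ = q₂ ∧ cs₁ = cs₂ := by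
  induction h₁ generalizing q₂ cs₂ with
  | nil => cases h₂; simp
  | keep h _ ih =>
    cases h₂ with
    | keep h' hp => simpa using ih hp
    | bump => exact absurd rfl h
  | bump hn hl _ ih =>
    cases h₂ with
    | keep h' hp => exact absurd rfl h'
    | bump hn' hl' hp =>
      obtain rfl := hl.eq hl' hn hn'
      simpa using ih hp

theorem Pass.length_eq {t : Bool} {A : Set Cell} {q q' : Cell} {cs cs' : List Cell}
    (h : Pass t A q cs q' cs') : cs'.length = cs.length := by
  induction h <;> simp_all

/-- The smaller letters with the largest one added last, or the largest one placed first and then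
displaced: both orders fill the same cells. -/
theorem Pass.isPath {t : Bool} {A : Set Cell} {q q' : Cell} {cs cs' : List Cell}
    (h : Pass t A q cs q' cs') (hq : Addable A q) (hcs : IsPath A cs) :
    Addable (addCells A cs) q' ∧ IsPath (insert q A) cs' ∧
      insert q' (addCells A cs) = addCells (insert q A) cs' := by
  induction h with
  | nil => simpa [IsPath] using hq
  | keep h _ ih =>
    obtain ⟨h1, h2, h3⟩ := ih (hcs.1.comm hq h) hcs.2
    rw [Set.insert_comm] at h2 h3
    exact ⟨by simpa using h1, ⟨hq.comm hcs.1 h.symm, h2⟩, by simpa using h3⟩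
  | bump hn hl _ ih =>
    obtain ⟨h1, h2, h3⟩ := ih hn hcs.2
    exact ⟨by simpa using h1, ⟨hn, h2⟩, by simpa using h3⟩

theorem pass_append {t : Bool} {A : Set Cell} {q q' : Cell} {cs ds es : List Cell} :
    Pass t A q (cs ++ ds) q' es ↔ ∃ q₁ cs' ds', Pass t A q cs q₁ cs' ∧
      Pass t (addCells A cs) q₁ ds q' ds' ∧ es = cs' ++ ds' := by
  induction cs generalizing A q es with
  | nil =>
    constructor
    · intro h
      exact ⟨q, [], es, .nil _ _, by simpa using h, rfl⟩
    · rintro ⟨q₁, cs', ds', h1, h2, rfl⟩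
      cases h1
      simpa using h2
  | cons c cs ih =>
    constructor
    · intro h
      cases h with
      | keep h hp =>
        obtain ⟨q₁, cs', ds', h1, h2, rfl⟩ := ih.1 hp
        exact ⟨q₁, c :: cs', ds', .keep h h1, by simpa using h2, rfl⟩
      | bump hn hl hp =>
        obtain ⟨q₁, cs', ds', h1, h2, rfl⟩ := ih.1 hp
        exact ⟨q₁, _ :: cs', ds', .bump hn hl h1, by simpa using h2, rfl⟩
    · rintro ⟨q₁, cs', ds', h1, h2, rfl⟩
      cases h1 with
      | keep h hp => exact .keep h (ih.2 ⟨_, _, _, hp, by simpa using h2, rfl⟩)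
      | bump hn hl hp => exact .bump hn hl (ih.2 ⟨_, _, _, hp, by simpa using h2, rfl⟩)

theorem exists_pass_true {A : Set Cell} {q : Cell} {cs : List Cell} (hq : Addable A q)
    (hcs : IsPath A cs) : ∃ q' cs', Pass true A q cs q' cs' := by
  induction cs generalizing A q with
  | nil => exact ⟨_, _, .nil _ _⟩
  | cons c cs ih =>
    by_cases h : c = q
    · subst h
      obtain ⟨n, hn, hl⟩ := hq.exists_next_row
      obtain ⟨q', cs', hp⟩ := ih hn hcs.2
      exact ⟨_, _, .bump hn (by simpa [NextLine] using hl) hp⟩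
    · obtain ⟨q', cs', hp⟩ := ih (hcs.1.comm hq h) hcs.2
      exact ⟨_, _, .keep h hp⟩

/-! Transposition -/

theorem swap_preimage_insert (A : Set Cell) (q : Cell) :
    Prod.swap ⁻¹' (insert q A) = insert q.swap (Prod.swap ⁻¹' A) := by
  ext ⟨i, j⟩
  obtain ⟨a, b⟩ := q
  simp [and_comm]

theorem Low.swap {A : Set Cell} (h : Low A) : Low (Prod.swap ⁻¹' A) :=
  fun i j hij i' hi j' hj => h j i hij j' hj i' hi

theorem Addable.swap {A : Set Cell} {p : Cell} (h : Addable A p) :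
    Addable (Prod.swap ⁻¹' A) p.swap :=
  ⟨h.1.swap, by simpa using h.2.1, by simpa [swap_preimage_insert] using h.2.2.swap⟩

theorem Pass.swap {t : Bool} {A : Set Cell} {q q' : Cell} {cs cs' : List Cell}
    (h : Pass t A q cs q' cs') :
    Pass (!t) (Prod.swap ⁻¹' A) q.swap (cs.map Prod.swap) q'.swap (cs'.map Prod.swap) := by
  induction h with
  | nil => exact .nil _ _
  | keep h _ ih =>
    rw [swap_preimage_insert] at ih
    exact .keep (fun e => h (Prod.swap_injective e)) ih
  | bump hn hl _ ih =>
    rw [swap_preimage_insert] at ih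
    refine .bump (by simpa [swap_preimage_insert] using hn.swap) ?_ ih
    cases t <;> simpa [NextLine] using hl

theorem addCells_swap (A : Set Cell) (cs : List Cell) :
    Prod.swap ⁻¹' (addCells A cs) = addCells (Prod.swap ⁻¹' A) (cs.map Prod.swap) := by
  induction cs generalizing A with
  | nil => simp
  | cons c cs ih => simp [ih, swap_preimage_insert]

/-! Row words -/

/-- The effect of `Pass true` on the rows of the cells. -/
def rowPass : ℕ → List ℕ → ℕ × List ℕ
  | q, [] => (q, [])
  | q, r :: rs =>
    if r = q then ((rowPass (q + 1) rs).1, (q + 1) :: (rowPass (q + 1) rs).2)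
    else ((rowPass q rs).1, r :: (rowPass q rs).2)

/-- An addable cell is determined by its row, so whether the travelling letter is hit can be read
off from rows alone. -/
theorem Pass.rows {A : Set Cell} {q q' : Cell} {cs cs' : List Cell}
    (h : Pass true A q cs q' cs') (hq : Addable A q) (hcs : IsPath A cs) :
    rowPass q.1 (cs.map Prod.fst) = (q'.1, cs'.map Prod.fst) := by
  induction h with
  | nil => rfl
  | keep h _ ih =>
    have := ih (hcs.1.comm hq h) hcs.2
    have hne : _ ≠ _ := fun e => h (hcs.1.eq_of_row hq e)
    simp [rowPass, hne, this]
  | bump hn hl _ ih =>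
    have := ih hn hcs.2
    simp only [NextLine, if_true] at hl
    rw [hl] at this
    simp [rowPass, this, hl]

/-- Elementary dual equivalence of paths with three cells, in terms of their rows. -/
def DualEquiv (x₁ x₂ x₃ y₁ y₂ y₃ : ℕ) : Prop :=
  (x₁ = y₁ ∧ x₂ = y₃ ∧ x₃ = y₂ ∧ (x₂ ≤ x₁ ∧ x₁ < x₃ ∨ x₃ ≤ x₁ ∧ x₁ < x₂)) ∨
  (x₃ = y₃ ∧ x₁ = y₂ ∧ x₂ = y₁ ∧ (x₁ < x₃ ∧ x₃ ≤ x₂ ∨ x₂ < x₃ ∧ x₃ ≤ x₁))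

/-- A finite check on the order of the rows and `q`. The kind of relation may change: for `q = 0`
the rows `(0, 1, 1)` and `(1, 0, 1)`, related by exchanging the first two, become `(1, 2, 1)` and
`(1, 1, 2)`, related by exchanging the last two. -/
theorem rowPass_dualEquiv (q : ℕ) {x₁ x₂ x₃ y₁ y₂ y₃ : ℕ} (h : DualEquiv x₁ x₂ x₃ y₁ y₂ y₃)
    {q₁ q₂ z₁ z₂ z₃ w₁ w₂ w₃ : ℕ} (hx : rowPass q [x₁, x₂, x₃] = (q₁, [z₁, z₂, z₃]))
    (hy : rowPass q [y₁, y₂, y₃] = (q₂, [w₁, w₂, w₃])) :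
    q₁ = q₂ ∧ DualEquiv z₁ z₂ z₃ w₁ w₂ w₃ := by
  simp only [rowPass] at hx hy
  rcases h with ⟨rfl, rfl, rfl, h⟩ | ⟨rfl, rfl, rfl, h⟩
  all_goals
    split_ifs at hx hy <;> simp only [Prod.mk.injEq, List.cons.injEq, and_true] at hx hy <;>
    first
    | (exfalso; omega)
    | (refine ⟨by omega, Or.inl ⟨by omega, by omega, by omega, by omega⟩⟩)
    | (refine ⟨by omega, Or.inr ⟨by omega, by omega, by omega, by omega⟩⟩)

/-- `p` is the first cell of its row that is not in `A`. -/
def RowEnd (A : Set Cell) (p : Cell) : Prop := p ∉ A ∧ ∀ j < p.2, (p.1, j) ∈ A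

theorem Addable.rowEnd {A : Set Cell} {p : Cell} (h : Addable A p) : RowEnd A p :=
  ⟨h.2.1, fun _ hj => h.lt_mem le_rfl hj.le (Or.inr hj)⟩

theorem RowEnd.unique {A : Set Cell} {p p' : Cell} (h : RowEnd A p) (h' : RowEnd A p')
    (e : p.1 = p'.1) : p = p' := by
  obtain ⟨a, b⟩ := p
  obtain ⟨a', b'⟩ := p'
  simp only at e
  subst e
  rcases lt_trichotomy b b' with hb | hb | hb
  · exact absurd (h'.2 b hb) h.1
  · rw [hb]
  · exact absurd (h.2 b' hb) h'.1

theorem RowEnd.of_insert {A : Set Cell} {p q : Cell} (h : RowEnd (insert q A) p)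
    (e : p.1 ≠ q.1) : RowEnd A p := by
  refine ⟨fun hm => h.1 (Or.inr hm), fun j hj => ?_⟩
  rcases h.2 j hj with h' | h'
  · exact absurd (congrArg Prod.fst h') e
  · exact h'

/-- Adding a cell in one row does not move the end of a different row. -/
theorem swap_two {A : Set Cell} {a b a' b' : Cell} (ha : Addable A a)
    (hb : Addable (insert a A) b) (hb' : Addable A b') (ha' : Addable (insert b' A) a')
    (e1 : a.1 = a'.1) (e2 : b.1 = b'.1) (hne : a.1 ≠ b.1) : a = a' ∧ b = b' :=
  ⟨ha.rowEnd.unique (ha'.rowEnd.of_insert (by omega)) e1,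
    (hb.rowEnd.of_insert (by omega)).unique hb'.rowEnd e2⟩

/-- The relation is defined on rows only. Since the exchanged rows are different, it exchanges the
cells themselves, so both paths fill the same set. -/
theorem DualEquiv.cells {A : Set Cell} {a₁ a₂ a₃ b₁ b₂ b₃ : Cell} (ha : IsPath A [a₁, a₂, a₃])
    (hb : IsPath A [b₁, b₂, b₃]) (h : DualEquiv a₁.1 a₂.1 a₃.1 b₁.1 b₂.1 b₃.1) :
    (a₁ = b₁ ∧ a₂ = b₃ ∧ a₃ = b₂) ∨ (a₁ = b₂ ∧ a₂ = b₁ ∧ a₃ = b₃) := by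
  obtain ⟨ha1, ha2, ha3, -⟩ := ha
  obtain ⟨hb1, hb2, hb3, -⟩ := hb
  rcases h with ⟨h1, h2, h3, h4⟩ | ⟨h1, h2, h3, h4⟩
  · left
    obtain rfl := ha1.eq_of_row hb1 h1
    obtain ⟨rfl, rfl⟩ := swap_two ha2 ha3 hb2 hb3 h2 h3 (by omega)
    simp
  · right
    obtain ⟨rfl, rfl⟩ := swap_two ha1 ha2 hb1 hb2 h2 h3 (by omega)
    rw [Set.insert_comm] at ha3
    exact ⟨rfl, rfl, ha3.eq_of_row hb3 h1⟩

theorem DualEquiv.addCells_eq {A : Set Cell} {a₁ a₂ a₃ b₁ b₂ b₃ : Cell}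
    (ha : IsPath A [a₁, a₂, a₃]) (hb : IsPath A [b₁, b₂, b₃])
    (h : DualEquiv a₁.1 a₂.1 a₃.1 b₁.1 b₂.1 b₃.1) :
    addCells A [a₁, a₂, a₃] = addCells A [b₁, b₂, b₃] := by
  rcases h.cells ha hb with ⟨rfl, rfl, rfl⟩ | ⟨rfl, rfl, rfl⟩ <;> ext p <;> simp <;> tauto

/-- Each of the two paths provides one comparison of the fixed cell with an exchanged cell that
follows or precedes it. Passing to columns interchanges weak and strict inequalities, which
interchanges the two alternatives in the definition. -/
theorem DualEquiv.cols {A : Set Cell} {a₁ a₂ a₃ b₁ b₂ b₃ : Cell} (ha : IsPath A [a₁, a₂, a₃])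
    (hb : IsPath A [b₁, b₂, b₃]) (h : DualEquiv a₁.1 a₂.1 a₃.1 b₁.1 b₂.1 b₃.1) :
    DualEquiv a₁.2 a₂.2 a₃.2 b₁.2 b₂.2 b₃.2 := by
  have hc := h.cells ha hb
  obtain ⟨ha1, ha2, ha3, -⟩ := ha
  obtain ⟨hb1, hb2, hb3, -⟩ := hb
  have i1 := ha1.row_lt_iff_next ha2
  have i2 := ha2.row_lt_iff_next ha3
  have i3 := hb1.row_lt_iff_next hb2
  have i4 := hb2.row_lt_iff_next hb3
  clear ha1 ha2 ha3 hb1 hb2 hb3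
  rcases hc with ⟨rfl, rfl, rfl⟩ | ⟨rfl, rfl, rfl⟩
  · have h' : a₂.1 ≤ a₁.1 ∧ a₁.1 < a₃.1 ∨ a₃.1 ≤ a₁.1 ∧ a₁.1 < a₂.1 := by
      unfold DualEquiv at h; omega
    exact Or.inl ⟨rfl, rfl, rfl, by omega⟩
  · have h' : a₁.1 < a₃.1 ∧ a₃.1 ≤ a₂.1 ∨ a₂.1 < a₃.1 ∧ a₃.1 ≤ a₁.1 := by
      unfold DualEquiv at h; omega
    exact Or.inr ⟨rfl, rfl, rfl, by omega⟩

theorem DualEquiv.symm {x₁ x₂ x₃ y₁ y₂ y₃ : ℕ} (h : DualEquiv x₁ x₂ x₃ y₁ y₂ y₃) :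
    DualEquiv y₁ y₂ y₃ x₁ x₂ x₃ := by
  unfold DualEquiv at *; omega

end ShiftedInsertion

namespace ShiftedInsertion

/-! ### Growth along a word -/

theorem append_cons_inj_of_notMem {β : Type*} {U V U' V' : List β} {m : β} (hU : m ∉ U) (hU' : m ∉ U')
    (h : U ++ m :: V = U' ++ m :: V') : U = U' ∧ V = V' := by
  induction U generalizing U' with
  | nil =>
    cases U' with
    | nil => simpa using h
    | cons a U' => simp at h hU'; exact absurd h.1 hU'.1
  | cons a U ih =>
    cases U' with
    | nil => simp at h hU; exact absurd h.1.symm hU.1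
    | cons a' U' =>
      simp at h hU hU'
      have := ih hU.2 hU'.2 h.2
      simp [h.1, this]

theorem exists_split_of_mem {β : Type*} {m : β} {P M S : List β} (h : m ∈ P ++ M ++ S) :
    (∃ P₁ P₂, P = P₁ ++ m :: P₂) ∨ (∃ M₁ M₂, M = M₁ ++ m :: M₂) ∨ ∃ S₁ S₂, S = S₁ ++ m :: S₂ := by
  simp only [List.mem_append] at h
  rcases h with (h | h) | h
  · exact Or.inl (List.append_of_mem h)
  · exact Or.inr (Or.inl (List.append_of_mem h))
  · exact Or.inr (Or.inr (List.append_of_mem h))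

section Growth

variable {β : Type} [LinearOrder β]

/-- The list `cs` records the cells by which the recording tableau grows along the word `W`, where
the letters `x` with `pos x` are inserted by rows and the other ones are inserted by columns. -/
inductive Growth (pos : β → Bool) : List β → List Cell → Prop
  | nil : Growth pos [] []
  | ins {U V : List β} {m : β} {us vs vs' : List Cell} {s q : Cell}
      (hm : ∀ x ∈ U ++ V, x < m) (hg : Growth pos (U ++ V) (us ++ vs))
      (hl : us.length = U.length) (hs : Addable (addCells ∅ us) s)
      (h0 : if pos m then s.1 = 0 else s.2 = 0)
      (hp : Pass (pos m) (addCells ∅ us) s vs q vs') :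
      Growth pos (U ++ m :: V) (us ++ s :: vs')

variable {pos : β → Bool}

theorem low_empty : Low ∅ := fun _ _ h => h.elim

theorem Growth.length_eq {W : List β} {cs : List Cell} (h : Growth pos W cs) :
    cs.length = W.length := by
  induction h with
  | nil => rfl
  | ins hm hg hl hs h0 hp ih =>
    have := hp.length_eq
    simp at ih ⊢; omega

theorem Growth.isPath {W : List β} {cs : List Cell} (h : Growth pos W cs) : IsPath ∅ cs := by
  induction h with
  | nil => trivial
  | ins hm hg hl hs h0 hp ih =>
    rw [isPath_append] at ih ⊢
    exact ⟨ih.1, hs, (hp.isPath hs ih.2).2.1⟩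

/-- The largest letter occurs only once, so the decomposition used by the last `ins` is the given
one. -/
theorem Growth.inv {U V : List β} {m : β} {cs : List Cell} (h : Growth pos (U ++ m :: V) cs)
    (hm : ∀ x ∈ U ++ V, x < m) : ∃ us vs vs' s q, cs = us ++ s :: vs' ∧
      Growth pos (U ++ V) (us ++ vs) ∧ us.length = U.length ∧ Addable (addCells ∅ us) s ∧
      (if pos m then s.1 = 0 else s.2 = 0) ∧ Pass (pos m) (addCells ∅ us) s vs q vs' := by
  generalize hW : U ++ m :: V = W at h
  cases h with
  | nil => simp at hW
  | @ins U' V' m' us vs vs' s q hm' hg hl hs h0 hp =>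
    have hmm : m = m' := by
      by_contra hne
      have h1 : m ∈ U' ++ m' :: V' := by rw [← hW]; simp
      have h2 : m' ∈ U ++ m :: V := by rw [hW]; simp
      have h3 : m < m' := hm' m (by simp at h1 ⊢; tauto)
      have h4 : m' < m := hm m' (by simp at h2 ⊢; have := Ne.symm hne; tauto)
      exact lt_asymm h3 h4
    subst hmm
    obtain ⟨rfl, rfl⟩ := append_cons_inj_of_notMem
      (fun hx => lt_irrefl _ (hm m (by simp [hx]))) (fun hx => lt_irrefl _ (hm' m (by simp [hx]))) hW
    exact ⟨us, vs, vs', s, q, rfl, hg, hl, hs, h0, hp⟩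

theorem Growth.unique {W : List β} {cs ds : List Cell} (h : Growth pos W cs)
    (h' : Growth pos W ds) : cs = ds := by
  induction h generalizing ds with
  | nil => exact (List.length_eq_zero_iff.1 h'.length_eq).symm
  | @ins _ _ _ _ _ _ s _ hm hg hl hs h0 hp ih =>
    obtain ⟨us₂, vs₂, vs'₂, s₂, q₂, rfl, hg₂, hl₂, hs₂, h0₂, hp₂⟩ := h'.inv hm
    obtain ⟨rfl, rfl⟩ := List.append_inj (ih hg₂) (by omega)
    have : s = s₂ := by
      split_ifs at h0 h0₂ with hpm
      · exact hs.eq_of_row hs₂ (by omega)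
      · exact hs.eq_of_col hs₂ (by omega)
    subst this
    rw [(hp.unique hp₂).2]

/-- Transposition interchanges row insertion and column insertion. It reduces later arguments to the
case of a largest letter inserted by rows. -/
theorem Growth.swap {W : List β} {cs : List Cell} (h : Growth pos W cs) :
    Growth (fun x => !pos x) W (cs.map Prod.swap) := by
  induction h with
  | nil => exact .nil
  | ins hm hg hl hs h0 hp ih =>
    rw [List.map_append] at ih
    have hs' := hs.swap
    have hp' := hp.swap
    rw [addCells_swap] at hs' hp'
    rw [List.map_append, List.map_cons]
    refine .ins hm ih (by simpa using hl) hs' ?_ hp'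
    split_ifs at h0 ⊢ <;> simp_all

/-- The order of signed letters: the letters with `pos` come after those without it, and the order
of the latter is reversed. -/
def SignedLT (pos : β → Bool) (x y : β) : Prop :=
  if pos x then pos y ∧ x < y else pos y ∨ y < x

/-- Interchanging the two classes of letters reverses the signed order, as transposition requires.
-/
theorem signedLT_not {x y : β} :
    SignedLT (fun x => !pos x) x y ↔ SignedLT pos y x := by
  unfold SignedLT
  cases hx : pos x <;> cases hy : pos y <;> simp [hx, hy]

theorem SignedLT.asymm {x y : β} (h : SignedLT pos x y) : ¬ SignedLT pos y x := by
  unfold SignedLT at *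
  cases hx : pos x <;> cases hy : pos y <;> simp [hx, hy] at h ⊢ <;> exact h.le

theorem SignedLT.trans {x y z : β} (h : SignedLT pos x y) (h' : SignedLT pos y z) :
    SignedLT pos x z := by
  unfold SignedLT at *
  cases hx : pos x <;> cases hy : pos y <;> cases hz : pos z <;> simp [hx, hy, hz] at h h' ⊢
  · exact h'.trans h
  · exact h.trans h'

theorem signedLT_of_pos {x m : β} (hm : pos m = true) (h : x < m) : SignedLT pos x m := by
  unfold SignedLT; simp [hm, h]

theorem finite_addCells (cs : List Cell) : (addCells ∅ cs).Finite := by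
  simp only [addCells, Set.empty_union]
  exact List.finite_toSet cs

/-- A descent lemma for a letter inserted by rows. -/
theorem Pass.row_le_iff {A : Set Cell} {q q' a b a' b' : Cell}
    (h : Pass true A q [a, b] q' [a', b']) (hq : Addable A q) (hp : IsPath A [a, b]) :
    b'.1 ≤ a'.1 ↔ b.1 ≤ a.1 := by
  have := h.rows hq hp
  simp only [List.map_cons, List.map_nil, rowPass] at this
  split_ifs at this <;> simp only [Prod.mk.injEq, List.cons.injEq] at this <;> omega

theorem IsPath.row_le_iff {A : Set Cell} {a b : Cell} (h : IsPath A [a, b]) :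
    b.1 ≤ a.1 ↔ a.2 < b.2 := by
  have := h.1.row_lt_iff_next h.2.1
  omega

/-- The letter with the largest label of a word with growth is unique. -/
theorem Growth.exists_max {W : List β} {cs : List Cell} (h : Growth pos W cs) (hW : W ≠ []) :
    ∃ U V m, W = U ++ m :: V ∧ ∀ x ∈ U ++ V, x < m := by
  cases h with
  | nil => exact absurd rfl hW
  | ins hm _ _ _ _ _ => exact ⟨_, _, _, rfl, hm⟩

/-- The growth of a word `P M S` with largest letter in `P`, restricted to the factor `M`. -/
theorem Growth.left {P₁ P₂ M S : List β} {m : β} {ps as ss : List Cell}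
    (h : Growth pos (P₁ ++ m :: P₂ ++ M ++ S) (ps ++ as ++ ss))
    (hm : ∀ x ∈ P₁ ++ P₂ ++ M ++ S, x < m)
    (hps : ps.length = (P₁ ++ m :: P₂).length) (has : as.length = M.length) :
    ∃ qs bs ts q₁ q₂ q₃, Growth pos (P₁ ++ P₂ ++ M ++ S) (qs ++ bs ++ ts) ∧
      qs.length = (P₁ ++ P₂).length ∧ bs.length = M.length ∧
      Addable (addCells ∅ qs) q₁ ∧ Pass (pos m) (addCells ∅ qs) q₁ bs q₂ as ∧
      Pass (pos m) (addCells ∅ (qs ++ bs)) q₂ ts q₃ ss ∧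
      insert q₁ (addCells ∅ qs) = addCells ∅ ps ∧
      ∀ M' as' bs' ts' q₃' ss', Growth pos (P₁ ++ P₂ ++ M' ++ S) (qs ++ bs' ++ ts') →
        (∀ x ∈ M', x < m) →
        Pass (pos m) (addCells ∅ qs) q₁ bs' q₂ as' →
        Pass (pos m) (addCells ∅ (qs ++ bs')) q₂ ts' q₃' ss' →
        Growth pos (P₁ ++ m :: P₂ ++ M' ++ S) (ps ++ as' ++ ss') := by
  rw [show P₁ ++ m :: P₂ ++ M ++ S = P₁ ++ m :: (P₂ ++ M ++ S) by simp] at h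
  obtain ⟨us, vs, vs', s, q, e, hg, hl, hs, h0, hp⟩ := h.inv (by simpa using hm)
  have hlen := hg.length_eq
  simp only [List.length_append] at hlen
  obtain ⟨v₁, v₂, v₃, rfl, l1, l2⟩ : ∃ v₁ v₂ v₃, vs = v₁ ++ v₂ ++ v₃ ∧ v₁.length = P₂.length ∧
      v₂.length = M.length :=
    ⟨vs.take P₂.length, (vs.drop P₂.length).take M.length, (vs.drop P₂.length).drop M.length,
      by rw [List.append_assoc, List.take_append_drop, List.take_append_drop], by simp; omega, by simp; omega⟩
  -- The journey of `m` is cut where `M` begins and ends; `q₁` and `q₂` are its cells at these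
  -- moments. A modification of `M` then only has to respect `q₂` and the diagram reached there.
  obtain ⟨q₂, v₁₂', v₃', hp12, hp3, rfl⟩ := pass_append.1 hp
  obtain ⟨q₁, v₁', v₂', hp1, hp2, rfl⟩ := pass_append.1 hp12
  have e' : ps ++ as ++ ss = us ++ s :: v₁' ++ v₂' ++ v₃' := by simpa using e
  have k1 := hp1.length_eq
  have k2 := hp2.length_eq
  simp only [List.length_append, List.length_cons] at hps
  obtain ⟨e1, rfl⟩ := List.append_inj e' (by simp; omega)
  obtain ⟨rfl, rfl⟩ := List.append_inj e1 (by simp; omega)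
  have hpath := hg.isPath
  rw [isPath_append, isPath_append, isPath_append] at hpath
  obtain ⟨r1, r2, r3⟩ := hp1.isPath hs hpath.2.1.1
  refine ⟨us ++ v₁, v₂, v₃, q₁, q₂, q, by simpa using hg, by simp; omega, l2, by simpa using r1,
    by simpa using hp2, by simpa using hp3, by simpa using r3, ?_⟩
  intro M' as' bs' ts' q₃' ss' hg' hM' hp2' hp3'
  rw [show P₁ ++ m :: P₂ ++ M' ++ S = P₁ ++ m :: (P₂ ++ M' ++ S) by simp,
    show us ++ s :: v₁' ++ as' ++ ss' = us ++ s :: (v₁' ++ as' ++ ss') by simp]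
  refine .ins (vs := v₁ ++ bs' ++ ts') (q := q₃') ?_ (by simpa using hg') hl hs h0 ?_
  · intro x hx
    simp only [List.mem_append] at hx hm
    rcases hx with hx | (hx | hx) | hx
    · exact hm x (by tauto)
    · exact hm x (by tauto)
    · exact hM' x hx
    · exact hm x (by tauto)
  · rw [pass_append]
    refine ⟨q₂, v₁' ++ as', ss', ?_, by simpa using hp3', rfl⟩
    rw [pass_append]
    exact ⟨q₁, v₁', as', hp1, by simpa using hp2', rfl⟩

/-- The growth of a word `P M S` with largest letter in `S`, restricted to the factor `P M`. -/
theorem Growth.right {P M S₁ S₂ : List β} {m : β} {ps as ss : List Cell}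
    (h : Growth pos (P ++ M ++ (S₁ ++ m :: S₂)) (ps ++ as ++ ss))
    (hm : ∀ x ∈ P ++ M ++ (S₁ ++ S₂), x < m)
    (hps : ps.length = P.length) (has : as.length = M.length) :
    ∃ ts, Growth pos (P ++ M ++ (S₁ ++ S₂)) (ps ++ as ++ ts) ∧
      ∀ M' as', Growth pos (P ++ M' ++ (S₁ ++ S₂)) (ps ++ as' ++ ts) → (∀ x ∈ M', x < m) →
        as'.length = M'.length → addCells (addCells ∅ ps) as' = addCells (addCells ∅ ps) as →
        Growth pos (P ++ M' ++ (S₁ ++ m :: S₂)) (ps ++ as' ++ ss) := by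
  rw [show P ++ M ++ (S₁ ++ m :: S₂) = (P ++ M ++ S₁) ++ m :: S₂ by simp] at h
  obtain ⟨us, vs, vs', s, q, e, hg, hl, hs, h0, hp⟩ := h.inv (by simpa using hm)
  simp only [List.length_append] at hl
  obtain ⟨u₁, u₂, u₃, rfl, l1, l2⟩ : ∃ v₁ v₂ v₃, us = v₁ ++ v₂ ++ v₃ ∧ v₁.length = P.length ∧
      v₂.length = M.length :=
    ⟨us.take P.length, (us.drop P.length).take M.length, (us.drop P.length).drop M.length,
      by rw [List.append_assoc, List.take_append_drop, List.take_append_drop],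
      by simp; omega, by simp; omega⟩
  have e' : ps ++ as ++ ss = u₁ ++ u₂ ++ (u₃ ++ s :: vs') := by simpa using e
  obtain ⟨e1, rfl⟩ := List.append_inj e' (by simp; omega)
  obtain ⟨rfl, rfl⟩ := List.append_inj e1 (by omega)
  refine ⟨u₃ ++ vs, by simpa using hg, ?_⟩
  intro M' as' hg' hM' hl' he
  rw [show P ++ M' ++ (S₁ ++ m :: S₂) = (P ++ M' ++ S₁) ++ m :: S₂ by simp,
    show ps ++ as' ++ (u₃ ++ s :: vs') = (ps ++ as' ++ u₃) ++ s :: vs' by simp]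
  -- The letter `m` enters after `M`, so it sees only the diagram reached and not the order in which
  -- it was filled.
  have hA : addCells ∅ (ps ++ as' ++ u₃) = addCells ∅ (ps ++ as ++ u₃) := by simp [he]
  simp only [List.length_append] at hl
  refine .ins (vs := vs) (q := q) ?_ (by simpa using hg') (by simp; omega) (hA ▸ hs) h0 (hA ▸ hp)
  intro x hx
  simp only [List.mem_append] at hx hm
  rcases hx with ((hx | hx) | hx) | hx
  · exact hm x (by tauto)
  · exact hM' x hx
  · exact hm x (by tauto)
  · exact hm x (by tauto)

end Growth

end ShiftedInsertion

namespace ShiftedInsertion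

/-! ### Descents of a word and descents of its growth -/

section Knuth

variable {β : Type} [LinearOrder β] {pos : β → Bool}

theorem Growth.nodup {W : List β} {cs : List Cell} (h : Growth pos W cs) : W.Nodup := by
  induction h with
  | nil => simp
  | @ins U V m _ _ _ _ _ hm _ _ _ _ _ ih =>
    rw [List.nodup_middle]
    exact List.nodup_cons.2 ⟨fun h => lt_irrefl _ (hm m h), ih⟩

theorem SignedLT.total {x y : β} (h : x ≠ y) : SignedLT pos x y ∨ SignedLT pos y x := by
  unfold SignedLT
  have := h.lt_or_gt
  cases hx : pos x <;> cases hy : pos y <;> simp <;> tauto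

theorem Growth.swap_swap {W : List β} {cs : List Cell}
    (h : Growth (fun x => !pos x) W cs) : Growth pos W (cs.map Prod.swap) := by
  simpa using h.swap

/-- The travelling letter occupies the only addable cell of row `0`; a cell wanted there pushes it
into row `1`. -/
theorem Pass.row_pos {A : Set Cell} {q c q' c' : Cell} {cs cs' : List Cell} (hq : Addable A q)
    (hc : Addable A c) (h0 : q.1 = 0) (h : Pass true A q (c :: cs) q' (c' :: cs')) : 0 < c'.1 := by
  cases h with
  | keep h _ => exact Nat.pos_of_ne_zero fun e => h (hc.eq_of_row hq (e.trans h0.symm))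
  | bump _ hl _ =>
    simp only [NextLine, if_true] at hl
    omega

theorem Growth.split_pair {P S : List β} {x y : β} {cs : List Cell}
    (h : Growth pos (P ++ [x, y] ++ S) cs) : ∃ ps a b ss, cs = ps ++ [a, b] ++ ss ∧
      ps.length = P.length := by
  have := h.length_eq
  simp at this
  obtain ⟨ps, rs, rfl, hl⟩ : ∃ ps rs, cs = ps ++ rs ∧ ps.length = P.length :=
    ⟨cs.take P.length, cs.drop P.length, by simp, by simp; omega⟩
  simp at this
  match rs, this with
  | a :: b :: ss, _ => exact ⟨ps, a, b, ss, by simp, hl⟩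
  | [a], h => simp at h; omega
  | [], h => simp at h; omega

theorem Growth.split_triple {P S : List β} {x y z : β} {cs : List Cell}
    (h : Growth pos (P ++ [x, y, z] ++ S) cs) : ∃ ps a b c ss, cs = ps ++ [a, b, c] ++ ss ∧
      ps.length = P.length := by
  have := h.length_eq
  simp at this
  obtain ⟨ps, rs, rfl, hl⟩ : ∃ ps rs, cs = ps ++ rs ∧ ps.length = P.length :=
    ⟨cs.take P.length, cs.drop P.length, by simp, by simp; omega⟩
  simp at this
  match rs, this with
  | a :: b :: c :: ss, _ => exact ⟨ps, a, b, c, ss, by simp, hl⟩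
  | [a, b], h => simp at h; omega
  | [a], h => simp at h; omega
  | [], h => simp at h; omega

/-- The largest letter of `W`, in any decomposition of `W`. -/
theorem lt_of_max {W U V U' V' : List β} {m : β} (hnd : W.Nodup) (hW : W = U ++ m :: V)
    (hm : ∀ x ∈ U ++ V, x < m) (hW' : W = U' ++ m :: V') : ∀ x ∈ U' ++ V', x < m := by
  obtain ⟨rfl, rfl⟩ := append_cons_inj_of_notMem
    (fun hx => lt_irrefl _ (hm m (by simp [hx])))
    (fun hx => by
      rw [hW', List.nodup_middle, List.nodup_cons] at hnd
      exact hnd.1 (by simp [hx])) (hW.symm.trans hW')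
  exact hm

theorem Growth.ne {P S : List β} {x y : β} {cs : List Cell}
    (h : Growth pos (P ++ [x, y] ++ S) cs) : x ≠ y := by
  rintro rfl
  have := h.nodup
  simp [List.nodup_append] at this

/-- The largest letter `m` is removed. If it precedes the pair, it passes through both cells without
changing their comparison; if it follows the pair, the two cells are unaffected. If it belongs to
the pair, its own cell is in row `0`: as second letter it gives an ascent, as first letter it sends
the next new cell to a positive row. -/
theorem signedLT_iff_row_le_of_pos (n : ℕ)
    (ih : ∀ (pos : β → Bool) (P S : List β) (x y : β) (ps ss : List Cell) (a b : Cell),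
      P.length + S.length < n → Growth pos (P ++ [x, y] ++ S) (ps ++ [a, b] ++ ss) →
      ps.length = P.length → (SignedLT pos x y ↔ b.1 ≤ a.1))
    {P S U V : List β} {x y m : β} {ps ss : List Cell} {a b : Cell}
    (hn : P.length + S.length = n)
    (h : Growth pos (P ++ [x, y] ++ S) (ps ++ [a, b] ++ ss)) (hps : ps.length = P.length)
    (hW : P ++ [x, y] ++ S = U ++ m :: V) (hm : ∀ x ∈ U ++ V, x < m) (hpm : pos m = true) :
    SignedLT pos x y ↔ b.1 ≤ a.1 := by
  have hne := h.ne
  have hnd := h.nodup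
  rcases exists_split_of_mem (show m ∈ P ++ [x, y] ++ S by rw [hW]; simp) with
    ⟨P₁, P₂, rfl⟩ | ⟨M₁, M₂, hM⟩ | ⟨S₁, S₂, rfl⟩
  · have hm2 := lt_of_max (U' := P₁) (V' := P₂ ++ [x, y] ++ S) hnd hW hm (by simp)
    rw [← List.append_assoc, ← List.append_assoc] at hm2
    obtain ⟨qs, bs, ts, q₁, q₂, q₃, hg, l1, l2, hq, hp, -, -, -⟩ := h.left hm2 hps (by simp)
    obtain ⟨c, d, rfl⟩ : ∃ c d, bs = [c, d] := List.length_eq_two.1 (by simpa using l2)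
    have hpath := hg.isPath
    rw [isPath_append, isPath_append] at hpath
    rw [hpm] at hp
    rw [hp.row_le_iff hq hpath.1.2]
    exact ih pos _ _ _ _ _ _ _ _ (by simp at hn ⊢; omega) hg l1
  · match M₁, hM with
    | [], hM =>
      simp only [List.nil_append, List.cons.injEq] at hM
      obtain ⟨rfl, -⟩ := hM
      have hm2 := lt_of_max (U' := P) (V' := y :: S) hnd hW hm (by simp)
      have hxy : y < x := hm2 y (by simp)
      have h1 : ¬ SignedLT pos x y := (signedLT_of_pos hpm hxy).asymm
      simp only [h1, false_iff, not_le]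
      rw [show P ++ [x, y] ++ S = P ++ x :: (y :: S) by simp] at h
      obtain ⟨us, vs, vs', s, q, e, hg, hl, hs, h0, hp⟩ := h.inv hm2
      obtain ⟨rfl, e₂⟩ := List.append_inj (show ps ++ (a :: b :: ss) = us ++ s :: vs' by simpa using e)
        (by omega)
      simp only [List.cons.injEq] at e₂
      obtain ⟨rfl, rfl⟩ := e₂
      have := hg.length_eq
      match vs, this with
      | [], h => simp at h; omega
      | c :: cs, _ =>
        have hpath := hg.isPath
        rw [isPath_append] at hpath
        rw [hpm] at hp h0
        rw [if_pos rfl] at h0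
        rw [h0]
        exact hp.row_pos hs hpath.2.1 h0
    | [x'], hM =>
      simp only [List.cons_append, List.nil_append, List.cons.injEq] at hM
      obtain ⟨rfl, rfl, -⟩ := hM
      have hm2 := lt_of_max (U' := P ++ [x]) (V' := S) hnd hW hm (by simp)
      have hxy : x < y := hm2 x (by simp)
      simp only [signedLT_of_pos hpm hxy, true_iff]
      rw [show P ++ [x, y] ++ S = (P ++ [x]) ++ y :: S by simp] at h
      obtain ⟨us, vs, vs', s, q, e, hg, hl, hs, h0, hp⟩ := h.inv hm2
      obtain ⟨rfl, e₂⟩ := List.append_inj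
        (show (ps ++ [a]) ++ (b :: ss) = us ++ s :: vs' by simpa using e) (by simp at hl ⊢; omega)
      simp only [List.cons.injEq] at e₂
      obtain ⟨rfl, rfl⟩ := e₂
      rw [hpm, if_pos rfl] at h0
      omega
    | _ :: _ :: M, hM =>
      have := congrArg List.length hM
      simp at this
  · have hm2 := lt_of_max (U' := P ++ [x, y] ++ S₁) (V' := S₂) hnd hW hm (by simp)
    rw [List.append_assoc] at hm2
    obtain ⟨ts, hg, -⟩ := h.right hm2 hps (by simp)
    exact ih pos _ _ _ _ _ _ _ _ (by simp at hn ⊢; omega) hg hps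

theorem Growth.isPath_mid {P : List β} {ps as ss : List Cell}
    (h : Growth pos P (ps ++ as ++ ss)) : IsPath (addCells ∅ ps) as := by
  have := h.isPath
  rw [isPath_append, isPath_append] at this
  exact this.1.2

/-- Consecutive letters form an ascent exactly if the second new cell is not below the first. -/
theorem Growth.signedLT_iff_row_le {P S : List β} {x y : β} {ps ss : List Cell} {a b : Cell}
    (h : Growth pos (P ++ [x, y] ++ S) (ps ++ [a, b] ++ ss)) (hps : ps.length = P.length) :
    SignedLT pos x y ↔ b.1 ≤ a.1 := by
  induction hn : P.length + S.length using Nat.strong_induction_on generalizing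
    pos P S x y ps ss a b with
  | _ n ih =>
    have ih' : ∀ (pos : β → Bool) (P S : List β) (x y : β) (ps ss : List Cell) (a b : Cell),
        P.length + S.length < n → Growth pos (P ++ [x, y] ++ S) (ps ++ [a, b] ++ ss) →
        ps.length = P.length → (SignedLT pos x y ↔ b.1 ≤ a.1) :=
      fun pos P S x y ps ss a b hlt hg hl => ih _ hlt hg hl rfl
    obtain ⟨U, V, m, hW, hm⟩ := h.exists_max (by simp)
    by_cases hpm : pos m = true
    · exact signedLT_iff_row_le_of_pos n ih' hn h hps hW hm hpm
    -- For a letter inserted by columns the statement is transposed. Both the signed order and the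
    -- comparison of cells are reversed, so the equivalence becomes one between the negations.
    · have h' := h.swap
      have := signedLT_iff_row_le_of_pos n ih' (ps := ps.map Prod.swap) (ss := ss.map Prod.swap)
        (a := a.swap) (b := b.swap) hn (by simpa using h') (by simpa using hps) hW hm
        (by simpa using hpm)
      rw [signedLT_not] at this
      simp only [Prod.fst_swap] at this
      have h3 := h.isPath_mid.row_le_iff
      rw [h3, ← not_le, ← this]
      constructor
      · exact fun h => h.asymm
      · exact fun hn => (SignedLT.total h.ne).resolve_right hn

end Knuth

end ShiftedInsertion

namespace ShiftedInsertion

/-! ### Knuth relations and dual equivalence of growth -/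

section Knuth

variable {β : Type} [LinearOrder β] {pos : β → Bool}

theorem low_addCells_empty {cs : List Cell} (h : IsPath ∅ cs) : Low (addCells ∅ cs) :=
  h.low low_empty

theorem Pass.exists_pair {t : Bool} {A : Set Cell} {q q' a b : Cell} {cs : List Cell}
    (h : Pass t A q [a, b] q' cs) : ∃ a' b', cs = [a', b'] :=
  List.length_eq_two.1 h.length_eq

/-- The case of a Knuth relation in which the largest letter jumps over the smaller of two ascending
letters. Both growths come from the same growth of the word without `m`. -/
theorem Growth.ins_max_ascent {P S : List β} {x y m : β} {ps ts : List Cell} {c₁ c₂ : Cell}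
    (h : Growth pos (P ++ [x, y] ++ S) (ps ++ [c₁, c₂] ++ ts)) (hps : ps.length = P.length)
    (hm : ∀ z ∈ P ++ [x, y] ++ S, z < m) (hpm : pos m = true) (hxy : SignedLT pos x y) :
    ∃ a₁ a₂ a₃ b₁ b₂ b₃ ss, Growth pos (P ++ [x, m, y] ++ S) (ps ++ [a₁, a₂, a₃] ++ ss) ∧
      Growth pos (P ++ [m, x, y] ++ S) (ps ++ [b₁, b₂, b₃] ++ ss) ∧
      DualEquiv a₁.1 a₂.1 a₃.1 b₁.1 b₂.1 b₃.1 := by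
  have hrow := (h.signedLT_iff_row_le hps).1 hxy
  have hpath := h.isPath
  rw [isPath_append, isPath_append] at hpath
  obtain ⟨⟨hp1, hc1, hc2, -⟩, hp3⟩ := hpath
  have hA := low_addCells_empty hp1
  obtain ⟨s₀, hs₀, e₀⟩ := exists_addable_row_zero hA (finite_addCells ps)
  obtain ⟨s₁, hs₁, e₁⟩ := exists_addable_row_zero (A := addCells ∅ (ps ++ [c₁]))
    (by simpa using hc1.2.2) (finite_addCells _)
  obtain ⟨q₀, bs, hq₀⟩ := exists_pass_true hs₀ (cs := [c₁, c₂]) ⟨hc1, hc2, trivial⟩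
  obtain ⟨q₁, as, hq₁⟩ := exists_pass_true hs₁ (cs := [c₂]) ⟨by simpa using hc2, trivial⟩
  obtain ⟨b₂, b₃, rfl⟩ := hq₀.exists_pair
  obtain ⟨a₃, rfl⟩ := List.length_eq_one_iff.1 hq₁.length_eq
  have r₀ := hq₀.rows hs₀ ⟨hc1, hc2, trivial⟩
  have r₁ := hq₁.rows hs₁ ⟨by simpa using hc2, trivial⟩
  obtain ⟨t₀, -, -⟩ := hq₀.isPath hs₀ ⟨hc1, hc2, trivial⟩
  obtain ⟨t₁, -, -⟩ := hq₁.isPath hs₁ ⟨by simpa using hc2, trivial⟩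
  -- Both starting cells lie in row `0` and `c₂` is not below `c₁`. If `c₁` is in row `0`, then so
  -- is `c₂`, and the last two rows are exchanged; otherwise the first two are. The final rows
  -- agree, which makes the remaining journey the same.
  have key : q₀.1 = q₁.1 ∧ DualEquiv c₁.1 s₁.1 a₃.1 s₀.1 b₂.1 b₃.1 := by
    simp only [List.map_cons, List.map_nil, rowPass, e₀, e₁] at r₀ r₁
    rw [e₀, e₁]
    unfold DualEquiv
    split_ifs at r₀ r₁ <;> simp only [Prod.mk.injEq, List.cons.injEq] at r₀ r₁ <;> omega
  have hq : q₀ = q₁ := by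
    refine t₀.eq_of_row ?_ key.1
    simpa using t₁
  subst hq
  obtain ⟨q', ss, hq'⟩ := exists_pass_true t₀ (cs := ts) (by simpa using hp3)
  refine ⟨c₁, s₁, a₃, s₀, b₂, b₃, ss, ?_, ?_, key.2⟩
  · rw [show P ++ [x, m, y] ++ S = (P ++ [x]) ++ m :: (y :: S) by simp,
      show ps ++ [c₁, s₁, a₃] ++ ss = (ps ++ [c₁]) ++ s₁ :: ([a₃] ++ ss) by simp]
    refine .ins (vs := [c₂] ++ ts) (q := q') (by simpa using hm) (by simpa using h) (by simp [hps])
      hs₁ (by simpa [hpm] using e₁) ?_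
    rw [hpm, pass_append]
    exact ⟨_, _, _, hq₁, by simpa using hq', rfl⟩
  · rw [show P ++ [m, x, y] ++ S = P ++ m :: ([x, y] ++ S) by simp,
      show ps ++ [s₀, b₂, b₃] ++ ss = ps ++ s₀ :: ([b₂, b₃] ++ ss) by simp]
    refine .ins (vs := [c₁, c₂] ++ ts) (q := q') (by simpa using hm) (by simpa using h) hps
      hs₀ (by simpa [hpm] using e₀) ?_
    rw [hpm, pass_append]
    exact ⟨_, _, _, hq₀, hq', rfl⟩

/-- Here `c₂` is strictly below `c₁`, hence not in row `0`. It does not collide with the starting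
cell of `m`, so the two cells commute. -/
theorem Growth.ins_max_descent {P S : List β} {x y m : β} {ps ts : List Cell} {c₁ c₂ : Cell}
    (h : Growth pos (P ++ [y, x] ++ S) (ps ++ [c₁, c₂] ++ ts)) (hps : ps.length = P.length)
    (hm : ∀ z ∈ P ++ [y, x] ++ S, z < m) (hpm : pos m = true) (hxy : SignedLT pos x y) :
    ∃ a₁ a₂ a₃ b₁ b₂ b₃ ss, Growth pos (P ++ [y, m, x] ++ S) (ps ++ [a₁, a₂, a₃] ++ ss) ∧
      Growth pos (P ++ [y, x, m] ++ S) (ps ++ [b₁, b₂, b₃] ++ ss) ∧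
      DualEquiv a₁.1 a₂.1 a₃.1 b₁.1 b₂.1 b₃.1 := by
  have hrow := mt (h.signedLT_iff_row_le hps).2 hxy.asymm
  have hpath := h.isPath
  rw [isPath_append, isPath_append] at hpath
  obtain ⟨⟨hp1, hc1, hc2, -⟩, hp3⟩ := hpath
  obtain ⟨s₁, hs₁, e₁⟩ := exists_addable_row_zero (A := addCells ∅ (ps ++ [c₁]))
    (by simpa using hc1.2.2) (finite_addCells _)
  have hc2' : Addable (addCells ∅ (ps ++ [c₁])) c₂ := by simpa using hc2
  have hne : c₂ ≠ s₁ := by rintro rfl; omega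
  have hs₂ : Addable (addCells ∅ (ps ++ [c₁, c₂])) s₁ := by simpa using hc2'.comm hs₁ hne
  obtain ⟨q', ss, hq'⟩ := exists_pass_true hs₂ (cs := ts) (by simpa using hp3)
  refine ⟨c₁, s₁, c₂, c₁, c₂, s₁, ss, ?_, ?_, Or.inl ⟨rfl, rfl, rfl, by omega⟩⟩
  · rw [show P ++ [y, m, x] ++ S = (P ++ [y]) ++ m :: (x :: S) by simp,
      show ps ++ [c₁, s₁, c₂] ++ ss = (ps ++ [c₁]) ++ s₁ :: (c₂ :: ss) by simp]
    refine .ins (vs := c₂ :: ts) (q := q') (by simpa using hm) (by simpa using h) (by simp [hps])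
      hs₁ (by simpa [hpm] using e₁) ?_
    rw [hpm]
    exact .keep hne (by simpa using hq')
  · rw [show P ++ [y, x, m] ++ S = (P ++ [y, x]) ++ m :: S by simp,
      show ps ++ [c₁, c₂, s₁] ++ ss = (ps ++ [c₁, c₂]) ++ s₁ :: ss by simp]
    exact .ins (vs := ts) (q := q') (by simpa using hm) (by simpa using h) (by simp [hps])
      hs₂ (by simpa [hpm] using e₁) (by rw [hpm]; exact hq')

/-- `t` lies strictly between `x` and `y` in the signed order. -/
def Between (pos : β → Bool) (t x y : β) : Prop :=
  SignedLT pos x t ∧ SignedLT pos t y ∨ SignedLT pos y t ∧ SignedLT pos t x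

/-- A Knuth relation between two words with three letters. -/
def KnuthRel (pos : β → Bool) (x₁ x₂ x₃ y₁ y₂ y₃ : β) : Prop :=
  (x₁ = y₂ ∧ x₂ = y₁ ∧ x₃ = y₃ ∧ Between pos x₃ x₁ x₂) ∨
  (x₁ = y₁ ∧ x₂ = y₃ ∧ x₃ = y₂ ∧ Between pos x₁ x₂ x₃)

theorem between_not {t x y : β} : Between (fun x => !pos x) t x y ↔ Between pos t x y := by
  unfold Between
  simp only [signedLT_not]
  tauto

theorem knuthRel_not {x₁ x₂ x₃ y₁ y₂ y₃ : β} :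
    KnuthRel (fun x => !pos x) x₁ x₂ x₃ y₁ y₂ y₃ ↔ KnuthRel pos x₁ x₂ x₃ y₁ y₂ y₃ := by
  unfold KnuthRel
  simp only [between_not]

/-- Removing the largest letter from a word, in terms of growth. -/
theorem Growth.erase_max {U V : List β} {m : β} {cs : List Cell} (h : Growth pos (U ++ m :: V) cs)
    (hm : ∀ x ∈ U ++ V, x < m) {ps rs : List Cell} {P : List β} (hU : P <+: U) (hcs : cs = ps ++ rs)
    (hps : ps.length = P.length) : ∃ rs', Growth pos (U ++ V) (ps ++ rs') := by
  obtain ⟨us, vs, vs', s, q, e, hg, hl, -⟩ := h.inv hm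
  obtain ⟨R, rfl⟩ := hU
  obtain ⟨us, ws, rfl, hl'⟩ : ∃ u w, us = u ++ w ∧ u.length = P.length :=
    ⟨us.take P.length, us.drop P.length, by simp, by simp at hl ⊢; omega⟩
  rw [hcs, List.append_assoc] at e
  obtain ⟨rfl, -⟩ := List.append_inj e (by omega)
  exact ⟨ws ++ vs, by simpa using hg⟩

/-- A largest letter inserted by rows is also the largest one in the signed order, so it is never
the intermediate letter of the relation. It is one of the two exchanged letters, and the remaining
two form an ascent or a descent. -/
theorem Growth.knuth_mid {P S : List β} {x₁ x₂ x₃ y₁ y₂ y₃ m : β} {ps ss : List Cell}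
    {a₁ a₂ a₃ : Cell} (h : Growth pos (P ++ [x₁, x₂, x₃] ++ S) (ps ++ [a₁, a₂, a₃] ++ ss))
    (hps : ps.length = P.length) (hk : KnuthRel pos x₁ x₂ x₃ y₁ y₂ y₃)
    (hmax : ∀ z ∈ P ++ [x₁, x₂, x₃] ++ S, z ≠ m → z < m) (hmem : m ∈ [x₁, x₂, x₃])
    (hpm : pos m = true) :
    ∃ b₁ b₂ b₃, Growth pos (P ++ [y₁, y₂, y₃] ++ S) (ps ++ [b₁, b₂, b₃] ++ ss) ∧
      DualEquiv a₁.1 a₂.1 a₃.1 b₁.1 b₂.1 b₃.1 := by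
  have hnd := h.nodup
  have hne : ∀ z ∈ [x₁, x₂, x₃], z ≠ m → SignedLT pos z m := fun z hz hne =>
    signedLT_of_pos hpm (hmax z (by simp at hz ⊢; tauto) hne)
  have hd : x₁ ≠ x₂ ∧ x₁ ≠ x₃ ∧ x₂ ≠ x₃ := by
    rw [List.append_assoc, List.nodup_append, List.nodup_append] at hnd
    have := hnd.2.1.1
    simp at this
    tauto
  -- the window with the largest letter inserted in the first or second position
  have first : ∀ {x y : β} {T T' : List β}, T = P ++ [x, m, y] ++ S → T' = P ++ [m, x, y] ++ S →
      SignedLT pos x y → T.Nodup → (∀ z ∈ T, z ≠ m → z < m) → ∀ {cs : List Cell},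
      (Growth pos T (ps ++ cs) ∨ Growth pos T' (ps ++ cs)) →
      ∃ a₁ a₂ a₃ b₁ b₂ b₃ ss, Growth pos T (ps ++ [a₁, a₂, a₃] ++ ss) ∧
      Growth pos T' (ps ++ [b₁, b₂, b₃] ++ ss) ∧ DualEquiv a₁.1 a₂.1 a₃.1 b₁.1 b₂.1 b₃.1 := by
    rintro x y T T' rfl rfl hxy hnd hmax cs hg
    rw [show P ++ [x, m, y] ++ S = (P ++ [x]) ++ m :: (y :: S) by simp, List.nodup_middle,
      List.nodup_cons] at hnd
    have hm : ∀ z ∈ P ++ [x] ++ y :: S, z < m := fun z hz =>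
      hmax z (by simp at hz ⊢; tauto) (by rintro rfl; exact hnd.1 hz)
    obtain ⟨rs, hg'⟩ : ∃ rs, Growth pos (P ++ [x, y] ++ S) (ps ++ rs) := by
      rcases hg with hg | hg
      · rw [show P ++ [x, m, y] ++ S = (P ++ [x]) ++ m :: (y :: S) by simp] at hg
        simpa using hg.erase_max hm (P := P) (by simp) rfl hps
      · rw [show P ++ [m, x, y] ++ S = P ++ m :: (x :: y :: S) by simp] at hg
        simpa using hg.erase_max (by simpa using hm) (P := P) (by simp) rfl hps
    obtain ⟨ps', c₁, c₂, ts, e, hl⟩ := hg'.split_pair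
    rw [List.append_assoc] at e
    obtain ⟨rfl, rfl⟩ := List.append_inj e (by omega)
    exact Growth.ins_max_ascent (by simpa using hg') hps (by simpa using hm) hpm hxy
  have second : ∀ {x y : β} {T T' : List β}, T = P ++ [y, m, x] ++ S → T' = P ++ [y, x, m] ++ S →
      SignedLT pos x y → T.Nodup → (∀ z ∈ T, z ≠ m → z < m) → ∀ {cs : List Cell},
      (Growth pos T (ps ++ cs) ∨ Growth pos T' (ps ++ cs)) →
      ∃ a₁ a₂ a₃ b₁ b₂ b₃ ss, Growth pos T (ps ++ [a₁, a₂, a₃] ++ ss) ∧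
      Growth pos T' (ps ++ [b₁, b₂, b₃] ++ ss) ∧ DualEquiv a₁.1 a₂.1 a₃.1 b₁.1 b₂.1 b₃.1 := by
    rintro x y T T' rfl rfl hxy hnd hmax cs hg
    rw [show P ++ [y, m, x] ++ S = (P ++ [y]) ++ m :: (x :: S) by simp, List.nodup_middle,
      List.nodup_cons] at hnd
    have hm : ∀ z ∈ P ++ [y] ++ x :: S, z < m := fun z hz =>
      hmax z (by simp at hz ⊢; tauto) (by rintro rfl; exact hnd.1 hz)
    obtain ⟨rs, hg'⟩ : ∃ rs, Growth pos (P ++ [y, x] ++ S) (ps ++ rs) := by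
      rcases hg with hg | hg
      · rw [show P ++ [y, m, x] ++ S = (P ++ [y]) ++ m :: (x :: S) by simp] at hg
        simpa using hg.erase_max hm (P := P) (by simp) rfl hps
      · rw [show P ++ [y, x, m] ++ S = (P ++ [y, x]) ++ m :: S by simp] at hg
        simpa using hg.erase_max (by simpa using hm) (P := P) (by simp) rfl hps
    obtain ⟨ps', c₁, c₂, ts, e, hl⟩ := hg'.split_pair
    rw [List.append_assoc] at e
    obtain ⟨rfl, rfl⟩ := List.append_inj e (by omega)
    exact Growth.ins_max_descent (by simpa using hg') hps (by simpa using hm) hpm hxy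
  -- The growth rebuilt from the word without `m` is the given one, by uniqueness.
  have conclude : ∀ {T : List β} {a₁' a₂' a₃' b₁ b₂ b₃ : Cell} {ss' : List Cell},
      Growth pos (P ++ [x₁, x₂, x₃] ++ S) (ps ++ [a₁', a₂', a₃'] ++ ss') →
      Growth pos T (ps ++ [b₁, b₂, b₃] ++ ss') → DualEquiv a₁'.1 a₂'.1 a₃'.1 b₁.1 b₂.1 b₃.1 →
      ∃ b₁ b₂ b₃, Growth pos T (ps ++ [b₁, b₂, b₃] ++ ss) ∧
      DualEquiv a₁.1 a₂.1 a₃.1 b₁.1 b₂.1 b₃.1 := by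
    intro T a₁' a₂' a₃' b₁ b₂ b₃ ss' h1 h2 h3
    have e := h.unique h1
    simp only [List.append_assoc, List.append_cancel_left_eq, List.cons_append, List.nil_append,
      List.cons.injEq] at e
    obtain ⟨rfl, rfl, rfl, rfl⟩ := e
    exact ⟨_, _, _, h2, h3⟩
  have hperm : ∀ {l : List β}, l.Perm [x₁, x₂, x₃] → (P ++ l ++ S).Nodup ∧
      ∀ z ∈ P ++ l ++ S, z ≠ m → z < m := by
    intro l hl
    have hp : (P ++ l ++ S).Perm (P ++ [x₁, x₂, x₃] ++ S) :=
      (hl.append_left P).append_right S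
    exact ⟨hp.nodup_iff.2 hnd, fun z hz => hmax z (hp.mem_iff.1 hz)⟩
  have h' : Growth pos (P ++ [x₁, x₂, x₃] ++ S) (ps ++ ([a₁, a₂, a₃] ++ ss)) := by simpa using h
  simp only [List.mem_cons, List.not_mem_nil, or_false] at hmem
  rcases hk with ⟨rfl, rfl, rfl, hb⟩ | ⟨rfl, rfl, rfl, hb⟩
  · rcases hmem with rfl | rfl | rfl
    · have hb' : SignedLT pos x₂ x₃ := by
        rcases hb with hb | hb
        · exact absurd hb.1 (hne _ (by simp) hd.2.1.symm).asymm
        · exact hb.1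
      have hp := hperm (l := [x₂, m, x₃]) (List.Perm.swap _ _ _)
      obtain ⟨b₁, b₂, b₃, a₁', a₂', a₃', ss', h1, h2, h3⟩ :=
        first rfl rfl hb' hp.1 hp.2 (Or.inr h')
      exact conclude h2 h1 h3.symm
    · have hb' : SignedLT pos x₁ x₃ := by
        rcases hb with hb | hb
        · exact hb.1
        · exact absurd hb.1 (hne _ (by simp) hd.2.2.symm).asymm
      have hp := hperm (l := [x₁, m, x₃]) (List.Perm.refl _)
      obtain ⟨a₁', a₂', a₃', b₁, b₂, b₃, ss', h1, h2, h3⟩ :=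
        first rfl rfl hb' hp.1 hp.2 (Or.inl h')
      exact conclude h1 h2 h3
    -- The intermediate letter would be `m`, which has nothing above it.
    · rcases hb with hb | hb
      · exact absurd hb.2 (hne _ (by simp) hd.2.2).asymm
      · exact absurd hb.2 (hne _ (by simp) hd.2.1).asymm
  · rcases hmem with rfl | rfl | rfl
    · rcases hb with hb | hb
      · exact absurd hb.2 (hne _ (by simp) hd.2.1.symm).asymm
      · exact absurd hb.2 (hne _ (by simp) hd.1.symm).asymm
    · have hb' : SignedLT pos x₃ x₁ := by
        rcases hb with hb | hb
        · exact absurd hb.1 (hne _ (by simp) hd.1).asymm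
        · exact hb.1
      have hp := hperm (l := [x₁, m, x₃]) (List.Perm.refl _)
      obtain ⟨a₁', a₂', a₃', b₁, b₂, b₃, ss', h1, h2, h3⟩ :=
        second rfl rfl hb' hp.1 hp.2 (Or.inl h')
      exact conclude h1 h2 h3
    · have hb' : SignedLT pos x₂ x₁ := by
        rcases hb with hb | hb
        · exact hb.1
        · exact absurd hb.1 (hne _ (by simp) hd.2.1).asymm
      have hp := hperm (l := [x₁, m, x₂]) ((List.Perm.swap _ _ _).cons _)
      obtain ⟨b₁, b₂, b₃, a₁', a₂', a₃', ss', h1, h2, h3⟩ :=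
        second rfl rfl hb' hp.1 hp.2 (Or.inr h')
      exact conclude h2 h1 h3.symm

/-- Outside the window the largest letter reduces to the induction hypothesis: before it, the letter
passes through dual equivalent paths by `rowPass_dualEquiv`; after it, only the common diagram
matters. Inside the window, `knuth_mid` applies. -/
theorem Growth.knuth_of_pos (n : ℕ)
    (ih : ∀ (pos : β → Bool) (P S : List β) (x₁ x₂ x₃ y₁ y₂ y₃ : β) (ps ss : List Cell)
      (a₁ a₂ a₃ : Cell), P.length + S.length < n →
      Growth pos (P ++ [x₁, x₂, x₃] ++ S) (ps ++ [a₁, a₂, a₃] ++ ss) → ps.length = P.length →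
      KnuthRel pos x₁ x₂ x₃ y₁ y₂ y₃ →
      ∃ b₁ b₂ b₃, Growth pos (P ++ [y₁, y₂, y₃] ++ S) (ps ++ [b₁, b₂, b₃] ++ ss) ∧
        DualEquiv a₁.1 a₂.1 a₃.1 b₁.1 b₂.1 b₃.1)
    {P S U V : List β} {x₁ x₂ x₃ y₁ y₂ y₃ m : β} {ps ss : List Cell} {a₁ a₂ a₃ : Cell}
    (hn : P.length + S.length = n)
    (h : Growth pos (P ++ [x₁, x₂, x₃] ++ S) (ps ++ [a₁, a₂, a₃] ++ ss))
    (hps : ps.length = P.length) (hk : KnuthRel pos x₁ x₂ x₃ y₁ y₂ y₃)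
    (hW : P ++ [x₁, x₂, x₃] ++ S = U ++ m :: V) (hm : ∀ x ∈ U ++ V, x < m) (hpm : pos m = true) :
    ∃ b₁ b₂ b₃, Growth pos (P ++ [y₁, y₂, y₃] ++ S) (ps ++ [b₁, b₂, b₃] ++ ss) ∧
      DualEquiv a₁.1 a₂.1 a₃.1 b₁.1 b₂.1 b₃.1 := by
  have hnd := h.nodup
  have hmem : ∀ x ∈ [y₁, y₂, y₃], x ∈ [x₁, x₂, x₃] := by
    rcases hk with ⟨rfl, rfl, rfl, -⟩ | ⟨rfl, rfl, rfl, -⟩ <;> simp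
  rcases exists_split_of_mem (show m ∈ P ++ [x₁, x₂, x₃] ++ S by rw [hW]; simp) with
    ⟨P₁, P₂, rfl⟩ | ⟨M₁, M₂, hM⟩ | ⟨S₁, S₂, rfl⟩
  · have hm2 := lt_of_max (U' := P₁) (V' := P₂ ++ [x₁, x₂, x₃] ++ S) hnd hW hm (by simp)
    rw [← List.append_assoc, ← List.append_assoc] at hm2
    obtain ⟨qs, bs, ts, q₁, q₂, q₃, hg, l1, l2, hq, hp, hp', hps', hcl⟩ := h.left hm2 hps (by simp)
    obtain ⟨c₁, c₂, c₃, rfl⟩ := List.length_eq_three.1 l2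
    rw [hpm] at hp hp' hcl
    obtain ⟨d₁, d₂, d₃, hg', hd⟩ :=
      ih pos _ _ _ _ _ _ _ _ _ _ _ _ _ (by simp at hn ⊢; omega) hg l1 hk
    have hpc := hg.isPath_mid
    have hpd := hg'.isPath_mid
    obtain ⟨q₂', bs', hq₂⟩ := exists_pass_true hq hpd
    obtain ⟨b₁, b₂, b₃, rfl⟩ := List.length_eq_three.1 hq₂.length_eq
    obtain ⟨e1, e2⟩ := rowPass_dualEquiv _ hd (hp.rows hq hpc) (hq₂.rows hq hpd)
    obtain ⟨t1, -⟩ := hp.isPath hq hpc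
    obtain ⟨t2, -⟩ := hq₂.isPath hq hpd
    have hAA := hd.addCells_eq hpc hpd
    rw [hAA] at t1
    -- The two journeys leave the window in the same row of the same diagram, hence in the same
    -- cell. The part of the growth coming from `S` is therefore shared.
    obtain rfl := t1.eq_of_row t2 e1
    refine ⟨b₁, b₂, b₃, hcl _ _ _ _ q₃ _ hg' ?_ hq₂ ?_, e2⟩
    · intro z hz
      exact hm2 z (by have := hmem z hz; simp only [List.mem_append]; tauto)
    · rw [addCells_append, ← hAA, ← addCells_append]
      exact hp'
  · refine h.knuth_mid hps hk ?_ (hM ▸ by simp) hpm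
    intro z hz hne
    rw [hW] at hz
    exact hm z (by simp at hz ⊢; tauto)
  · have hm2 := lt_of_max (U' := P ++ [x₁, x₂, x₃] ++ S₁) (V' := S₂) hnd hW hm (by simp)
    rw [List.append_assoc] at hm2
    obtain ⟨ts, hg, hcl⟩ := h.right hm2 hps (by simp)
    obtain ⟨d₁, d₂, d₃, hg', hd⟩ :=
      ih pos _ _ _ _ _ _ _ _ _ _ _ _ _ (by simp at hn ⊢; omega) hg hps hk
    refine ⟨d₁, d₂, d₃, hcl _ _ hg' ?_ (by simp) ?_, hd⟩
    · intro z hz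
      exact hm2 z (by have := hmem z hz; simp only [List.mem_append]; tauto)
    · exact (hd.addCells_eq hg.isPath_mid hg'.isPath_mid).symm

/-- Growth along a word is compatible with Knuth relations. -/
theorem Growth.knuth {P S : List β} {x₁ x₂ x₃ y₁ y₂ y₃ : β} {ps ss : List Cell} {a₁ a₂ a₃ : Cell}
    (h : Growth pos (P ++ [x₁, x₂, x₃] ++ S) (ps ++ [a₁, a₂, a₃] ++ ss))
    (hps : ps.length = P.length) (hk : KnuthRel pos x₁ x₂ x₃ y₁ y₂ y₃) :
    ∃ b₁ b₂ b₃, Growth pos (P ++ [y₁, y₂, y₃] ++ S) (ps ++ [b₁, b₂, b₃] ++ ss) ∧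
      DualEquiv a₁.1 a₂.1 a₃.1 b₁.1 b₂.1 b₃.1 := by
  induction hn : P.length + S.length using Nat.strong_induction_on generalizing
    pos P S x₁ x₂ x₃ y₁ y₂ y₃ ps ss a₁ a₂ a₃ with
  | _ n ih =>
    have ih' : ∀ (pos : β → Bool) (P S : List β) (x₁ x₂ x₃ y₁ y₂ y₃ : β) (ps ss : List Cell)
        (a₁ a₂ a₃ : Cell), P.length + S.length < n →
        Growth pos (P ++ [x₁, x₂, x₃] ++ S) (ps ++ [a₁, a₂, a₃] ++ ss) → ps.length = P.length →
        KnuthRel pos x₁ x₂ x₃ y₁ y₂ y₃ →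
        ∃ b₁ b₂ b₃, Growth pos (P ++ [y₁, y₂, y₃] ++ S) (ps ++ [b₁, b₂, b₃] ++ ss) ∧
          DualEquiv a₁.1 a₂.1 a₃.1 b₁.1 b₂.1 b₃.1 :=
      fun pos P S _ _ _ _ _ _ ps ss _ _ _ hlt hg hl hk => ih _ hlt hg hl hk rfl
    obtain ⟨U, V, m, hW, hm⟩ := h.exists_max (by simp)
    by_cases hpm : pos m = true
    · exact Growth.knuth_of_pos n ih' hn h hps hk hW hm hpm
    · have h' := h.swap
      obtain ⟨b₁, b₂, b₃, hg, hd⟩ := Growth.knuth_of_pos n ih' (ps := ps.map Prod.swap)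
        (ss := ss.map Prod.swap) (a₁ := a₁.swap) (a₂ := a₂.swap) (a₃ := a₃.swap) hn
        (by simpa using h') (by simpa using hps) (knuthRel_not.2 hk) hW hm (by simpa using hpm)
      refine ⟨b₁.swap, b₂.swap, b₃.swap, ?_, ?_⟩
      · simpa using hg.swap_swap
      -- Undoing the transposition turns columns back into rows; dual equivalence survives by
      -- `DualEquiv.cols`.
      · have hpa : IsPath (addCells ∅ (ps.map Prod.swap)) [a₁.swap, a₂.swap, a₃.swap] :=
          Growth.isPath_mid (ss := ss.map Prod.swap) (by simpa using h')
        exact hd.cols hpa hg.isPath_mid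

end Knuth

end ShiftedInsertion

namespace ShiftedInsertion

/-! ### Growth of shifted diagrams -/

/-- A set of cells on and above the main diagonal, closed under going up and to the left there. -/
def ShiftedLow (A : Set Cell) : Prop :=
  (∀ i j, (i, j) ∈ A → i ≤ j) ∧
    ∀ i j, (i, j) ∈ A → ∀ i' ≤ i, ∀ j' ≤ j, i' ≤ j' → (i', j') ∈ A

/-- Adding the cell `p` to the shifted diagram `A` gives a shifted diagram. -/
def ShiftedAddable (A : Set Cell) (p : Cell) : Prop :=
  ShiftedLow A ∧ p ∉ A ∧ ShiftedLow (insert p A)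

theorem ShiftedAddable.le {A : Set Cell} {p : Cell} (h : ShiftedAddable A p) : p.1 ≤ p.2 :=
  h.2.2.1 p.1 p.2 (by simp)

theorem ShiftedAddable.lt_mem {A : Set Cell} {p : Cell} (h : ShiftedAddable A p) {i j : ℕ}
    (hij : i ≤ j) (hi : i ≤ p.1) (hj : j ≤ p.2) (hne : i < p.1 ∨ j < p.2) : (i, j) ∈ A := by
  obtain ⟨a, b⟩ := p
  rcases h.2.2.2 a b (by simp) i hi j hj hij with h | h
  · simp only [Prod.mk.injEq] at h; simp at hne; omega
  · exact h

theorem shiftedAddable_of {A : Set Cell} {p : Cell} (hA : ShiftedLow A) (hp : p ∉ A)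
    (hle : p.1 ≤ p.2) (h1 : ∀ i < p.1, (i, p.2) ∈ A) (h2 : ∀ j < p.2, p.1 ≤ j → (p.1, j) ∈ A) :
    ShiftedAddable A p := by
  refine ⟨hA, hp, ?_, ?_⟩
  · rintro i j (h | h)
    · obtain rfl : (i, j) = p := h
      exact hle
    · exact hA.1 i j h
  · intro i j hij i' hi' j' hj' hle'
    obtain ⟨a, b⟩ := p
    rcases hij with hij | hij
    · simp only [Prod.mk.injEq] at hij
      obtain ⟨rfl, rfl⟩ := hij
      by_cases e1 : i' < i
      · exact Or.inr (hA.2 _ _ (h1 i' e1) i' le_rfl j' hj' hle')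
      · obtain rfl : i' = i := by omega
        by_cases e2 : j' < j
        · exact Or.inr (h2 j' e2 hle')
        · left; simp; omega
    · exact Or.inr (hA.2 _ _ hij i' hi' j' hj' hle')

theorem ShiftedAddable.comm {A : Set Cell} {p p' : Cell} (h : ShiftedAddable A p)
    (h' : ShiftedAddable A p') (e : p ≠ p') : ShiftedAddable (insert p A) p' := by
  refine ⟨h.2.2, by simp [h'.2.1, e.symm], ?_, ?_⟩
  · rintro i j (hij | hij | hij)
    · exact h'.2.2.1 i j (Or.inl hij)
    · exact h.2.2.1 i j (Or.inl hij)
    · exact h.1.1 i j hij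
  · intro i j hij i' hi j' hj hle
    rcases hij with hij | hij | hij
    · rcases h'.2.2.2 i j (Or.inl hij) i' hi j' hj hle with h | h
      · exact Or.inl h
      · exact Or.inr (Or.inr h)
    · exact Or.inr (h.2.2.2 i j (Or.inl hij) i' hi j' hj hle)
    · exact Or.inr (h.2.2.2 i j (Or.inr hij) i' hi j' hj hle)

/-- The cells of the list can be added to `A` one after the other. -/
def IsShiftedPath : Set Cell → List Cell → Prop
  | _, [] => True
  | A, c :: cs => ShiftedAddable A c ∧ IsShiftedPath (insert c A) cs

theorem isShiftedPath_append {A : Set Cell} {cs ds : List Cell} :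
    IsShiftedPath A (cs ++ ds) ↔ IsShiftedPath A cs ∧ IsShiftedPath (addCells A cs) ds := by
  induction cs generalizing A with
  | nil => simp [IsShiftedPath]
  | cons c cs ih => simp [IsShiftedPath, ih, and_assoc]

/-- A letter bumped out of `q`, primed unless `u` holds, is placed in `n`, primed unless `u'`
holds. -/
def ShiftedNext (q : Cell) (u : Bool) (n : Cell) (u' : Bool) : Prop :=
  if u = true ∧ q.1 ≠ q.2 then n.1 = q.1 + 1 ∧ u' = true else n.2 = q.2 + 1 ∧ u' = false

/-- The largest letter, initially in the cell `q`, moves while the smaller letters fill the cells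
`cs` one after the other. -/
inductive ShiftedPass :
    Set Cell → Cell → Bool → List Cell → Cell → Bool → List Cell → Prop
  | nil (A : Set Cell) (q : Cell) (u : Bool) : ShiftedPass A q u [] q u []
  | keep {A : Set Cell} {q c q' : Cell} {u u' : Bool} {cs cs' : List Cell} (h : c ≠ q)
      (hp : ShiftedPass (insert c A) q u cs q' u' cs') :
      ShiftedPass A q u (c :: cs) q' u' (c :: cs')
  | bump {A : Set Cell} {q n q' : Cell} {u v u' : Bool} {cs cs' : List Cell}
      (hn : ShiftedAddable (insert q A) n) (hl : ShiftedNext q u n v)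
      (hp : ShiftedPass (insert q A) n v cs q' u' cs') :
      ShiftedPass A q u (q :: cs) q' u' (n :: cs')

/-- Primed letters are not on the main diagonal. -/
def OffDiag (q : Cell) (u : Bool) : Prop := u = false → q.1 < q.2

/-- If a letter sent to the next column landed on the diagonal, the cell above it would already be
filled. That cell lies weakly below and to the right of `q`, so `q` would have belonged to `A`
before. -/
theorem ShiftedNext.offDiag {A : Set Cell} {q n : Cell} {u v : Bool} (hl : ShiftedNext q u n v)
    (hq : ShiftedAddable A q) (hn : ShiftedAddable (insert q A) n) : OffDiag n v := by
  intro hv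
  unfold ShiftedNext at hl
  split_ifs at hl
  · simp [hl.2] at hv
  · have h1 := hn.le
    have h2 := hq.le
    by_contra hlt
    obtain ⟨a, b⟩ := q
    rcases hn.lt_mem (i := b) (j := b + 1) (by omega) (by simp at *; omega) (by simp at *; omega)
      (by simp at *; omega) with h | h
    · simp at h
    · exact hq.2.1 (hq.1.2 _ _ h a h2 b (by omega) h2)

theorem ShiftedPass.isPath {A : Set Cell} {q q' : Cell} {u u' : Bool} {cs cs' : List Cell}
    (h : ShiftedPass A q u cs q' u' cs') (hq : ShiftedAddable A q) (hcs : IsShiftedPath A cs) :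
    ShiftedAddable (addCells A cs) q' ∧ IsShiftedPath (insert q A) cs' ∧
      insert q' (addCells A cs) = addCells (insert q A) cs' := by
  induction h with
  | nil => simpa [IsShiftedPath] using hq
  | keep h _ ih =>
    obtain ⟨h1, h2, h3⟩ := ih (hcs.1.comm hq h) hcs.2
    rw [Set.insert_comm] at h2 h3
    exact ⟨by simpa using h1, ⟨hq.comm hcs.1 h.symm, h2⟩, by simpa using h3⟩
  | bump hn hl _ ih =>
    obtain ⟨h1, h2, h3⟩ := ih hn hcs.2
    exact ⟨by simpa using h1, ⟨hn, h2⟩, by simpa using h3⟩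

theorem ShiftedPass.length_eq {A : Set Cell} {q q' : Cell} {u u' : Bool} {cs cs' : List Cell}
    (h : ShiftedPass A q u cs q' u' cs') : cs'.length = cs.length := by
  induction h <;> simp_all

theorem shiftedPass_append {A : Set Cell} {q q' : Cell} {u u' : Bool} {cs ds es : List Cell} :
    ShiftedPass A q u (cs ++ ds) q' u' es ↔ ∃ q₁ u₁ cs' ds', ShiftedPass A q u cs q₁ u₁ cs' ∧
      ShiftedPass (addCells A cs) q₁ u₁ ds q' u' ds' ∧ es = cs' ++ ds' := by
  induction cs generalizing A q u es with
  | nil =>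
    constructor
    · intro h
      exact ⟨q, u, [], es, .nil _ _ _, by simpa using h, rfl⟩
    · rintro ⟨q₁, u₁, cs', ds', h1, h2, rfl⟩
      cases h1
      simpa using h2
  | cons c cs ih =>
    constructor
    · intro h
      cases h with
      | keep h hp =>
        obtain ⟨q₁, u₁, cs', ds', h1, h2, rfl⟩ := ih.1 hp
        exact ⟨q₁, u₁, c :: cs', ds', .keep h h1, by simpa using h2, rfl⟩
      | bump hn hl hp =>
        obtain ⟨q₁, u₁, cs', ds', h1, h2, rfl⟩ := ih.1 hp
        exact ⟨q₁, u₁, _ :: cs', ds', .bump hn hl h1, by simpa using h2, rfl⟩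
    · rintro ⟨q₁, u₁, cs', ds', h1, h2, rfl⟩
      cases h1 with
      | keep h hp => exact .keep h (ih.2 ⟨_, _, _, _, hp, by simpa using h2, rfl⟩)
      | bump hn hl hp => exact .bump hn hl (ih.2 ⟨_, _, _, _, hp, by simpa using h2, rfl⟩)

/-- The list `cs` records the cells by which the shifted mixed recording tableau grows along the
word `W`. -/
inductive ShiftedGrowth {α : Type} [LinearOrder α] : List α → List Cell → Prop
  | nil : ShiftedGrowth [] []
  | ins {U V : List α} {m : α} {us vs vs' : List Cell} {s q : Cell} {u : Bool}
      (hm : ∀ x ∈ U ++ V, x < m) (hg : ShiftedGrowth (U ++ V) (us ++ vs))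
      (hl : us.length = U.length) (hs : ShiftedAddable (addCells ∅ us) s) (h0 : s.1 = 0)
      (hp : ShiftedPass (addCells ∅ us) s true vs q u vs') :
      ShiftedGrowth (U ++ m :: V) (us ++ s :: vs')

theorem ShiftedGrowth.length_eq {α : Type} [LinearOrder α] {W : List α} {cs : List Cell}
    (h : ShiftedGrowth W cs) : cs.length = W.length := by
  induction h with
  | nil => rfl
  | ins hm hg hl hs h0 hp ih =>
    have := hp.length_eq
    simp at ih ⊢; omega

theorem ShiftedGrowth.isPath {α : Type} [LinearOrder α] {W : List α} {cs : List Cell}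
    (h : ShiftedGrowth W cs) : IsShiftedPath ∅ cs := by
  induction h with
  | nil => trivial
  | ins hm hg hl hs h0 hp ih =>
    rw [isShiftedPath_append] at ih ⊢
    exact ⟨ih.1, hs, (hp.isPath hs ih.2).2.1⟩

/-! ### Doubling -/

/-- The double of a shifted diagram: the diagram moved one step to the right, together with its
reflection in the main diagonal. -/
def double (A : Set Cell) : Set Cell :=
  {p | (p.2, p.1) ∈ A ∨ ∃ c, p.2 = c + 1 ∧ (p.1, c) ∈ A}

/-- The two cells of the double that correspond to a cell. -/
def doubleCell (c : Cell) : List Cell := [(c.2, c.1), (c.1, c.2 + 1)]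

/-- On and below the diagonal the double is the reflected diagram, strictly above it the shifted
one. Going up or left may cross from one part to the other, whence the case distinctions. -/
theorem ShiftedLow.double {A : Set Cell} (h : ShiftedLow A) : Low (double A) := by
  rintro i j (hij | ⟨c, hc, hij⟩) i' hi' j' hj'
  · simp only at hij
    by_cases hle : j' ≤ i'
    · exact Or.inl (h.2 _ _ hij j' hj' i' hi' hle)
    · refine Or.inr ⟨j' - 1, by simp; omega, ?_⟩
      have := h.1 _ _ hij
      exact h.2 _ _ hij i' (by omega) _ (by omega) (by omega)
  · simp only at hij hc
    have := h.1 _ _ hij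
    by_cases hle : j' ≤ i'
    · exact Or.inl (h.2 _ _ hij j' (by omega) i' (by omega) hle)
    · refine Or.inr ⟨j' - 1, by simp; omega, ?_⟩
      exact h.2 _ _ hij i' (by omega) _ (by omega) (by omega)

theorem double_insert (A : Set Cell) (c : Cell) :
    double (insert c A) = insert (c.1, c.2 + 1) (insert (c.2, c.1) (double A)) := by
  obtain ⟨r, k⟩ := c
  ext ⟨i, j⟩
  simp only [double, Set.mem_ofPred_eq, Set.mem_insert_iff, Prod.mk.injEq]
  constructor
  · rintro ((⟨h1, h2⟩ | h) | ⟨c, h1, ⟨h2, h3⟩ | h2⟩)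
    · right; left; omega
    · right; right; left; exact h
    · left; omega
    · right; right; right; exact ⟨c, h1, h2⟩
  · rintro (⟨h1, h2⟩ | ⟨h1, h2⟩ | h | ⟨c, h1, h2⟩)
    · right; exact ⟨k, h2, Or.inl ⟨h1, rfl⟩⟩
    · left; left; exact ⟨h2, h1⟩
    · left; right; exact h
    · right; exact ⟨c, h1, Or.inr h2⟩

theorem mem_double_of_le {A : Set Cell} {i j : ℕ} (hA : ShiftedLow A) (h : j ≤ i) :
    (i, j) ∈ double A ↔ (j, i) ∈ A := by
  constructor
  · rintro (h' | ⟨c, hc, h'⟩)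
    · exact h'
    · have := hA.1 _ _ h'
      simp at hc this; omega
  · exact Or.inl

theorem mem_double_of_lt {A : Set Cell} {i j : ℕ} (hA : ShiftedLow A) (h : i ≤ j) :
    (i, j + 1) ∈ double A ↔ (i, j) ∈ A := by
  constructor
  · rintro (h' | ⟨c, hc, h'⟩)
    · have := hA.1 _ _ h'
      simp at this; omega
    · simp only at hc h'
      obtain rfl : c = j := by omega
      exact h'
  · exact fun h' => Or.inr ⟨j, rfl, h'⟩

theorem ShiftedAddable.double_fst {A : Set Cell} {c : Cell} (h : ShiftedAddable A c) :
    Addable (double A) (c.2, c.1) := by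
  have hle := h.le
  obtain ⟨r, k⟩ := c
  simp only at hle ⊢
  refine addable_of h.1.double ?_ ?_ ?_
  · rw [mem_double_of_le h.1 hle]; exact h.2.1
  · intro i hi
    simp only at hi ⊢
    by_cases hri : r ≤ i
    · rw [mem_double_of_le h.1 hri]
      exact h.lt_mem hri le_rfl hi.le (Or.inr hi)
    · obtain ⟨r', rfl⟩ : ∃ r', r = r' + 1 := ⟨r - 1, by omega⟩
      rw [mem_double_of_lt h.1 (by omega)]
      exact h.lt_mem (by omega) (by simp; omega) (by simp; omega) (by simp; omega)
  · intro j hj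
    simp only at hj ⊢
    rw [mem_double_of_le h.1 (by omega)]
    exact h.lt_mem (by omega) hj.le le_rfl (Or.inl hj)

/-- The order of the two copies matters on the main diagonal, where the second cell is the right
neighbour of the first. -/
theorem ShiftedAddable.double_snd {A : Set Cell} {c : Cell} (h : ShiftedAddable A c) :
    Addable (insert (c.2, c.1) (double A)) (c.1, c.2 + 1) := by
  have hle := h.le
  have hlow := h.double_fst.2.2
  obtain ⟨r, k⟩ := c
  simp only at hle hlow ⊢
  refine addable_of hlow ?_ ?_ ?_
  · rintro (h' | h')
    · simp at h'; omega
    · rw [mem_double_of_lt h.1 hle] at h'; exact h.2.1 h'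
  · intro i hi
    simp only at hi ⊢
    right
    rw [mem_double_of_lt h.1 (by omega)]
    exact h.lt_mem (by omega) hi.le le_rfl (Or.inl hi)
  · intro j hj
    simp only at hj ⊢
    by_cases hrj : r < j
    · right
      obtain ⟨j', rfl⟩ : ∃ j', j = j' + 1 := ⟨j - 1, by omega⟩
      rw [mem_double_of_lt h.1 (by omega)]
      exact h.lt_mem (by omega) le_rfl (by simp; omega) (by simp; omega)
    -- Equality means `j = r = k`: a diagonal cell, whose left neighbour in the double is the copy
    -- just added.
    · by_cases e : (r, j) = (k, r)
      · exact Or.inl e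
      · right
        rw [mem_double_of_le h.1 (by omega)]
        simp only [Prod.mk.injEq, not_and] at e
        exact h.lt_mem (by omega) (by simp; omega) (by simp; omega) (by simp; omega)

/-- A cell that is not weakly above and to the left of `n` has no influence on whether `n` is
addable. -/
theorem Addable.of_insert {A : Set Cell} {e n : Cell} (h : Addable (insert e A) n) (hA : Low A)
    (hne : ¬ (e.1 ≤ n.1 ∧ e.2 ≤ n.2)) : Addable A n := by
  have key : ∀ i j, i ≤ n.1 → j ≤ n.2 → (i, j) ∈ insert e A → (i, j) ∈ A := by
    rintro i j hi hj (h' | h')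
    · obtain rfl : (i, j) = e := h'
      exact absurd ⟨hi, hj⟩ hne
    · exact h'
  exact addable_of hA (fun hm => h.2.1 (Or.inr hm))
    (fun i hi => key _ _ hi.le le_rfl (h.lt_mem hi.le le_rfl (Or.inl hi)))
    (fun j hj => key _ _ le_rfl hj.le (h.lt_mem le_rfl hj.le (Or.inr hj)))

/-- The cell of the double that is occupied by the primed version of a letter. -/
def primedCell (q : Cell) (u : Bool) : Cell := if u then (q.2, q.1) else (q.1, q.2 + 1)

/-- The cell of the double that is occupied by the unprimed version of a letter. -/
def unprimedCell (q : Cell) (u : Bool) : Cell := if u then (q.1, q.2 + 1) else (q.2, q.1)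

/-- A letter travelling in the shifted diagram becomes two travelling letters in the double: first
the primed copy goes by columns, then the unprimed copy goes by rows through the resulting path.
While the letter is unprimed, its primed copy sits in the reflected half; once it has been primed,
the two copies have exchanged halves. -/
theorem ShiftedPass.double {A : Set Cell} {q q' : Cell} {u u' : Bool} {cs cs' : List Cell}
    (h : ShiftedPass A q u cs q' u' cs') (hq : ShiftedAddable A q) (hcs : IsShiftedPath A cs)
    (ho : OffDiag q u) :
    ∃ mid, Pass false (double A) (primedCell q u) (cs.flatMap doubleCell) (primedCell q' u') mid ∧
      Pass true (insert (primedCell q u) (ShiftedInsertion.double A)) (unprimedCell q u) mid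
        (unprimedCell q' u') (cs'.flatMap doubleCell) := by
  induction h with
  | nil => exact ⟨[], .nil _ _, .nil _ _⟩
  | @keep A q c q' u u' cs cs' h _ ih =>
    obtain ⟨mid, h1, h2⟩ := ih (hcs.1.comm hq h) hcs.2 ho
    have l1 := hcs.1.le
    have l2 := hq.le
    have hne : (c.2, c.1) ≠ primedCell q u ∧ (c.1, c.2 + 1) ≠ primedCell q u ∧
        (c.2, c.1) ≠ unprimedCell q u ∧ (c.1, c.2 + 1) ≠ unprimedCell q u := by
      obtain ⟨a, b⟩ := c
      obtain ⟨r, k⟩ := q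
      simp only [Prod.mk.injEq, ne_eq] at h l1 l2
      cases u <;> simp [primedCell, unprimedCell] <;> omega
    rw [double_insert] at h1 h2
    refine ⟨(c.2, c.1) :: (c.1, c.2 + 1) :: mid, .keep hne.1 (.keep hne.2.1 h1),
      .keep hne.2.2.1 (.keep hne.2.2.2 ?_)⟩
    rwa [Set.insert_comm (c.2, c.1), Set.insert_comm (c.1, c.2 + 1)]
  | @bump A q n q' u v u' cs cs' hn hl _ ih =>
    have ho' := hl.offDiag hq hn
    obtain ⟨mid, h1, h2⟩ := ih hn hcs.2 ho'
    have l2 := hq.le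
    have d1 := hq.double_fst
    have d2 := hq.double_snd
    have e1 := hn.double_fst
    have e2 := hn.double_snd
    rw [double_insert] at h1 h2 e1 e2
    obtain ⟨r, c⟩ := q
    obtain ⟨s, k⟩ := n
    simp only at l2 d1 d2 e1 e2 h1 h2
    by_cases hu : u = true ∧ r ≠ c
    -- Unprimed and off the diagonal: the reflected copy is hit by the first cell of the pair and
    -- the shifted copy by the second, and each stays in its half.
    · simp only [ShiftedNext, if_pos hu] at hl
      obtain ⟨rfl, rfl⟩ := hl
      obtain ⟨rfl, hrc⟩ := hu
      simp only [primedCell, unprimedCell, if_true] at h1 h2 ⊢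
      refine ⟨(k, r + 1) :: (r, c + 1) :: mid,
        .bump (e1.of_insert d1.2.2 (by simp; omega)) rfl (.keep (by simp; omega) h1),
        .keep (by simp; omega) (.bump ?_ rfl ?_)⟩
      · rwa [Set.insert_comm]
      · rwa [Set.insert_comm]
    · simp only [ShiftedNext, if_neg hu] at hl
      obtain ⟨rfl, rfl⟩ := hl
      have hs : s < c + 1 := ho' rfl
      have e2' := e2.of_insert e1.1 (by simp; omega)
      simp only [primedCell, unprimedCell, Bool.false_eq_true, if_false] at h1 h2
      cases u with
      | true =>
        -- On the diagonal the primed copy is hit twice. It moves to `(r, r + 1)` and from there to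
        -- column `r + 2`, while the unprimed copy drops into row `r + 1`. This is how a bump from
        -- the diagonal primes a letter.
        obtain rfl : r = c := by simpa using hu
        simp only [primedCell, unprimedCell, if_true]
        exact ⟨(r, r + 1) :: (s, r + 1 + 1) :: mid,
          .bump d2 rfl (.bump e2' rfl h1),
          .bump e1 rfl (.keep (by simp; omega) h2)⟩
      | false =>
        -- A primed letter: the unprimed copy, now in the reflected half, is hit by the first cell
        -- of the pair, the primed copy by the second.
        have hrc : r < c := ho rfl
        simp only [primedCell, unprimedCell, Bool.false_eq_true, if_false]
        refine ⟨(c, r) :: (s, c + 1 + 1) :: mid,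
          .keep (by simp; omega) (.bump e2' rfl h1),
          .bump ?_ rfl (.keep (by simp; omega) ?_)⟩
        · rwa [Set.insert_comm]
        · rwa [Set.insert_comm (c, r)]

/-- The double of a word: each letter is replaced by its primed and its unprimed version. -/
def doubleWord {α : Type} (W : List α) : List (α ×ₗ Bool) :=
  W.flatMap fun a => [toLex (a, false), toLex (a, true)]

/-- The unprimed letters of the double. -/
def isUnprimed {α : Type} (x : α ×ₗ Bool) : Bool := (ofLex x).2

theorem addCells_double (cs : List Cell) :
    addCells ∅ (cs.flatMap doubleCell) = double (addCells ∅ cs) := by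
  suffices h : ∀ A, addCells (double A) (cs.flatMap doubleCell) = double (addCells A cs) by
    rw [← h]
    congr 1
    ext p
    simp [double]
  induction cs with
  | nil => simp
  | cons c cs ih =>
    intro A
    rw [List.flatMap_cons, addCells_append, addCells_cons, ← ih, double_insert]
    simp [doubleCell]

/-- The copies of the largest letter are the two largest letters of the double, with the primed one
below the unprimed one. They are thus added one after the other, starting in column `0` and in row
`0` respectively, and travel as in `ShiftedPass.double`. -/
theorem ShiftedGrowth.double {α : Type} [LinearOrder α] {W : List α} {cs : List Cell}
    (h : ShiftedGrowth W cs) :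
    Growth isUnprimed (doubleWord W) (cs.flatMap doubleCell) := by
  induction h with
  | nil => exact .nil
  | @ins U V m us vs vs' s q u hm hg hl hs h0 hp ih =>
    have hpath := hg.isPath
    rw [isShiftedPath_append] at hpath
    obtain ⟨mid, h1, h2⟩ := hp.double hs hpath.2 (fun h => by simp at h)
    have hlt : ∀ b : Bool, ∀ x ∈ doubleWord (U ++ V), x < toLex (m, b) := by
      intro b x hx
      simp only [doubleWord, List.mem_flatMap, List.mem_cons, List.not_mem_nil, or_false] at hx
      obtain ⟨a, ha, rfl | rfl⟩ := hx
      · exact Prod.Lex.lt_iff.2 (Or.inl (hm a ha))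
      · exact Prod.Lex.lt_iff.2 (Or.inl (hm a ha))
    rw [List.flatMap_append] at ih
    have hl2 : ∀ {l : List Cell} {T : List α}, l.length = T.length →
        (l.flatMap doubleCell).length = (doubleWord T).length := by
      intro l T hlt
      simp [doubleWord, doubleCell, List.length_flatMap, hlt]
    have hd : doubleWord (U ++ V) = doubleWord U ++ doubleWord V := by simp [doubleWord]
    have e : doubleWord (U ++ m :: V) =
        (doubleWord U ++ [toLex (m, false)]) ++ toLex (m, true) :: doubleWord V := by
      simp [doubleWord]
    rw [hd] at hlt ih
    rw [← addCells_double] at h1 h2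
    have g1 : Growth isUnprimed (doubleWord U ++ toLex (m, false) :: doubleWord V)
        (us.flatMap doubleCell ++ (s.2, s.1) :: mid) := by
      refine .ins (hlt false) ih (hl2 hl) ?_ (by simpa [isUnprimed] using h0) h1
      rw [addCells_double]
      exact hs.double_fst
    rw [e, List.flatMap_append, List.flatMap_cons, show us.flatMap doubleCell ++
      (doubleCell s ++ vs'.flatMap doubleCell) = (us.flatMap doubleCell ++ [(s.2, s.1)]) ++
      (s.1, s.2 + 1) :: vs'.flatMap doubleCell by simp [doubleCell]]
    refine .ins (vs := mid) ?_ (by simpa using g1) (by simp [hl2 hl]) ?_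
      (by simpa [isUnprimed] using h0) ?_ (q := unprimedCell q u)
    · intro x hx
      have := hlt true x
      simp only [List.mem_append, List.mem_singleton] at hx this
      rcases hx with (hx | rfl) | hx
      · exact this (Or.inl hx)
      · exact Prod.Lex.lt_iff.2 (Or.inr ⟨rfl, by simp⟩)
      · exact this (Or.inr hx)
    · rw [addCells_append, addCells_double]
      simpa using hs.double_snd
    · rw [addCells_append]
      simpa [primedCell, unprimedCell, isUnprimed] using h2

end ShiftedInsertion

namespace ShiftedInsertion

/-! ### Shifted plactic relations -/

section KnuthStep

variable {β : Type} [LinearOrder β] {pos : β → Bool}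

/-- Growth along `w` and along `w'` leads to the same diagram, in any context. -/
def GrowthEquiv (pos : β → Bool) (w w' : List β) : Prop :=
  ∀ P S cs, Growth pos (P ++ w ++ S) cs →
    ∃ ds, Growth pos (P ++ w' ++ S) ds ∧ addCells ∅ ds = addCells ∅ cs

theorem GrowthEquiv.refl (w : List β) : GrowthEquiv pos w w := fun _ _ _ h => ⟨_, h, rfl⟩

theorem GrowthEquiv.trans {w w' w'' : List β} (h : GrowthEquiv pos w w')
    (h' : GrowthEquiv pos w' w'') : GrowthEquiv pos w w'' := by
  intro P S cs hg
  obtain ⟨ds, hd, e⟩ := h P S cs hg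
  obtain ⟨es, he, e'⟩ := h' P S ds hd
  exact ⟨es, he, e'.trans e⟩

theorem GrowthEquiv.cons {w w' : List β} (h : GrowthEquiv pos w w') (x : β) :
    GrowthEquiv pos (x :: w) (x :: w') := by
  intro P S cs hg
  have := h (P ++ [x]) S cs (by simpa using hg)
  simpa using this

/-- Dual equivalent windows fill the same cells and the growth outside the window is unchanged, so
the final diagrams agree. -/
theorem KnuthRel.growthEquiv {x₁ x₂ x₃ y₁ y₂ y₃ : β} (h : KnuthRel pos x₁ x₂ x₃ y₁ y₂ y₃)
    (T : List β) : GrowthEquiv pos (x₁ :: x₂ :: x₃ :: T) (y₁ :: y₂ :: y₃ :: T) := by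
  intro P S cs hg
  have hg' : Growth pos (P ++ [x₁, x₂, x₃] ++ (T ++ S)) cs := by simpa using hg
  obtain ⟨ps, a, b, c, ss, rfl, hl⟩ := hg'.split_triple
  obtain ⟨b₁, b₂, b₃, h', hd⟩ := hg'.knuth hl h
  refine ⟨ps ++ [b₁, b₂, b₃] ++ ss, by simpa using h', ?_⟩
  rw [addCells_append, addCells_append, addCells_append, addCells_append,
    hd.addCells_eq hg'.isPath_mid h'.isPath_mid]

/-- `z` is strictly between `x` and `y`. -/
def IsMid (z x y : ℕ) : Prop := x < z ∧ z < y ∨ y < z ∧ z < x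

instance (z x y : ℕ) : Decidable (IsMid z x y) := by unfold IsMid; infer_instance

/-- Apply a Knuth relation to the three letters following the first `i` ones, if this is possible:
the first two of them (if `k` holds) or the last two are exchanged. -/
def knuthMove (k : Bool) : ℕ → List ℕ → List ℕ
  | 0, x :: y :: z :: S =>
    if k then (if IsMid z x y then y :: x :: z :: S else x :: y :: z :: S)
    else (if IsMid x y z then x :: z :: y :: S else x :: y :: z :: S)
  | i + 1, x :: S => x :: knuthMove k i S
  | _, S => S

theorem mem_of_mem_knuthMove {k : Bool} {i : ℕ} {w : List ℕ} {x : ℕ}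
    (h : x ∈ knuthMove k i w) : x ∈ w := by
  fun_induction knuthMove k i w <;> simp_all <;> tauto

theorem between_of_isMid {g : ℕ → β} {n : ℕ}
    (hg : ∀ x y, x < y → y < n → SignedLT pos (g x) (g y)) {x y z : ℕ} (hx : x < n) (hy : y < n)
    (hz : z < n) (h : IsMid z x y) : Between pos (g z) (g x) (g y) := by
  rcases h with ⟨h1, h2⟩ | ⟨h1, h2⟩
  · exact Or.inl ⟨hg _ _ h1 hz, hg _ _ h2 hy⟩
  · exact Or.inr ⟨hg _ _ h1 hz, hg _ _ h2 hx⟩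

theorem growthEquiv_knuthMove {g : ℕ → β} {n : ℕ}
    (hg : ∀ x y, x < y → y < n → SignedLT pos (g x) (g y)) (k : Bool) (i : ℕ) (w : List ℕ)
    (hw : ∀ x ∈ w, x < n) : GrowthEquiv pos (w.map g) ((knuthMove k i w).map g) := by
  fun_induction knuthMove k i w with
  | case1 x y z S h1 h2 =>
    simp at hw
    exact KnuthRel.growthEquiv
      (Or.inl ⟨rfl, rfl, rfl, between_of_isMid hg hw.1 hw.2.1 hw.2.2.1 h2⟩) _
  | case3 x y z S h1 h2 =>
    simp at hw
    exact KnuthRel.growthEquiv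
      (Or.inr ⟨rfl, rfl, rfl, between_of_isMid hg hw.2.1 hw.2.2.1 hw.1 h2⟩) _
  | case5 i x S ih =>
    simp at hw
    exact (ih hw.2).cons _
  | _ => exact GrowthEquiv.refl _

/-- A move that is not applicable leaves the word alone, so any list of moves is sound; only its
final result has to be computed. -/
theorem growthEquiv_knuthMoves {g : ℕ → β} {n : ℕ}
    (hg : ∀ x y, x < y → y < n → SignedLT pos (g x) (g y)) (ms : List (Bool × ℕ)) (w : List ℕ)
    (hw : ∀ x ∈ w, x < n) :
    GrowthEquiv pos (w.map g) ((ms.foldl (fun v m => knuthMove m.1 m.2 v) w).map g) := by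
  induction ms generalizing w with
  | nil => exact GrowthEquiv.refl _
  | cons m ms ih =>
    exact (growthEquiv_knuthMove hg m.1 m.2 w hw).trans
      (ih _ fun x hx => hw x (mem_of_mem_knuthMove hx))

end KnuthStep

/-! ### Shifted plactic relations and their doubles -/

section Plactic

variable {α : Type} [LinearOrder α]

/-- The order isomorphism from `{0, …, 7}` to the signed letters with values in `{a, b, c, d}`. -/
def signedLetter (a b c d : α) (v : ℕ) : α ×ₗ Bool :=
  match v with
  | 0 => toLex (d, false)
  | 1 => toLex (c, false)
  | 2 => toLex (b, false)
  | 3 => toLex (a, false)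
  | 4 => toLex (a, true)
  | 5 => toLex (b, true)
  | 6 => toLex (c, true)
  | _ => toLex (d, true)

theorem signedLT_signedLetter {a b c d : α} (hab : a < b) (hbc : b < c) (hcd : c < d) (x y : ℕ)
    (hxy : x < y) (hy : y < 8) :
    SignedLT isUnprimed (signedLetter a b c d x) (signedLetter a b c d y) := by
  have step : ∀ x, x < 7 →
      SignedLT isUnprimed (signedLetter a b c d x) (signedLetter a b c d (x + 1)) := by
    intro x hx
    have key : ∀ {p q : α} {b b' : Bool}, p < q → toLex (p, b) < toLex (q, b') :=
      fun h => Prod.Lex.lt_iff.2 (Or.inl h)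
    match x, hx with
    | 0, _ => exact Or.inr (key hcd)
    | 1, _ => exact Or.inr (key hbc)
    | 2, _ => exact Or.inr (key hab)
    | 3, _ => exact Or.inl rfl
    | 4, _ => exact ⟨rfl, key hab⟩
    | 5, _ => exact ⟨rfl, key hbc⟩
    | 6, _ => exact ⟨rfl, key hcd⟩
  induction y with
  | zero => omega
  | succ y ih =>
    rcases Nat.lt_succ_iff_lt_or_eq.1 hxy with h | rfl
    · exact (ih h (by omega)).trans (step y (by omega))
    · exact step x (by omega)

/-- The shifted plactic relations between words with four distinct letters. -/
inductive ShiftedPlactic : List α → List α → Prop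
  | abdc {a b c d : α} (h₁ : a < b) (h₂ : b < c) (h₃ : c < d) :
      ShiftedPlactic [a, b, d, c] [a, d, b, c]
  | acdb {a b c d : α} (h₁ : a < b) (h₂ : b < c) (h₃ : c < d) :
      ShiftedPlactic [a, c, d, b] [a, c, b, d]
  | dacb {a b c d : α} (h₁ : a < b) (h₂ : b < c) (h₃ : c < d) :
      ShiftedPlactic [d, a, c, b] [a, d, c, b]
  | badc {a b c d : α} (h₁ : a < b) (h₂ : b < c) (h₃ : c < d) :
      ShiftedPlactic [b, a, d, c] [b, d, a, c]
  | cbda {a b c d : α} (h₁ : a < b) (h₂ : b < c) (h₃ : c < d) :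
      ShiftedPlactic [c, b, d, a] [c, d, b, a]
  | dbca {a b c d : α} (h₁ : a < b) (h₂ : b < c) (h₃ : c < d) :
      ShiftedPlactic [d, b, c, a] [b, d, c, a]
  | bcda {a b c d : α} (h₁ : a < b) (h₂ : b < c) (h₃ : c < d) :
      ShiftedPlactic [b, c, d, a] [b, c, a, d]
  | cadb {a b c d : α} (h₁ : a < b) (h₂ : b < c) (h₃ : c < d) :
      ShiftedPlactic [c, a, d, b] [c, d, a, b]

/-- Only the relative order of the eight signed letters `d' < c' < b' < a' < a < b < c < d` matters.
Coding them by `0, …, 7` reduces each relation to a computation with numerals. -/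
theorem ShiftedPlactic.growthEquiv {w w' : List α} (h : ShiftedPlactic w w') :
    GrowthEquiv isUnprimed (doubleWord w) (doubleWord w') := by
  have key : ∀ {a b c d : α}, a < b → b < c → c < d → ∀ (ms : List (Bool × ℕ)) (v v' : List ℕ),
      (∀ x ∈ v, x < 8) → ms.foldl (fun v m => knuthMove m.1 m.2 v) v = v' →
      GrowthEquiv isUnprimed (v.map (signedLetter a b c d)) (v'.map (signedLetter a b c d)) := by
    rintro a b c d h₁ h₂ h₃ ms v _ hv rfl
    exact growthEquiv_knuthMoves (signedLT_signedLetter h₁ h₂ h₃) ms v hv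
  cases h with
  | abdc h₁ h₂ h₃ =>
    -- The moves lead from the code of `a'a b'b d'd c'c` to that of `a'a d'd b'b c'c`; the other
    -- cases are of the same form.
    exact key h₁ h₂ h₃ [(false, 1), (true, 5), (true, 3), (false, 1), (false, 0), (false, 2),
      (false, 3), (true, 5), (false, 3), (false, 2), (false, 0), (false, 4)]
      [3, 4, 2, 5, 0, 7, 1, 6] [3, 4, 0, 7, 2, 5, 1, 6] (by decide) (by decide)
  | acdb h₁ h₂ h₃ =>
    exact key h₁ h₂ h₃ [(false, 1), (true, 5), (false, 3), (false, 1), (false, 0), (false, 2),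
      (false, 3), (false, 5), (false, 3), (false, 2), (false, 0), (false, 4)]
      [3, 4, 1, 6, 0, 7, 2, 5] [3, 4, 1, 6, 2, 5, 0, 7] (by decide) (by decide)
  | dacb h₁ h₂ h₃ =>
    exact key h₁ h₂ h₃ [(true, 1), (true, 5), (true, 3), (false, 1), (true, 0), (true, 2),
      (true, 3), (true, 5), (false, 3), (true, 2), (false, 0), (true, 4)]
      [0, 7, 3, 4, 1, 6, 2, 5] [3, 4, 0, 7, 1, 6, 2, 5] (by decide) (by decide)
  | badc h₁ h₂ h₃ =>
    exact key h₁ h₂ h₃ [(true, 1), (true, 5), (true, 3), (false, 1), (false, 0), (true, 2),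
      (false, 3), (true, 5), (false, 3), (false, 2), (false, 0), (false, 4)]
      [2, 5, 3, 4, 0, 7, 1, 6] [2, 5, 0, 7, 3, 4, 1, 6] (by decide) (by decide)
  | cbda h₁ h₂ h₃ =>
    exact key h₁ h₂ h₃ [(true, 1), (true, 5), (true, 3), (false, 1), (false, 0), (true, 2),
      (true, 3), (true, 5), (false, 3), (false, 2), (false, 0), (true, 4)]
      [1, 6, 2, 5, 0, 7, 3, 4] [1, 6, 0, 7, 2, 5, 3, 4] (by decide) (by decide)
  | dbca h₁ h₂ h₃ =>
    exact key h₁ h₂ h₃ [(true, 1), (true, 5), (true, 3), (false, 1), (true, 0), (true, 2),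
      (true, 3), (true, 5), (false, 3), (true, 2), (false, 0), (true, 4)]
      [0, 7, 2, 5, 1, 6, 3, 4] [2, 5, 0, 7, 1, 6, 3, 4] (by decide) (by decide)
  | bcda h₁ h₂ h₃ =>
    exact key h₁ h₂ h₃ [(false, 1), (true, 5), (false, 3), (false, 1), (false, 0), (false, 2),
      (false, 3), (false, 5), (false, 3), (false, 2), (false, 0), (false, 4)]
      [2, 5, 1, 6, 0, 7, 3, 4] [2, 5, 1, 6, 3, 4, 0, 7] (by decide) (by decide)
  | cadb h₁ h₂ h₃ =>
    exact key h₁ h₂ h₃ [(true, 1), (true, 5), (true, 3), (false, 1), (false, 0), (true, 2),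
      (false, 3), (true, 5), (false, 3), (false, 2), (false, 0), (false, 4)]
      [1, 6, 3, 4, 0, 7, 2, 5] [1, 6, 0, 7, 3, 4, 2, 5] (by decide) (by decide)

theorem IsShiftedPath.low {A : Set Cell} {cs : List Cell} (hA : ShiftedLow A)
    (h : IsShiftedPath A cs) : ShiftedLow (addCells A cs) := by
  induction cs generalizing A with
  | nil => simpa using hA
  | cons c cs ih => simpa using ih h.1.2.2 h.2

theorem shiftedLow_empty : ShiftedLow ∅ := ⟨fun _ _ h => h.elim, fun _ _ h => h.elim⟩

/-- The part of the double on and below the diagonal is the reflected diagram. -/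
theorem double_inj {A B : Set Cell} (hA : ShiftedLow A) (hB : ShiftedLow B)
    (h : double A = double B) : A = B := by
  ext ⟨i, j⟩
  constructor
  · intro hm
    have hle := hA.1 _ _ hm
    rw [← mem_double_of_le hB hle, ← h, mem_double_of_le hA hle]
    exact hm
  · intro hm
    have hle := hB.1 _ _ hm
    rw [← mem_double_of_le hA hle, h, mem_double_of_le hB hle]
    exact hm

/-- The diagram to which a word leads depends only on its shifted plactic class. -/
theorem ShiftedPlactic.addCells_eq {w w' P S : List α} (h : ShiftedPlactic w w')
    {cs ds : List Cell} (hc : ShiftedGrowth (P ++ w ++ S) cs)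
    (hd : ShiftedGrowth (P ++ w' ++ S) ds) : addCells ∅ cs = addCells ∅ ds := by
  apply double_inj (hc.isPath.low shiftedLow_empty) (hd.isPath.low shiftedLow_empty)
  rw [← addCells_double, ← addCells_double]
  obtain ⟨es, he, e⟩ := h.growthEquiv (doubleWord P) (doubleWord S) _
    (by simpa [doubleWord] using hc.double)
  have hd' : Growth isUnprimed (doubleWord P ++ doubleWord w' ++ doubleWord S)
      (ds.flatMap doubleCell) := by simpa [doubleWord] using hd.double
  rw [hd'.unique he, e]

end Plactic

end ShiftedInsertion

namespace ShiftedInsertion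

/-! ### Mixed insertion and growth -/

namespace Filling

theorem ext_entry {α : Type} {T T' : Filling α} (h : ∀ p, T.entry p = T'.entry p) : T = T' := by
  obtain ⟨s, e, hm⟩ := T
  obtain ⟨s', e', hm'⟩ := T'
  obtain rfl : e = e' := funext h
  obtain rfl : s = s' := by ext p; rw [hm, hm']
  rfl

theorem entry_write {α : Type} (T : Filling α) (p q : Cell) (a : α) :
    (T.write p a).entry q = if q = p then some a else T.entry q := by
  simp [write, Function.update_apply]

theorem entry_write_self {α : Type} (T : Filling α) (p : Cell) (a : α) :
    (T.write p a).entry p = some a := by simp [entry_write]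

theorem entry_write_of_ne {α : Type} (T : Filling α) {p q : Cell} (h : q ≠ p) (a : α) :
    (T.write p a).entry q = T.entry q := by simp [entry_write, h]

theorem write_comm {α : Type} (T : Filling α) {p q : Cell} (h : p ≠ q) (a b : α) :
    (T.write p a).write q b = (T.write q b).write p a := by
  apply ext_entry
  intro x
  simp only [entry_write]
  split_ifs with h1 h2
  · exact absurd (h2.symm.trans h1) h
  all_goals rfl

theorem write_write {α : Type} (T : Filling α) (p : Cell) (a b : α) :
    (T.write p a).write p b = T.write p b := by
  apply ext_entry
  intro x
  simp only [entry_write]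
  split_ifs <;> rfl

theorem coe_shape_write {α : Type} (T : Filling α) (p : Cell) (a : α) :
    ((T.write p a).shape : Set Cell) = insert p (T.shape : Set Cell) := by
  simp [write]

theorem entry_eq_none {α : Type} {T : Filling α} {p : Cell} :
    T.entry p = none ↔ p ∉ (T.shape : Set Cell) := by
  rw [Finset.mem_coe, T.mem_shape, not_not]

theorem exists_entry {α : Type} {T : Filling α} {p : Cell} (h : p ∈ (T.shape : Set Cell)) :
    ∃ b, T.entry p = some b := by
  rw [Finset.mem_coe, T.mem_shape] at h
  exact Option.ne_none_iff_exists'.1 h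

theorem mem_of_entry {α : Type} {T : Filling α} {p : Cell} {b : α} (h : T.entry p = some b) :
    p ∈ (T.shape : Set Cell) := by
  rw [Finset.mem_coe, T.mem_shape, h]; simp

theorem mixInsertLine_of_none {T : Filling PLetter} {L : Line} {a : PLetter}
    (h : T.entry (T.target L a) = none) : T.mixInsertLine L a = T.write (T.target L a) a := by
  rw [mixInsertLine]
  split
  · rfl
  · simp_all

theorem mixInsertLine_of_some {T : Filling PLetter} {L : Line} {a b : PLetter}
    (h : T.entry (T.target L a) = some b) : T.mixInsertLine L a =
      (T.write (T.target L a) a).mixInsertLine (afterBump (T.target L a) b).1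
        (afterBump (T.target L a) b).2 := by
  rw [mixInsertLine]
  split
  · simp_all
  · simp_all

theorem target_eq_iff {T : Filling PLetter} {L : Line} {a : PLetter} {k : ℕ} :
    T.target L a = L.cell k ↔
      T.Accepts a (L.cell k) ∧ ∀ j < k, ¬ T.Accepts a (L.cell j) := by
  rw [target, L.cell_injective.eq_iff, Nat.find_eq_iff]

theorem lt_of_target {T : Filling PLetter} {L : Line} {a b : PLetter}
    (h : T.entry (T.target L a) = some b) : a < b :=
  Nat.find_spec (T.exists_accepts L a) b h

theorem exists_target_eq (T : Filling PLetter) (L : Line) (a : PLetter) :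
    ∃ k, T.target L a = L.cell k := ⟨_, rfl⟩

theorem target_write_of_ne {T : Filling PLetter} {L : Line} {a m : PLetter} {q : Cell}
    (hq : T.entry q = none) (h : T.target L a ≠ q) :
    (T.write q m).target L a = T.target L a := by
  obtain ⟨k, hk⟩ := T.exists_target_eq L a
  have h' := target_eq_iff.1 hk
  rw [hk] at h ⊢
  rw [target_eq_iff]
  refine ⟨fun b hb => h'.1 b ?_, fun j hj hacc => h'.2 j hj fun b hb => hacc b ?_⟩
  · rwa [entry_write_of_ne _ h] at hb
  · rw [entry_write_of_ne _ (by rintro rfl; rw [hq] at hb; simp at hb)]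
    exact hb

theorem target_write_of_lt {T : Filling PLetter} {L : Line} {a m : PLetter}
    (hq : T.entry (T.target L a) = none) (h : a < m) :
    (T.write (T.target L a) m).target L a = T.target L a := by
  obtain ⟨k, hk⟩ := T.exists_target_eq L a
  have h' := target_eq_iff.1 hk
  rw [hk] at hq ⊢
  rw [target_eq_iff]
  refine ⟨fun b hb => ?_, fun j hj hacc => h'.2 j hj fun b hb => hacc b ?_⟩
  · rw [entry_write_self] at hb
    simpa using (Option.some_injective _ hb) ▸ h
  · rw [entry_write_of_ne _ (by intro e; rw [e, hq] at hb; simp at hb)]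
    exact hb

/-- Inserting a letter into a tableau to which a large letter `m` has been added in an empty cell
`q`. -/
theorem mixInsertLine_write {q : Cell} {m : PLetter} (T : Filling PLetter) (L : Line) (a : PLetter)
    (hq : T.entry q = none) :
    ((T.mixInsertLine L a).entry q = none →
      (T.write q m).mixInsertLine L a = (T.mixInsertLine L a).write q m) ∧
    (∀ b, (T.mixInsertLine L a).entry q = some b → b < m → (T.write q m).mixInsertLine L a =
      (T.mixInsertLine L a).mixInsertLine (afterBump q m).1 (afterBump q m).2) := by
  induction T, L, a using Filling.mixInsertLine.induct with
  | case1 T L a hb =>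
    rw [mixInsertLine_of_none hb]
    by_cases h : T.target L a = q
    · subst h
      simp only [entry_write_self, reduceCtorEq, false_implies, true_and, Option.some.injEq]
      rintro _ rfl hlt
      have ht := target_write_of_lt hq hlt
      -- The insertion would have ended in `q`; with `m` there, it bumps `m` and continues.
      rw [mixInsertLine_of_some (b := m) (by rw [ht, entry_write_self]), ht, write_write]
    · have ht := target_write_of_ne (m := m) hq h
      rw [entry_write_of_ne _ (Ne.symm h), hq]
      refine ⟨fun _ => ?_, by simp⟩
      rw [mixInsertLine_of_none (by rw [ht, entry_write_of_ne _ h, hb]), ht, write_comm _ (Ne.symm h)]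
  | case2 T L a b hb ih =>
    have h : T.target L a ≠ q := by
      intro h
      rw [h, hq] at hb
      simp at hb
    have ht := target_write_of_ne (m := m) hq h
    rw [mixInsertLine_of_some hb,
      mixInsertLine_of_some (T := T.write q m) (b := b) (by rw [ht, entry_write_of_ne _ h, hb]), ht,
      write_comm _ (Ne.symm h)]
    exact ih (by rw [entry_write_of_ne _ (Ne.symm h), hq])

end Filling

theorem PLetter.primed_base_le (b : PLetter) : PLetter.primed b.base ≤ b := by
  obtain ⟨x, t⟩ := b
  refine Prod.Lex.le_iff.2 (Or.inr ⟨rfl, ?_⟩)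
  change false ≤ t
  simp

theorem afterBump_le (p : Cell) (b : PLetter) : (afterBump p b).2 ≤ b := by
  unfold afterBump
  split_ifs
  · exact b.primed_base_le
  · exact le_rfl
  · exact le_rfl

theorem entries_le {M : PLetter} (T : Filling PLetter) (L : Line) (a : PLetter)
    (hT : ∀ p b, T.entry p = some b → b ≤ M) (ha : a ≤ M) :
    ∀ p b, (T.mixInsertLine L a).entry p = some b → b ≤ M := by
  induction T, L, a using Filling.mixInsertLine.induct with
  | case1 T L a hb =>
    rw [Filling.mixInsertLine_of_none hb]
    intro p b h
    rw [Filling.entry_write] at h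
    split_ifs at h
    · simp only [Option.some.injEq] at h; exact h ▸ ha
    · exact hT p b h
  | case2 T L a b hb ih =>
    rw [Filling.mixInsertLine_of_some hb]
    refine ih ?_ ((afterBump_le _ b).trans (hT _ b hb))
    intro p b h
    rw [Filling.entry_write] at h
    split_ifs at h
    · simp only [Option.some.injEq] at h; exact h ▸ ha
    · exact hT p b h

/-- A letter that is not smaller than any entry is placed at the end of its line. -/
theorem Filling.target_of_le {T : Filling PLetter} {L : Line} {M : PLetter}
    (hT : ∀ p b, T.entry p = some b → b ≤ M) :
    T.entry (T.target L M) = none ∧ ∃ k, T.target L M = L.cell k ∧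
      ∀ j < k, T.entry (L.cell j) ≠ none := by
  constructor
  · by_contra h
    obtain ⟨b, hb⟩ := Option.ne_none_iff_exists'.1 h
    exact absurd (Filling.lt_of_target hb) (not_lt.2 (hT _ _ hb))
  · obtain ⟨k, hk⟩ := T.exists_target_eq L M
    refine ⟨k, hk, fun j hj h => (Filling.target_eq_iff.1 hk).2 j hj fun b hb => ?_⟩
    rw [h] at hb
    simp at hb

/-- Where the copies of the largest letter `M` can be after an insertion. -/
theorem entry_eq_max {M : PLetter} (T : Filling PLetter) (L : Line) (a : PLetter)
    (hT : ∀ p b, T.entry p = some b → b ≤ M) (ha : a < M)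
    (hle : ∀ p b, T.entry p = some b → p.1 ≤ p.2)
    (hd : M.IsPrimed → ∀ p, T.entry p = some M → p.1 ≠ p.2)
    (hu : ¬ M.IsPrimed → ∀ p, T.entry p = some M → T.entry (p.1 + 1, p.2) = none)
    (hp : M.IsPrimed → ∀ p, T.entry p = some M → T.entry (p.1, p.2 + 1) = none) (x : Cell)
    (hx : (T.mixInsertLine L a).entry x = some M) :
    T.entry x = some M ∨ T.entry x = none ∧ ∃ p, T.entry p = some M ∧
      (M.IsPrimed → x.1 ≤ p.1) ∧ (¬ M.IsPrimed → x.2 ≤ p.2) := by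
  induction T, L, a using Filling.mixInsertLine.induct with
  | case1 T L a hb =>
    rw [Filling.mixInsertLine_of_none hb, Filling.entry_write] at hx
    split_ifs at hx
    · simp only [Option.some.injEq] at hx; exact absurd hx ha.ne
    · exact Or.inl hx
  | case2 T L a b hb ih =>
    rw [Filling.mixInsertLine_of_some hb] at hx
    set p := T.target L a with hpdef
    have hab : a < b := Filling.lt_of_target hb
    have hM : ∀ y, (T.write p a).entry y = some M → T.entry y = some M := by
      intro y hy
      rw [Filling.entry_write] at hy
      split_ifs at hy
      · simp only [Option.some.injEq] at hy; exact absurd hy ha.ne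
      · exact hy
    have hN : ∀ y, T.entry y = none ↔ (T.write p a).entry y = none := by
      intro y
      rw [Filling.entry_write]
      split_ifs with h
      · simp [h, hb]
      · rfl
    have hT' : ∀ y c, (T.write p a).entry y = some c → c ≤ M := by
      intro y c hy
      rw [Filling.entry_write] at hy
      split_ifs at hy
      · simp only [Option.some.injEq] at hy; exact hy ▸ ha.le
      · exact hT y c hy
    have hle' : ∀ y c, (T.write p a).entry y = some c → y.1 ≤ y.2 := by
      intro y c hy
      rw [Filling.entry_write] at hy
      split_ifs at hy with h
      · exact h ▸ hle _ _ hb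
      · exact hle _ _ hy
    rcases ((afterBump_le p b).trans (hT p b hb)).lt_or_eq with hlt | heq
    · rcases ih hT' hlt hle' (fun h y hy => hd h y (hM y hy))
        (fun h y hy => (hN _).1 (hu h y (hM y hy)))
        (fun h y hy => (hN _).1 (hp h y (hM y hy))) hx with h | ⟨h1, y, hy, h2⟩
      · exact Or.inl (hM _ h)
      · exact Or.inr ⟨(hN x).2 h1, y, hM _ hy, h2⟩
    -- The bumped letter is a copy of `M` and stays one. Nothing exceeds it, so it comes to rest at
    -- the end of the next line, and the neighbour of `p` that is known to be empty bounds how far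
    -- that is.
    · obtain rfl : b = M := le_antisymm (hT p b hb) (heq ▸ afterBump_le p b)
      obtain ⟨e1, k, e2, e3⟩ := Filling.target_of_le (L := (afterBump p b).1) hT'
      rw [heq, Filling.mixInsertLine_of_none e1, Filling.entry_write] at hx
      split_ifs at hx with hxt
      · right
        refine ⟨by rw [hN, hxt, e1], p, hb, ?_, ?_⟩
        · intro hpr
          have hne := hd hpr p hb
          simp only [afterBump, hne, if_false, hpr, if_true] at e2 e3 hxt
          rw [hxt, e2]
          simp only [Line.cell] at e3 ⊢
          by_contra hlt
          exact e3 p.1 (by omega) ((hN _).1 (hp hpr p hb))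
        · intro hpr
          have hpl := hle p b hb
          by_cases hpd : p.1 = p.2
          -- A bump from the diagonal would have primed the letter, so it would no longer be `M`.
          · exfalso
            simp only [afterBump, hpd, if_true] at heq
            apply hpr
            rw [← heq]
            rfl
          · simp only [afterBump, hpd, if_false, hpr] at e2 e3 hxt
            rw [hxt, e2]
            simp only [Line.cell] at e3 ⊢
            by_contra hlt
            -- The offset in row `p.1 + 1` of the cell below `p`, as rows are counted from the
            -- diagonal.
            refine e3 (p.2 - (p.1 + 1)) (by omega) ?_
            rw [show p.1 + 1 + (p.2 - (p.1 + 1)) = p.2 by omega]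
            exact (hN _).1 (hu hpr p hb)
      · exact Or.inl (hM _ hx)

/-- Shifted semistandard tableaux. -/
structure IsTableau (T : Filling PLetter) : Prop where
  low : ShiftedLow (T.shape : Set Cell)
  row : ∀ {r c c' a b}, c < c' → T.entry (r, c) = some a → T.entry (r, c') = some b →
    a ≤ b ∧ (a = b → ¬ a.IsPrimed)
  col : ∀ {r r' c a b}, r < r' → T.entry (r, c) = some a → T.entry (r', c) = some b →
    a ≤ b ∧ (a = b → a.IsPrimed)
  diag : ∀ {r a}, T.entry (r, r) = some a → ¬ a.IsPrimed

/-- The letter `m` can be placed into the cell `q` as the last copy of the largest letter. -/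
structure IsLast (T : Filling PLetter) (q : Cell) (m : PLetter) : Prop where
  le : ∀ p b, T.entry p = some b → b ≤ m
  primed : m.IsPrimed → ∀ p, T.entry p = some m → p.1 < q.1
  unprimed : ¬ m.IsPrimed → ∀ p, T.entry p = some m → p.2 < q.2

/-- The conditions in `IsLast` are those of standardization: copies of an unprimed letter are
ordered from left to right, copies of a primed one from top to bottom. -/
theorem IsTableau.write {T : Filling PLetter} {q : Cell} {m : PLetter} (hT : IsTableau T)
    (h : IsLast T q m) (hq : ShiftedAddable T.shape q) (hd : m.IsPrimed → q.1 ≠ q.2) :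
    IsTableau (T.write q m) := by
  have hmem : ∀ {i j b}, T.entry (i, j) = some b → q.1 ≤ i → q.2 ≤ j → False := by
    intro i j b hb hi hj
    exact hq.2.1 (hT.low.2 i j (Filling.mem_of_entry hb) q.1 hi q.2 hj hq.le)
  refine ⟨by rw [Filling.coe_shape_write]; exact hq.2.2, ?_, ?_, ?_⟩
  · intro r c c' a b hlt ha hb
    rw [Filling.entry_write] at ha hb
    split_ifs at ha hb with h1 h2 h2
    · rw [← h1] at h2; simp only [Prod.mk.injEq] at h2; omega
    · exact (hmem hb (by rw [← h1]) (by rw [← h1]; exact hlt.le)).elim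
    · simp only [Option.some.injEq] at hb
      subst hb
      refine ⟨h.le _ _ ha, ?_⟩
      rintro rfl hp
      have := h.primed hp _ ha
      rw [← h2] at this
      simp at this
    · exact hT.row hlt ha hb
  · intro r r' c a b hlt ha hb
    rw [Filling.entry_write] at ha hb
    split_ifs at ha hb with h1 h2 h2
    · rw [← h1] at h2; simp only [Prod.mk.injEq] at h2; omega
    · exact (hmem hb (by rw [← h1]; exact hlt.le) (by rw [← h1])).elim
    · simp only [Option.some.injEq] at hb
      subst hb
      refine ⟨h.le _ _ ha, ?_⟩
      rintro rfl
      by_contra hp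
      have := h.unprimed hp _ ha
      rw [← h2] at this
      simp at this
    · exact hT.col hlt ha hb
  · intro r a ha
    rw [Filling.entry_write] at ha
    split_ifs at ha with h1
    · simp only [Option.some.injEq] at ha
      subst ha
      exact fun hp => hd hp (by rw [← h1])
    · exact hT.diag ha

/-- The letters of `xs` can be inserted into `T` by mixed insertion, and `cs` is the list of new
cells. -/
def MixRun : Filling PLetter → List Letter → List Cell → Prop
  | _, [], [] => True
  | T, x :: xs, c :: cs => ((mixInsert T x).shape : Set Cell) = insert c (T.shape : Set Cell) ∧
      ShiftedAddable T.shape c ∧ IsTableau (mixInsert T x) ∧ MixRun (mixInsert T x) xs cs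
  | _, _, _ => False

theorem mixRun_append {T : Filling PLetter} {xs ys : List Letter} {cs ds : List Cell}
    (hl : cs.length = xs.length) : MixRun T (xs ++ ys) (cs ++ ds) ↔
      MixRun T xs cs ∧ MixRun (xs.foldl mixInsert T) ys ds := by
  induction xs generalizing T cs with
  | nil =>
    obtain rfl : cs = [] := List.length_eq_zero_iff.1 hl
    simp [MixRun]
  | cons x xs ih =>
    match cs, hl with
    | c :: cs, hl => simp [MixRun, ih (by simpa using hl), and_assoc]

theorem MixRun.isTableau {T : Filling PLetter} {xs : List Letter} {cs : List Cell}
    (h : MixRun T xs cs) (hT : IsTableau T) : IsTableau (xs.foldl mixInsert T) := by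
  induction xs generalizing T cs with
  | nil => exact hT
  | cons x xs ih =>
    match cs, h with
    | c :: cs, h => exact ih h.2.2.2 h.2.2.1

theorem MixRun.shape_eq {T : Filling PLetter} {xs : List Letter} {cs : List Cell}
    (h : MixRun T xs cs) : ((xs.foldl mixInsert T).shape : Set Cell) = addCells T.shape cs := by
  induction xs generalizing T cs with
  | nil =>
    match cs, h with
    | [], _ => simp
  | cons x xs ih =>
    match cs, h with
    | c :: cs, h => simp [ih h.2.2.2, h.1]

/-- The letter `k`, primed unless `u` holds. -/
def mark (k : Letter) (u : Bool) : PLetter := toLex (k, u)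

theorem isPrimed_mark {k : Letter} {u : Bool} : (mark k u).IsPrimed ↔ u = false := Iff.rfl

theorem unprimed_lt_mark {x k : Letter} (h : x < k) (u : Bool) : PLetter.unprimed x < mark k u :=
  Prod.Lex.lt_iff.2 (Or.inl h)

theorem le_primed_of_lt {k : Letter} {b : PLetter} (h : b < mark k true) : b ≤ mark k false := by
  obtain ⟨x, t⟩ := b
  rcases Prod.Lex.lt_iff.1 h with h | ⟨h1, h2⟩
  · exact Prod.Lex.le_iff.2 (Or.inl h)
  · refine Prod.Lex.le_iff.2 (Or.inr ⟨h1, ?_⟩)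
    change t < true at h2
    change t ≤ false
    revert h2
    cases t <;> simp

/-- One insertion into a tableau without the last copy of its largest letter. -/
theorem IsLast.mixInsert {T : Filling PLetter} {q : Cell} {k x : Letter} {u : Bool}
    (hT : IsTableau T) (h : IsLast T q (mark k u)) (hx : x < k) :
    IsLast (mixInsert T x) q (mark k u) := by
  have hM : ∀ y, (ShiftedInsertion.mixInsert T x).entry y = some (mark k u) → T.entry y = some (mark k u) ∨
      T.entry y = none ∧ ∃ p, T.entry p = some (mark k u) ∧
        ((mark k u).IsPrimed → y.1 ≤ p.1) ∧ (¬ (mark k u).IsPrimed → y.2 ≤ p.2) := by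
    refine entry_eq_max T (.row 0) (PLetter.unprimed x) h.le (unprimed_lt_mark hx u) ?_ ?_ ?_ ?_
    · intro p b hb
      exact hT.low.1 _ _ (Filling.mem_of_entry hb)
    · rintro hp ⟨i, j⟩ he (rfl : i = j)
      exact hT.diag he hp
    · rintro hp ⟨i, j⟩ he
      by_contra hne
      obtain ⟨b, hb⟩ := Option.ne_none_iff_exists'.1 hne
      have := hT.col (Nat.lt_succ_self i) he hb
      exact hp (this.2 (le_antisymm this.1 (h.le _ _ hb)))
    · rintro hp ⟨i, j⟩ he
      by_contra hne
      obtain ⟨b, hb⟩ := Option.ne_none_iff_exists'.1 hne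
      have := hT.row (Nat.lt_succ_self j) he hb
      exact this.2 (le_antisymm this.1 (h.le _ _ hb)) hp
  refine ⟨entries_le _ _ _ h.le (unprimed_lt_mark hx u).le, ?_, ?_⟩
  · intro hp y hy
    rcases hM y hy with h' | ⟨-, p, hp', h1, -⟩
    · exact h.primed hp y h'
    · exact (h1 hp).trans_lt (h.primed hp p hp')
  · intro hp y hy
    rcases hM y hy with h' | ⟨-, p, hp', -, h1⟩
    · exact h.unprimed hp y h'
    · exact (h1 hp).trans_lt (h.unprimed hp p hp')

/-- All copies of `m` lie to the left of column `c`. A copy above row `r` would force another one in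
column `c`, and a copy in row `r` would stand before the smaller letter `b`. -/
theorem IsLast.ge_of_bump {T : Filling PLetter} {r c : ℕ} {m b : PLetter} (hT : IsTableau T)
    (h : IsLast T (r, c) m) (hm : ¬ m.IsPrimed) (hb : T.entry (r, c) = some b) (hlt : b < m)
    {p : Cell} (hp : T.entry p = some m) : r + 1 ≤ p.1 := by
  obtain ⟨i, j⟩ := p
  have hj : j < c := h.unprimed hm _ hp
  have hi := hT.low.1 _ _ (Filling.mem_of_entry hb)
  rcases lt_trichotomy i r with hir | rfl | hir
  · obtain ⟨e, he⟩ := Filling.exists_entry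
      (hT.low.2 r c (Filling.mem_of_entry hb) i hir.le c le_rfl (by omega))
    obtain rfl : m = e := le_antisymm (hT.row hj hp he).1 (h.le _ _ he)
    have := h.unprimed hm _ he
    simp at this
  · exact absurd (hT.row hj hp hb).1 (not_le.2 hlt)
  · exact hir

/-- A bumped unprimed letter off the main diagonal moves to the next row. -/
theorem IsLast.bump_row {T : Filling PLetter} {A : Set Cell} {r c : ℕ} {m b : PLetter}
    (hT : IsTableau T) (h : IsLast T (r, c) m) (hm : ¬ m.IsPrimed)
    (hb : T.entry (r, c) = some b) (hlt : b < m) (hq : ShiftedAddable A (r, c)) (hrc : r < c)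
    (hA : (T.shape : Set Cell) = insert (r, c) A) :
    ∃ n : Cell, n.1 = r + 1 ∧ ShiftedAddable T.shape n ∧ IsLast T n m ∧
      T.mixInsertLine (.row (r + 1)) m = T.write n m := by
  obtain ⟨e1, k, e2, e3⟩ := Filling.target_of_le (L := .row (r + 1)) h.le
  rw [e2] at e1
  simp only [Line.cell] at e1 e2 e3
  have hcol : (r + 1, c) ∉ (T.shape : Set Cell) := by
    rw [hA]
    rintro (h' | h')
    · simp at h'
    · exact hq.2.1 (hq.1.2 _ _ h' r (by omega) c le_rfl hrc.le)
  -- The cell below `(r, c)` is empty, so row `r + 1` ends weakly to its left.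
  have hkc : r + 1 + k ≤ c := by
    by_contra hlt'
    refine e3 (c - (r + 1)) (by omega) ?_
    rw [show r + 1 + (c - (r + 1)) = c by omega]
    exact Filling.entry_eq_none.2 hcol
  refine ⟨(r + 1, r + 1 + k), rfl, ?_, ⟨h.le, fun hp => absurd hp hm, ?_⟩, ?_⟩
  · refine shiftedAddable_of hT.low (Filling.entry_eq_none.1 e1) (by simp) ?_ ?_
    · intro i hi
      exact hT.low.2 r c (Filling.mem_of_entry hb) i (by simp at hi; omega) _ hkc
        (by simp at hi; omega)
    · intro j hj hj'
      simp only at hj hj'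
      by_contra hne
      refine e3 (j - (r + 1)) (by omega) ?_
      rw [show r + 1 + (j - (r + 1)) = j by omega]
      exact Filling.entry_eq_none.2 hne
  · intro _ p hp
    have h1 := h.ge_of_bump hT hm hb hlt hp
    by_contra hge
    exact Filling.entry_eq_none.1 e1 (hT.low.2 p.1 p.2 (Filling.mem_of_entry hp) _ h1 _
      (by simpa using hge) (by omega))
  · rw [Filling.mixInsertLine_of_none (by rw [e2]; exact e1), e2]

/-- A bumped primed letter moves to the next column. -/
theorem IsLast.bump_col {T : Filling PLetter} {A : Set Cell} {r c : ℕ} {m b : PLetter}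
    (hT : IsTableau T) (hle : ∀ p b, T.entry p = some b → b ≤ m) (hm : m.IsPrimed)
    (hp : ∀ p, T.entry p = some m → p.2 ≤ c → p.1 ≤ r)
    (hb : T.entry (r, c) = some b) (hlt : b < m) (hq : ShiftedAddable A (r, c))
    (hA : (T.shape : Set Cell) = insert (r, c) A) :
    ∃ n : Cell, n.2 = c + 1 ∧ ShiftedAddable T.shape n ∧ IsLast T n m ∧
      T.mixInsertLine (.col (c + 1)) m = T.write n m := by
  obtain ⟨e1, s, e2, e3⟩ := Filling.target_of_le (L := .col (c + 1)) hle
  rw [e2] at e1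
  simp only [Line.cell] at e1 e2 e3
  have hrc := hq.le
  simp only at hrc
  have hcol : (r, c + 1) ∉ (T.shape : Set Cell) := by
    rw [hA]
    rintro (h' | h')
    · simp at h'
    · exact hq.2.1 (hq.1.2 _ _ h' r le_rfl c (by omega) hrc)
  have hsr : s ≤ r := by
    by_contra hlt'
    exact e3 r (by omega) (Filling.entry_eq_none.2 hcol)
  refine ⟨(s, c + 1), rfl, ?_, ⟨hle, ?_, fun hp => absurd hm hp⟩, ?_⟩
  · refine shiftedAddable_of hT.low (Filling.entry_eq_none.1 e1) (by simp; omega) ?_ ?_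
    · intro i hi
      by_contra hne
      exact e3 i hi (Filling.entry_eq_none.2 hne)
    · intro j hj hj'
      simp only at hj hj'
      exact hT.low.2 r c (Filling.mem_of_entry hb) s hsr j (by omega) hj'
  · rintro _ ⟨i, j⟩ he
    by_contra hge
    simp only [not_lt] at hge
    by_cases hjc : j ≤ c
    · have hir := hp _ he hjc
      simp only at hir
      have hmem : (i, c) ∈ (T.shape : Set Cell) :=
        hT.low.2 r c (Filling.mem_of_entry hb) i hir c le_rfl (by omega)
      obtain ⟨e, hec⟩ := Filling.exists_entry hmem
      rcases hjc.lt_or_eq with hjc | rfl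
      · have := hT.row hjc he hec
        exact this.2 (le_antisymm this.1 (hle _ _ hec)) hm
      · rcases hir.lt_or_eq with hir | rfl
        · exact absurd (hT.col hir he hb).1 (not_le.2 hlt)
        · rw [he] at hb
          simp only [Option.some.injEq] at hb
          exact hlt.ne hb.symm
    · exact Filling.entry_eq_none.1 e1 (hT.low.2 i j (Filling.mem_of_entry he) s hge (c + 1)
        (by omega) (by omega))
  · rw [Filling.mixInsertLine_of_none (by rw [e2]; exact e1), e2]

/-- When the cell of the last copy of the largest letter has been taken, that copy goes to the end
of the next line, where it is again the last copy, possibly primed. This is the link between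
`afterBump` and `ShiftedNext`. -/
theorem IsLast.bump {T : Filling PLetter} {A : Set Cell} {q : Cell} {k : Letter} {u : Bool}
    {b : PLetter} (hT : IsTableau T) (h : IsLast T q (mark k u)) (ho : OffDiag q u)
    (hb : T.entry q = some b) (hlt : b < mark k u) (hq : ShiftedAddable A q)
    (hA : (T.shape : Set Cell) = insert q A) :
    ∃ n v, ShiftedNext q u n v ∧ ShiftedAddable T.shape n ∧ IsLast T n (mark k v) ∧
      T.mixInsertLine (afterBump q (mark k u)).1 (afterBump q (mark k u)).2 =
        T.write n (mark k v) := by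
  obtain ⟨r, c⟩ := q
  have hrc := hq.le
  simp only at hrc
  by_cases hu : u = true ∧ r ≠ c
  · obtain ⟨rfl, hne⟩ := hu
    obtain ⟨n, h1, h2, h3, h4⟩ := h.bump_row hT (by simp [isPrimed_mark]) hb hlt hq (by omega) hA
    refine ⟨n, true, by simp [ShiftedNext, hne, h1], h2, h3, ?_⟩
    simp [afterBump, hne, isPrimed_mark, h4]
  · have hnext : ∀ n : Cell, n.2 = c + 1 → ShiftedNext (r, c) u n false := by
      intro n hn
      simp only [ShiftedNext, if_neg hu]
      exact ⟨hn, trivial⟩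
    have hab : afterBump (r, c) (mark k u) = (.col (c + 1), mark k false) := by
      cases u with
      | true =>
        obtain rfl : r = c := by simpa using hu
        simp [afterBump, mark, PLetter.primed, PLetter.base]
      | false =>
        have : r ≠ c := (ho rfl).ne
        simp [afterBump, this, isPrimed_mark]
    have hprimed : (mark k false).IsPrimed := rfl
    suffices hsuff : (∀ p b, T.entry p = some b → b ≤ mark k false) ∧
        (∀ p, T.entry p = some (mark k false) → p.2 ≤ c → p.1 ≤ r) ∧ b < mark k false by
      obtain ⟨n, h1, h2, h3, h4⟩ := IsLast.bump_col hT hsuff.1 hprimed hsuff.2.1 hb hsuff.2.2 hq hA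
      exact ⟨n, false, hnext n h1, h2, h3, by rw [hab]; exact h4⟩
    cases u with
    | false => exact ⟨h.le, fun p hp _ => (h.primed hprimed p hp).le, hlt⟩
    | true =>
      obtain rfl : r = c := by simpa using hu
      -- On the diagonal the unprimed letter turns into a primed one, which must then be the
      -- largest. No unprimed copy remains: it would be in a row below `r` and a column before `r`,
      -- hence under the diagonal.
      have hno : ∀ p, T.entry p ≠ some (mark k true) := by
        intro p hp
        have h1 := h.ge_of_bump hT (by simp [isPrimed_mark]) hb hlt hp
        have h2 := h.unprimed (by simp [isPrimed_mark]) p hp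
        have h3 := hT.low.1 p.1 p.2 (Filling.mem_of_entry hp)
        simp only at h2
        omega
      refine ⟨fun p b hp => le_primed_of_lt (lt_of_le_of_ne (h.le p b hp) ?_), ?_, ?_⟩
      · rintro rfl
        exact hno p hp
      · intro p hp hle
        exact (hT.low.1 p.1 p.2 (Filling.mem_of_entry hp)).trans hle
      · refine lt_of_le_of_ne (le_primed_of_lt hlt) ?_
        rintro rfl
        exact hT.diag hb rfl

/-- Mixed insertion into a tableau with a last copy of its largest letter follows the rule of
shifted growth. -/
theorem MixRun.exists_shiftedPass {k : Letter} {xs : List Letter} {cs : List Cell}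
    {T : Filling PLetter} {q : Cell} {u : Bool} (h : MixRun T xs cs) (hT : IsTableau T)
    (hq : ShiftedAddable T.shape q) (ho : OffDiag q u) (hl : IsLast T q (mark k u))
    (hx : ∀ x ∈ xs, x < k) :
    ∃ q' u' cs', ShiftedPass T.shape q u cs q' u' cs' ∧ MixRun (T.write q (mark k u)) xs cs' := by
  induction xs generalizing T cs q u with
  | nil =>
    match cs, h with
    | [], _ => exact ⟨q, u, [], .nil _ _ _, trivial⟩
  | cons x xs ih =>
    match cs, h with
    | c :: cs, ⟨h1, h2, h3, h4⟩ =>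
      have hxk : x < k := hx x (by simp)
      have hqn : T.entry q = none := Filling.entry_eq_none.2 hq.2.1
      have hl' := hl.mixInsert hT hxk
      have hw := Filling.mixInsertLine_write (q := q) (m := mark k u) T (.row 0)
        (PLetter.unprimed x) hqn
      have hx' : ∀ y ∈ xs, y < k := fun y hy => hx y (by simp [hy])
      by_cases hc : c = q
      · subst hc
        obtain ⟨b, hb⟩ := Filling.exists_entry (T := mixInsert T x) (p := c) (by rw [h1]; simp)
        have hbm : b < mark k u := by
          refine lt_of_le_of_ne (hl'.le _ _ hb) ?_
          rintro rfl
          by_cases hp : (mark k u).IsPrimed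
          · exact lt_irrefl _ (hl'.primed hp _ hb)
          · exact lt_irrefl _ (hl'.unprimed hp _ hb)
        -- The insertion of `x` ends exactly in the cell of the travelling letter, which is then
        -- bumped once and settles in `n`.
        obtain ⟨n, v, hn, hna, hnl, he⟩ := hl'.bump h3 ho hb hbm h2 h1
        have hna' := hna
        rw [h1] at hna'
        have hon := hn.offDiag h2 hna'
        obtain ⟨q', u', cs', hp, hr⟩ := ih h4 h3 hna hon hnl hx'
        have hmi : mixInsert (T.write c (mark k u)) x = (mixInsert T x).write n (mark k v) :=
          (hw.2 b hb hbm).trans he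
        rw [h1] at hp
        refine ⟨q', u', n :: cs', .bump hna' hn hp, ?_, ?_, ?_, ?_⟩
        · rw [hmi, Filling.coe_shape_write, Filling.coe_shape_write, h1]
        · rwa [Filling.coe_shape_write]
        · rw [hmi]
          exact h3.write hnl hna (fun hpr => (hon (isPrimed_mark.1 hpr)).ne)
        · rwa [hmi]
      · have hqn' : (mixInsert T x).entry q = none := by
          rw [Filling.entry_eq_none, h1]
          rintro (h | h)
          · exact hc h.symm
          · exact hq.2.1 h
        have hq' : ShiftedAddable (mixInsert T x).shape q := by rw [h1]; exact h2.comm hq hc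
        obtain ⟨q', u', cs', hp, hr⟩ := ih h4 h3 hq' ho hl' hx'
        have hmi : mixInsert (T.write q (mark k u)) x = (mixInsert T x).write q (mark k u) :=
          hw.1 hqn'
        rw [h1] at hp
        refine ⟨q', u', c :: cs', .keep hc hp, ?_, ?_, ?_, ?_⟩
        · rw [hmi, Filling.coe_shape_write, Filling.coe_shape_write, h1, Set.insert_comm]
        · rw [Filling.coe_shape_write]; exact hq.comm h2 (Ne.symm hc)
        · rw [hmi]
          exact h3.write hl' hq' (fun hpr => (ho (isPrimed_mark.1 hpr)).ne)
        · rwa [hmi]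

/-- Insertion of a new copy of the largest letter. -/
theorem exists_mixInsert_last {T : Filling PLetter} {k : Letter} (hT : IsTableau T)
    (hle : ∀ p b, T.entry p = some b → b ≤ mark k true) :
    ∃ s : Cell, s.1 = 0 ∧ ShiftedAddable T.shape s ∧ IsLast T s (mark k true) ∧
      mixInsert T k = T.write s (mark k true) := by
  obtain ⟨e1, j, e2, e3⟩ := Filling.target_of_le (L := .row 0) hle
  rw [e2] at e1
  simp only [Line.cell, Nat.zero_add] at e1 e2 e3
  refine ⟨(0, j), rfl, ?_, ⟨hle, by simp [isPrimed_mark], ?_⟩, ?_⟩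
  · refine shiftedAddable_of hT.low (Filling.entry_eq_none.1 e1) (by simp) (by simp) ?_
    intro i hi _
    by_contra hne
    exact e3 i hi (Filling.entry_eq_none.2 hne)
  · intro _ p hp
    by_contra hge
    exact Filling.entry_eq_none.1 e1 (hT.low.2 p.1 p.2 (Filling.mem_of_entry hp) 0 (by omega) j
      (by simpa using hge) (by omega))
  · change T.mixInsertLine (.row 0) (mark k true) = _
    rw [Filling.mixInsertLine_of_none (by rw [e2]; exact e1), e2]

theorem foldl_mixInsert_le {k : Letter} {xs : List Letter} (T : Filling PLetter)
    (hT : ∀ p b, T.entry p = some b → b ≤ mark k true) (hx : ∀ x ∈ xs, x ≤ k) :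
    ∀ p b, (xs.foldl mixInsert T).entry p = some b → b ≤ mark k true := by
  induction xs generalizing T with
  | nil => exact hT
  | cons x xs ih =>
    refine ih _ (entries_le _ _ _ hT ?_) fun y hy => hx y (by simp [hy])
    exact Prod.Lex.le_iff.2 ((hx x (by simp)).lt_or_eq.imp id fun h => ⟨h, le_rfl⟩)

theorem isTableau_empty : IsTableau Filling.empty :=
  ⟨by simpa [Filling.empty] using shiftedLow_empty, by simp [Filling.empty],
    by simp [Filling.empty], by simp [Filling.empty]⟩

/-- Words whose letters carry indices that increase among equal letters. -/
def IsIndexed (W : List (Letter ×ₗ ℕ)) : Prop :=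
  W.Pairwise fun a b => (ofLex a).1 = (ofLex b).1 → (ofLex a).2 < (ofLex b).2

/-- The word obtained by forgetting the indices. -/
def forget (W : List (Letter ×ₗ ℕ)) : List Letter := W.map fun a => (ofLex a).1

theorem IsIndexed.nodup {W : List (Letter ×ₗ ℕ)} (h : IsIndexed W) : W.Nodup :=
  List.Pairwise.imp (fun {a b} hab e => by subst e; exact lt_irrefl _ (hab rfl)) h

/-- The shapes of the mixed insertion tableaux grow as described by `ShiftedGrowth`. -/
theorem IsIndexed.exists_growth {W : List (Letter ×ₗ ℕ)} (h : IsIndexed W) :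
    ∃ cs, ShiftedGrowth W cs ∧ MixRun Filling.empty (forget W) cs := by
  induction hn : W.length using Nat.strong_induction_on generalizing W with
  | _ n ih =>
    by_cases hW : W = []
    · subst hW
      exact ⟨[], .nil, trivial⟩
    · obtain ⟨m, hmW, hmax⟩ : ∃ m ∈ W, ∀ x ∈ W, x ≤ m := by
        have hne : W.toFinset.Nonempty := by
          obtain ⟨a, l, rfl⟩ := List.exists_cons_of_ne_nil hW
          exact ⟨a, by simp⟩
        exact ⟨W.toFinset.max' hne, by simpa using W.toFinset.max'_mem hne,
          fun x hx => W.toFinset.le_max' x (by simpa using hx)⟩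
      obtain ⟨U, V, rfl⟩ := List.append_of_mem hmW
      have hnd := h.nodup
      rw [List.nodup_middle, List.nodup_cons] at hnd
      have hm : ∀ x ∈ U ++ V, x < m := fun x hx =>
        lt_of_le_of_ne (hmax x (by simp at hx ⊢; tauto)) (by rintro rfl; exact hnd.1 hx)
      have hUV : IsIndexed (U ++ V) := List.Pairwise.sublist (by simp) h
      obtain ⟨cs, hg, hr⟩ := ih (U ++ V).length (by simp at hn ⊢; omega) hUV rfl
      obtain ⟨us, vs, rfl, hl⟩ : ∃ us vs, cs = us ++ vs ∧ us.length = U.length := by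
        have := hg.length_eq
        simp only [List.length_append] at this
        exact ⟨cs.take U.length, cs.drop U.length, by simp, by simp; omega⟩
      have hf : forget (U ++ V) = forget U ++ forget V := by simp [forget]
      have hl' : us.length = (forget U).length := by simpa [forget] using hl
      rw [hf, mixRun_append hl'] at hr
      set T := (forget U).foldl mixInsert Filling.empty with hTdef
      set k := (ofLex m).1 with hk
      have hT : IsTableau T := hr.1.isTableau isTableau_empty
      have hTs : (T.shape : Set Cell) = addCells ∅ us := by
        rw [hTdef, hr.1.shape_eq]; simp [Filling.empty]
      have hle : ∀ p b, T.entry p = some b → b ≤ mark k true := by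
        refine foldl_mixInsert_le _ (by simp [Filling.empty]) ?_
        intro x hx
        simp only [forget, List.mem_map] at hx
        obtain ⟨a, ha, rfl⟩ := hx
        rcases Prod.Lex.lt_iff.1 (hm a (by simp [ha])) with h' | h'
        · exact h'.le
        · exact h'.1.le
      obtain ⟨s, hs0, hsa, hsl, hse⟩ := exists_mixInsert_last hT hle
      -- By the indices, `m` is the last occurrence of the largest letter, so the letters after it
      -- are strictly smaller and can displace it.
      have hV : ∀ x ∈ forget V, x < k := by
        intro x hx
        simp only [forget, List.mem_map] at hx
        obtain ⟨a, ha, rfl⟩ := hx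
        rcases Prod.Lex.lt_iff.1 (hm a (by simp [ha])) with h' | h'
        · exact h'
        · have h2 := (List.pairwise_append.1 h).2.1
          rw [List.pairwise_cons] at h2
          exact absurd (h2.1 a ha h'.1.symm) (not_lt.2 h'.2.le)
      obtain ⟨q', u', vs', hp, hr'⟩ := hr.2.exists_shiftedPass hT hsa (fun h => by simp at h) hsl hV
      have hsa' := hsa
      rw [hTs] at hp hsa
      refine ⟨us ++ s :: vs', .ins hm hg hl hsa hs0 hp, ?_⟩
      have hf' : forget (U ++ m :: V) = forget U ++ k :: forget V := by simp [forget, hk]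
      rw [hf', mixRun_append hl']
      refine ⟨hr.1, ?_, hsa', ?_, ?_⟩
      · rw [← hTdef, hse, Filling.coe_shape_write]
      · rw [← hTdef, hse]
        exact hT.write hsl hsa' (by simp [isPrimed_mark])
      · rw [← hTdef, hse]
        exact hr'

end ShiftedInsertion

namespace ShiftedInsertion

/-! ### Peaks -/

theorem ShiftedAddable.lt_or_lt {A : Set Cell} {p p' : Cell} (h : ShiftedAddable A p)
    (h' : ShiftedAddable A p') (hne : p ≠ p') :
    p.1 < p'.1 ∧ p'.2 < p.2 ∨ p'.1 < p.1 ∧ p.2 < p'.2 := by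
  have key : ∀ {p p' : Cell}, ShiftedAddable A p → ShiftedAddable A p' → p ≠ p' →
      p.1 ≤ p'.1 → p'.2 < p.2 := by
    rintro ⟨a, b⟩ ⟨c, d⟩ h h' hne hle
    by_contra hlt
    simp only [ne_eq, Prod.mk.injEq] at hne hle hlt
    exact h.2.1 (h'.lt_mem h.le hle (by simp; omega) (by simp; omega))
  have h1 := key h h' hne
  have h2 := key h' h hne.symm
  omega

theorem IsShiftedPath.col_lt_iff {A : Set Cell} {c d : Cell} {cs : List Cell}
    (h : IsShiftedPath A (c :: d :: cs)) : c.2 < d.2 ↔ d.1 ≤ c.1 := by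
  obtain ⟨hc, hd, -⟩ := h
  have hcl := hc.le
  have hdl := hd.le
  obtain ⟨a, b⟩ := c
  obtain ⟨i, j⟩ := d
  simp only at hcl hdl ⊢
  constructor
  · intro hlt
    by_contra hle
    rcases hd.lt_mem (i := a) (j := b + 1) (by omega) (by simp; omega) (by simp; omega)
      (by simp; omega) with h | h
    · simp at h
    · exact hc.2.1 (hc.1.2 _ _ h a le_rfl b (by omega) hcl)
  · intro hle
    by_contra hlt
    refine hd.2.1 ?_
    by_cases he : (i, j) = (a, b)
    · exact Or.inl he
    · simp only [Prod.mk.injEq] at he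
      exact Or.inr (hc.lt_mem hdl hle (by simp; omega) (by simp; omega))

/-- The largest letter passing through two cells preserves whether the second one is to the right
of the first one, except if it moves from the first cell to the main diagonal. -/
theorem ShiftedPass.col_lt_iff {A : Set Cell} {q q' c d c' d' : Cell} {u u' : Bool}
    (h : ShiftedPass A q u [c, d] q' u' [c', d']) (hq : ShiftedAddable A q)
    (hcs : IsShiftedPath A [c, d]) :
    (c.2 < d.2 ↔ c'.2 < d'.2) ∨ (c = q ∧ u = true ∧ q.1 ≠ q.2 ∧ d.1 = q.1 + 1 ∧ d.2 = d.1 ∧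
      c' = d ∧ d' = q' ∧ d'.2 = d.2 + 1 ∧ u' = false) := by
  have hcs' := (h.isPath hq hcs).2.1
  have i1 := hcs.col_lt_iff
  have i2 := hcs'.col_lt_iff
  cases h with
  | keep h hp =>
    have l1 := hcs.1.lt_or_lt hq h
    cases hp with
    | keep h' hp' => cases hp'; exact Or.inl Iff.rfl
    | bump hn hl hp' =>
      cases hp'
      left
      unfold ShiftedNext at hl
      split_ifs at hl <;> omega
  | bump hn hl hp =>
    cases hp with
    | keep h' hp' =>
      cases hp'
      have l1 := hcs.2.1.lt_or_lt hn h'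
      left
      unfold ShiftedNext at hl
      split_ifs at hl <;> omega
    | bump hn' hl' hp' =>
      cases hp'
      by_cases hu : u = true ∧ q.1 ≠ q.2
      · simp only [ShiftedNext, if_pos hu] at hl
        by_cases hd : d.1 = d.2
        · simp only [ShiftedNext, hd, ne_eq, not_true_eq_false, and_false, if_false] at hl'
          -- The exceptional case: bumped by rows onto the diagonal and at once bumped again, the
          -- letter leaves to the right instead of downwards. This is why plain descents are not
          -- preserved by the shifted growth.
          exact Or.inr ⟨rfl, hu.1, hu.2, hl.1, hd.symm, rfl, rfl, hl'.1, hl'.2⟩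
        · simp only [ShiftedNext, hl.2, ne_eq, hd, not_false_eq_true, and_self, if_true] at hl'
          left; omega
      · simp only [ShiftedNext, if_neg hu] at hl
        simp only [ShiftedNext, hl.2, Bool.false_eq_true, false_and, if_false] at hl'
        left; omega

/-- The largest letter passing through three cells preserves whether they form a peak. -/
theorem ShiftedPass.peak_iff {A : Set Cell} {q q' c₁ c₂ c₃ d₁ d₂ d₃ : Cell} {u u' : Bool}
    (h : ShiftedPass A q u [c₁, c₂, c₃] q' u' [d₁, d₂, d₃]) (hq : ShiftedAddable A q)
    (hcs : IsShiftedPath A [c₁, c₂, c₃]) :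
    c₁.2 < c₂.2 ∧ c₂.1 < c₃.1 ↔ d₁.2 < d₂.2 ∧ d₂.1 < d₃.1 := by
  have hds := (h.isPath hq hcs).2.1
  have i1 := hcs.2.col_lt_iff
  have i2 := hds.2.col_lt_iff
  have i3 := hcs.col_lt_iff
  obtain ⟨q₂, u₂, es, es', h12, h3, e⟩ := shiftedPass_append (cs := [c₁, c₂]) (ds := [c₃]) |>.1 h
  obtain ⟨e₁, e₂, rfl⟩ := List.length_eq_two.1 h12.length_eq
  obtain ⟨e₃, rfl⟩ := List.length_eq_one_iff.1 h3.length_eq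
  simp only [List.cons_append, List.nil_append, List.cons.injEq, and_true] at e
  obtain ⟨rfl, rfl, rfl⟩ := e
  obtain ⟨q₁, u₁, fs, fs', h1, h23, e⟩ := shiftedPass_append (cs := [c₁]) (ds := [c₂, c₃]) |>.1 h
  obtain ⟨f₁, rfl⟩ := List.length_eq_one_iff.1 h1.length_eq
  obtain ⟨f₂, f₃, rfl⟩ := List.length_eq_two.1 h23.length_eq
  simp only [List.cons_append, List.nil_append, List.cons.injEq, and_true] at e
  obtain ⟨rfl, rfl, rfl⟩ := e
  have hq₁ := h1.isPath hq (by exact ⟨hcs.1, trivial⟩)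
  have hq₂ := h12.isPath hq (by exact ⟨hcs.1, hcs.2.1, trivial⟩)
  have j1 := h12.col_lt_iff hq (by exact ⟨hcs.1, hcs.2.1, trivial⟩)
  have j2 := h23.col_lt_iff hq₁.1 (by simpa using hcs.2)
  -- If one of the two pairs is exceptional, neither triple is a peak. The exception itself excludes
  -- a peak on one side, and the other comparison of the triple excludes it on the other side.
  rcases j1 with j1 | ⟨rfl, -, hne, e1, e2, rfl, rfl, e5, rfl⟩
  · rcases j2 with j2 | ⟨rfl, rfl, hne, e1, e2, rfl, rfl, e5, rfl⟩
    · omega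
    · have hlt : ¬ c₁.2 < c₂.2 := by
        cases h1 with
        | keep h' hp =>
          cases hp
          intro hlt
          have := hcs.1.lt_or_lt hq h'
          have h2 := hcs.1.le
          have h3 : (d₂.1, d₂.2) ∈ insert c₁ A :=
            hcs.1.2.2.2 c₁.1 c₁.2 (Or.inl rfl) _ (by omega) _ (by omega) (by omega)
          exact hcs.2.2.1.2.1 (Or.inr h3)
        | bump hn hl hp =>
          cases hp
          unfold ShiftedNext at hl
          split_ifs at hl
          · omega
          · simp at hl
      omega
  · have : ¬ d₂.1 < d₃.1 := by
      cases h3 with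
      | keep h' hp =>
        cases hp
        intro hlt
        have h1 := hcs.2.2.1.lt_or_lt (by simpa using hq₂.1) h'
        have h2 := hcs.2.2.1.le
        have h3 : (c₃.1, c₃.2) ∈ insert d₁ (insert c₁ A) :=
          hcs.2.1.2.2.2 d₁.1 d₁.2 (Or.inl rfl) _ (by omega) _ (by omega) h2
        exact hcs.2.2.1.2.1 h3
      | bump hn hl hp =>
        cases hp
        simp [ShiftedNext] at hl
        omega
    omega

/-! ### Peaks of a word and of its growth -/

section Growth

variable {α : Type} [LinearOrder α]

theorem ShiftedGrowth.nodup {W : List α} {cs : List Cell} (h : ShiftedGrowth W cs) :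
    W.Nodup := by
  induction h with
  | nil => exact List.nodup_nil
  | ins hm hg hl hs h0 hp ih =>
    rw [List.nodup_middle, List.nodup_cons]
    exact ⟨fun hx => lt_irrefl _ (hm _ hx), ih⟩

theorem ShiftedGrowth.inv {U V : List α} {m : α} {cs : List Cell}
    (h : ShiftedGrowth (U ++ m :: V) cs) (hm : ∀ x ∈ U ++ V, x < m) :
    ∃ us vs vs' s q u, cs = us ++ s :: vs' ∧ ShiftedGrowth (U ++ V) (us ++ vs) ∧
      us.length = U.length ∧ ShiftedAddable (addCells ∅ us) s ∧ s.1 = 0 ∧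
      ShiftedPass (addCells ∅ us) s true vs q u vs' := by
  generalize hW : U ++ m :: V = W at h
  cases h with
  | nil => simp at hW
  | @ins U' V' m' us vs vs' s q u hm' hg hl hs h0 hp =>
    have hmm : m = m' := by
      rcases lt_trichotomy m m' with h' | h' | h'
      · have h1 : m' ∈ U ++ m :: V := by rw [hW]; simp
        have h2 : m' ∈ U ++ V := by simp at h1 ⊢; rcases h1 with h1 | rfl | h1 <;> simp_all
        exact absurd (hm _ h2) h'.asymm
      · exact h'
      · have h1 : m ∈ U' ++ m' :: V' := by rw [← hW]; simp
        have h2 : m ∈ U' ++ V' := by simp at h1 ⊢; rcases h1 with h1 | rfl | h1 <;> simp_all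
        exact absurd (hm' _ h2) h'.asymm
    subst hmm
    obtain ⟨rfl, rfl⟩ := append_cons_inj_of_notMem
      (fun hx => lt_irrefl _ (hm m (by simp [hx]))) (fun hx => lt_irrefl _ (hm' m (by simp [hx]))) hW
    exact ⟨us, vs, vs', s, q, u, rfl, hg, hl, hs, h0, hp⟩

theorem ShiftedGrowth.exists_max {W : List α} {cs : List Cell} (h : ShiftedGrowth W cs)
    (hW : W ≠ []) : ∃ U m V, W = U ++ m :: V ∧ ∀ x ∈ U ++ V, x < m := by
  cases h with
  | nil => exact absurd rfl hW
  | ins hm => exact ⟨_, _, _, rfl, hm⟩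

/-- Three consecutive letters form a peak exactly if the corresponding new cells do. -/
theorem ShiftedGrowth.peak_iff {P S : List α} {x y z : α} {ps ss : List Cell} {a b c : Cell}
    (h : ShiftedGrowth (P ++ [x, y, z] ++ S) (ps ++ [a, b, c] ++ ss)) (hps : ps.length = P.length) :
    x < y ∧ z < y ↔ a.2 < b.2 ∧ b.1 < c.1 := by
  induction hn : (P ++ S).length using Nat.strong_induction_on generalizing P S ps ss a b c with
  | _ n ih =>
    obtain ⟨U, m, V, hW, hm⟩ := h.exists_max (by simp)
    have hnd := h.nodup
    have hpath := h.isPath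
    rw [isShiftedPath_append, isShiftedPath_append] at hpath
    replace hpath := hpath.1.2
    have i1 := hpath.col_lt_iff
    have i2 := hpath.2.col_lt_iff
    rcases exists_split_of_mem (show m ∈ P ++ [x, y, z] ++ S by rw [hW]; simp) with
      ⟨P₁, P₂, rfl⟩ | ⟨M₁, M₂, hM⟩ | ⟨S₁, S₂, rfl⟩
    · have hm2 := lt_of_max (U' := P₁) (V' := P₂ ++ [x, y, z] ++ S) hnd hW hm (by simp)
      rw [show P₁ ++ m :: P₂ ++ [x, y, z] ++ S = P₁ ++ m :: (P₂ ++ [x, y, z] ++ S) by simp] at h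
      obtain ⟨us, vs, vs', s, q, u, e, hg, hl, hs, h0, hp⟩ := h.inv hm2
      have hlen := hg.length_eq
      simp only [List.length_append] at hlen
      obtain ⟨v₁, v₂, v₃, rfl, l1, l2⟩ : ∃ v₁ v₂ v₃, vs = v₁ ++ v₂ ++ v₃ ∧
          v₁.length = P₂.length ∧ v₂.length = 3 :=
        ⟨vs.take P₂.length, (vs.drop P₂.length).take 3, (vs.drop P₂.length).drop 3,
          by rw [List.append_assoc, List.take_append_drop, List.take_append_drop],
          by simp; omega, by simp at hlen ⊢; omega⟩
      obtain ⟨q₂, u₂, v₁₂', v₃', hp12, hp3, rfl⟩ := shiftedPass_append.1 hp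
      obtain ⟨q₁, u₁, v₁', v₂', hp1, hp2, rfl⟩ := shiftedPass_append.1 hp12
      have e' : ps ++ [a, b, c] ++ ss = us ++ s :: v₁' ++ v₂' ++ v₃' := by simpa using e
      have k1 := hp1.length_eq
      have k2 := hp2.length_eq
      simp only [List.length_append, List.length_cons] at hps
      obtain ⟨e1, rfl⟩ := List.append_inj e' (by simp; omega)
      obtain ⟨rfl, rfl⟩ := List.append_inj e1 (by simp; omega)
      obtain ⟨d₁, d₂, d₃, rfl⟩ := List.length_eq_three.1 l2
      have hpath' := hg.isPath
      rw [isShiftedPath_append, isShiftedPath_append, isShiftedPath_append] at hpath'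
      have r1 := (hp1.isPath hs hpath'.2.1.1).1
      rw [← hp2.peak_iff r1 hpath'.2.1.2]
      exact ih (P₁ ++ P₂ ++ S).length (by simp at hn ⊢; omega) (P := P₁ ++ P₂) (S := S)
        (ps := us ++ v₁) (ss := v₃) (by simpa using hg) (by simp; omega) rfl
    · match M₁, hM with
      | [], hM =>
        simp only [List.nil_append, List.cons.injEq] at hM
        obtain ⟨rfl, -⟩ := hM
        have hm2 := lt_of_max (U' := P) (V' := y :: z :: S) hnd hW hm (by simp)
        have hxy : y < x := hm2 y (by simp)
        rw [show P ++ [x, y, z] ++ S = P ++ x :: (y :: z :: S) by simp] at h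
        obtain ⟨us, vs, vs', s, q, u, e, hg, hl, hs, h0, hp⟩ := h.inv hm2
        obtain ⟨rfl, e₂⟩ := List.append_inj
          (show ps ++ (a :: b :: c :: ss) = us ++ s :: vs' by simpa using e) (by omega)
        simp only [List.cons.injEq] at e₂
        obtain ⟨rfl, rfl⟩ := e₂
        have hg' := hg.isPath
        rw [isShiftedPath_append] at hg'
        replace hg' := hg'.2
        -- The largest letter comes first, so the letters do not form a peak. Its journey shows that
        -- the cells do not either: only a start on the diagonal allows `b` to be to the right of
        -- `a`, and then the primed letter keeps `c` from being lower.
        suffices a.2 < b.2 → ¬ b.1 < c.1 by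
          constructor
          · intro h'; exact absurd h'.1 hxy.asymm
          · intro h'; exact absurd h'.2 (this h'.1)
        intro hab
        cases hp with
        | keep hne hp' =>
          have := hs.lt_or_lt hg'.1 hne.symm
          omega
        | bump hn' hl' hp' =>
          have ho := hl'.offDiag hs hn'
          unfold ShiftedNext at hl'
          split_ifs at hl' with hu
          · omega
          · obtain ⟨hb, rfl⟩ := hl'
            have ha := hs.le
            simp only [h0, ne_eq, true_and] at hu
            cases hp' with
            | keep hne hp'' =>
              have h1 := hg'.2.1.lt_or_lt hn' hne
              have h2 := hg'.2.1.le
              omega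
            | bump hn'' hl'' hp'' =>
              simp [ShiftedNext] at hl''
              omega
      | [x'], hM =>
        simp only [List.singleton_append, List.cons.injEq] at hM
        obtain ⟨rfl, rfl, -⟩ := hM
        have hm2 := lt_of_max (U' := P ++ [x]) (V' := z :: S) hnd hW hm (by simp)
        have hxy : x < y := hm2 x (by simp)
        have hzy : z < y := hm2 z (by simp)
        rw [show P ++ [x, y, z] ++ S = (P ++ [x]) ++ y :: (z :: S) by simp] at h
        obtain ⟨us, vs, vs', s, q, u, e, hg, hl, hs, h0, hp⟩ := h.inv hm2
        obtain ⟨rfl, e₂⟩ := List.append_inj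
          (show (ps ++ [a]) ++ (b :: c :: ss) = us ++ s :: vs' by simpa using e)
          (by simp at hl ⊢; omega)
        simp only [List.cons.injEq] at e₂
        obtain ⟨rfl, rfl⟩ := e₂
        have hg' := hg.isPath
        rw [isShiftedPath_append] at hg'
        replace hg' := hg'.2
        have hab : a.2 < b.2 := i1.2 (by omega)
        suffices b.1 < c.1 by simp [hxy, hzy, hab, this]
        cases hp with
        | keep hne hp' =>
          have := hs.lt_or_lt hg'.1 hne.symm
          omega
        | bump hn' hl' hp' =>
          unfold ShiftedNext at hl'
          split_ifs at hl' with hu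
          · omega
          · simp only [h0, ne_eq, true_and, not_not] at hu
            omega
      | [x', y'], hM =>
        simp only [List.cons_append, List.nil_append, List.cons.injEq] at hM
        obtain ⟨rfl, rfl, rfl, -⟩ := hM
        have hm2 := lt_of_max (U' := P ++ [x, y]) (V' := S) hnd hW hm (by simp)
        have hyz : y < z := hm2 y (by simp)
        rw [show P ++ [x, y, z] ++ S = (P ++ [x, y]) ++ z :: S by simp] at h
        obtain ⟨us, vs, vs', s, q, u, e, hg, hl, hs, h0, hp⟩ := h.inv hm2
        obtain ⟨rfl, e₂⟩ := List.append_inj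
          (show (ps ++ [a, b]) ++ (c :: ss) = us ++ s :: vs' by simpa using e)
          (by simp at hl ⊢; omega)
        simp only [List.cons.injEq] at e₂
        obtain ⟨rfl, rfl⟩ := e₂
        constructor
        · intro h'; exact absurd h'.2 hyz.asymm
        · intro h'; omega
      | _ :: _ :: _ :: M, hM =>
        have := congrArg List.length hM
        simp at this
    · have hm2 := lt_of_max (U' := P ++ [x, y, z] ++ S₁) (V' := S₂) hnd hW hm (by simp)
      rw [show P ++ [x, y, z] ++ (S₁ ++ m :: S₂) = (P ++ [x, y, z] ++ S₁) ++ m :: S₂ by simp] at h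
      obtain ⟨us, vs, vs', s, q, u, e, hg, hl, hs, h0, hp⟩ := h.inv hm2
      simp only [List.length_append] at hl
      obtain ⟨u₁, u₂, rfl, l1⟩ : ∃ u₁ u₂, us = u₁ ++ u₂ ∧
          u₁.length = (ps ++ [a, b, c]).length :=
        ⟨us.take (ps ++ [a, b, c]).length, us.drop (ps ++ [a, b, c]).length,
          (List.take_append_drop _ _).symm, by simp at hl ⊢; omega⟩
      obtain ⟨rfl, -⟩ := List.append_inj
        (show (ps ++ [a, b, c]) ++ ss = u₁ ++ (u₂ ++ s :: vs') by simpa using e) l1.symm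
      exact ih (P ++ (S₁ ++ S₂)).length (by simp at hn ⊢; omega) (P := P) (S := S₁ ++ S₂)
        (ps := ps) (ss := u₂ ++ vs) (by simpa using hg) hps rfl

end Growth

end ShiftedInsertion

namespace ShiftedInsertion

/-! ### Shapes of mixed insertion tableaux -/

/-- The word with each letter carrying its position as an index. -/
def indexed (w : List Letter) : List (Letter ×ₗ ℕ) := w.zipIdx.map toLex

theorem forget_append (V W : List (Letter ×ₗ ℕ)) : forget (V ++ W) = forget V ++ forget W := by
  simp [forget]

theorem forget_indexed (w : List Letter) : forget (indexed w) = w := by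
  simp only [forget, indexed, List.map_map]
  exact List.zipIdx_map_fst 0 w

theorem isIndexed_indexed (w : List Letter) : IsIndexed (indexed w) := by
  simp only [IsIndexed, indexed, List.pairwise_map]
  have h : (w.zipIdx.map Prod.snd).Pairwise (· < ·) := by
    rw [List.zipIdx_map_snd]
    exact List.pairwise_lt_range'
  refine List.Pairwise.imp ?_ (List.pairwise_map.1 h)
  intro a b h _
  exact h

theorem forget_eq_append {W : List (Letter ×ₗ ℕ)} {u v : List Letter} (h : forget W = u ++ v) :
    ∃ U V, W = U ++ V ∧ forget U = u ∧ forget V = v := by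
  obtain ⟨U, V, h1, h2, h3⟩ := List.map_eq_append_iff.1 h
  exact ⟨U, V, h1, h2, h3⟩

theorem forget_eq_cons {W : List (Letter ×ₗ ℕ)} {x : Letter} {v : List Letter}
    (h : forget W = x :: v) : ∃ X V, W = X :: V ∧ (ofLex X).1 = x ∧ forget V = v := by
  obtain ⟨X, V, h1, h2, h3⟩ := List.map_eq_cons_iff.1 h
  exact ⟨X, V, h1, h2, h3⟩

theorem lt_of_fst_le {A B : Letter ×ₗ ℕ} (h : (ofLex A).1 ≤ (ofLex B).1)
    (hi : (ofLex A).1 = (ofLex B).1 → (ofLex A).2 < (ofLex B).2) : A < B :=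
  Prod.Lex.lt_iff.2 (h.lt_or_eq.imp id fun h => ⟨h, hi h⟩)

theorem lt_of_fst_lt {A B : Letter ×ₗ ℕ} (h : (ofLex A).1 < (ofLex B).1) : A < B :=
  Prod.Lex.lt_iff.2 (Or.inl h)

theorem lt_iff_of_indexed {A B : Letter ×ₗ ℕ}
    (hi : (ofLex A).1 = (ofLex B).1 → (ofLex A).2 < (ofLex B).2) :
    A < B ↔ (ofLex A).1 ≤ (ofLex B).1 := by
  refine ⟨fun h => ?_, fun h => lt_of_fst_le h hi⟩
  rcases Prod.Lex.lt_iff.1 h with h | h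
  · exact h.le
  · exact h.1.le

theorem gt_iff_of_indexed {A B : Letter ×ₗ ℕ}
    (hi : (ofLex A).1 = (ofLex B).1 → (ofLex A).2 < (ofLex B).2) :
    B < A ↔ (ofLex B).1 < (ofLex A).1 := by
  refine ⟨fun h => ?_, lt_of_fst_lt⟩
  rcases Prod.Lex.lt_iff.1 h with h | h
  · exact h
  · exact absurd (hi h.1.symm) h.2.asymm

/-- The list `cs` contains the cells by which the mixed insertion tableau grows along `w`. -/
structure IsMixPath (w : List Letter) (cs : List Cell) : Prop where
  run : MixRun Filling.empty w cs
  path : IsShiftedPath ∅ cs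
  length_eq : cs.length = w.length
  peak : ∀ P x y z S ps a b c ss, w = P ++ [x, y, z] ++ S → cs = ps ++ [a, b, c] ++ ss →
    ps.length = P.length → (x ≤ y ∧ z < y ↔ a.2 < b.2 ∧ b.1 < c.1)

/-- The indices make equal letters increase from left to right. Hence peaks of the indexed word are
the triples with a weak ascent followed by a strict descent. -/
theorem exists_isMixPath (w : List Letter) : ∃ cs, IsMixPath w cs := by
  obtain ⟨cs, hg, hr⟩ := (isIndexed_indexed w).exists_growth
  rw [forget_indexed] at hr
  refine ⟨cs, hr, hg.isPath, by simp [hg.length_eq, indexed], ?_⟩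
  rintro P x y z S ps a b c ss hw rfl hps
  have hi := isIndexed_indexed w
  have hf := forget_indexed w
  generalize indexed w = W at hi hf hg
  rw [hw] at hf
  obtain ⟨W₁, S', rfl, hf₁, rfl⟩ := forget_eq_append hf
  obtain ⟨P', W₂, rfl, rfl, hf₂⟩ := forget_eq_append hf₁
  obtain ⟨X, W₃, rfl, rfl, hf₃⟩ := forget_eq_cons hf₂
  obtain ⟨Y, W₄, rfl, rfl, hf₄⟩ := forget_eq_cons hf₃
  obtain ⟨Z, W₅, rfl, rfl, hf₅⟩ := forget_eq_cons hf₄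
  obtain rfl : W₅ = [] := by simpa [forget] using hf₅
  rw [← hg.peak_iff (by simpa [forget] using hps)]
  have hp := (List.pairwise_append.1 (List.pairwise_append.1 hi).1).2.1
  simp only [List.pairwise_cons, List.mem_cons, List.not_mem_nil, or_false, forall_eq_or_imp,
    forall_eq] at hp
  rw [lt_iff_of_indexed hp.1.1, gt_iff_of_indexed hp.2.1]

/-- The shape of the mixed insertion tableau is determined by the new cells. -/
theorem IsMixPath.shape_eq {w : List Letter} {cs : List Cell} (h : IsMixPath w cs) :
    ((mixTableau w).shape : Set Cell) = addCells ∅ cs := by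
  rw [mixTableau, h.run.shape_eq]
  simp [Filling.empty]

/-- Mixed insertion of the two words leads to tableaux of the same shape, in any context. -/
def MixEquiv (v w : List Letter) : Prop :=
  ∀ P S, (mixTableau (P ++ v ++ S)).shape = (mixTableau (P ++ w ++ S)).shape

theorem MixEquiv.refl (v : List Letter) : MixEquiv v v := fun _ _ => rfl

theorem MixEquiv.trans {u v w : List Letter} (h : MixEquiv u v) (h' : MixEquiv v w) :
    MixEquiv u w := fun P S => (h P S).trans (h' P S)

theorem MixEquiv.append {v w : List Letter} (h : MixEquiv v w) (P S : List Letter) :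
    MixEquiv (P ++ v ++ S) (P ++ w ++ S) := by
  intro P' S'
  simpa using h (P' ++ P) (S ++ S')

/-- Transfers an exchange of two adjacent letters from indexed words to words. As the exchanged
letters differ, carrying their indices along leaves a correctly indexed word. -/
theorem mixEquiv_swap {l r : List Letter} {p q : Letter} (hpq : p ≠ q)
    (h : ∀ L A B R, IsIndexed (L ++ A :: B :: R) → forget L = l → (ofLex A).1 = p →
      (ofLex B).1 = q → forget R = r →
      ShiftedPlactic (L ++ A :: B :: R) (L ++ B :: A :: R) ∨
      ShiftedPlactic (L ++ B :: A :: R) (L ++ A :: B :: R)) :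
    MixEquiv (l ++ p :: q :: r) (l ++ q :: p :: r) := by
  intro P S
  have hi := isIndexed_indexed (P ++ (l ++ p :: q :: r) ++ S)
  have hf := forget_indexed (P ++ (l ++ p :: q :: r) ++ S)
  generalize indexed (P ++ (l ++ p :: q :: r) ++ S) = W at hi hf
  obtain ⟨W₁, S', rfl, hf₁, rfl⟩ := forget_eq_append hf
  obtain ⟨P', W₂, rfl, rfl, hf₂⟩ := forget_eq_append hf₁
  obtain ⟨L, W₃, rfl, rfl, hf₃⟩ := forget_eq_append hf₂
  obtain ⟨A, W₄, rfl, rfl, hf₄⟩ := forget_eq_cons hf₃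
  obtain ⟨B, R, rfl, rfl, rfl⟩ := forget_eq_cons hf₄
  have hi' : IsIndexed (P' ++ (L ++ B :: A :: R) ++ S') := by
    simp only [IsIndexed, List.append_assoc, List.cons_append, List.pairwise_append,
      List.pairwise_cons, List.mem_append, List.mem_cons] at hi ⊢
    grind
  have hs := h L A B R (List.pairwise_append.1 (List.pairwise_append.1 hi).1).2.1 rfl rfl rfl rfl
  obtain ⟨cs, hg, hr⟩ := hi.exists_growth
  obtain ⟨ds, hg', hr'⟩ := hi'.exists_growth
  have he : addCells ∅ cs = addCells ∅ ds := by
    rcases hs with hs | hs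
    · exact hs.addCells_eq hg hg'
    · exact (hs.addCells_eq hg' hg).symm
  have e1 := hr.shape_eq
  have e2 := hr'.shape_eq
  rw [← Finset.coe_inj]
  simp only [forget_append] at e1 e2
  simp only [mixTableau]
  simp only [forget, List.map_cons] at e1 e2 ⊢
  rw [e1, e2]
  simpa [Filling.empty] using he

end ShiftedInsertion

namespace ShiftedInsertion

/-! ### Hook words and mixed insertion -/

theorem MixEquiv.cons {v w : List Letter} (h : MixEquiv v w) (x : Letter) :
    MixEquiv (x :: v) (x :: w) := by
  simpa using h.append [x] []

theorem MixEquiv.append_right {v w : List Letter} (h : MixEquiv v w) (S : List Letter) :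
    MixEquiv (v ++ S) (w ++ S) := by
  simpa using h.append [] S

theorem MixEquiv.append_left {v w : List Letter} (h : MixEquiv v w) (P : List Letter) :
    MixEquiv (P ++ v) (P ++ w) := by
  simpa using h.append P []

theorem IsIndexed.four {A B C D : Letter ×ₗ ℕ} (h : IsIndexed [A, B, C, D]) :
    (((ofLex A).1 ≤ (ofLex B).1 → A < B) ∧ ((ofLex A).1 ≤ (ofLex C).1 → A < C) ∧
      ((ofLex A).1 ≤ (ofLex D).1 → A < D)) ∧ (((ofLex B).1 ≤ (ofLex C).1 → B < C) ∧
      ((ofLex B).1 ≤ (ofLex D).1 → B < D)) ∧ ((ofLex C).1 ≤ (ofLex D).1 → C < D) := by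
  simp only [IsIndexed, List.pairwise_cons, List.mem_cons, List.not_mem_nil, or_false,
    forall_eq_or_imp, forall_eq] at h
  exact ⟨⟨fun hl => lt_of_fst_le hl h.1.1, fun hl => lt_of_fst_le hl h.1.2.1,
    fun hl => lt_of_fst_le hl h.1.2.2⟩, ⟨fun hl => lt_of_fst_le hl h.2.1.1,
    fun hl => lt_of_fst_le hl h.2.1.2⟩, fun hl => lt_of_fst_le hl h.2.2.1⟩

theorem forget_eq_pair {L : List (Letter ×ₗ ℕ)} {f g : Letter} (h : forget L = [f, g]) :
    ∃ F G, L = [F, G] ∧ (ofLex F).1 = f ∧ (ofLex G).1 = g := by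
  obtain ⟨F, L', rfl, h1, h'⟩ := forget_eq_cons h
  obtain ⟨G, L'', rfl, h2, h''⟩ := forget_eq_cons h'
  exact ⟨F, G, by simpa [forget] using h'', h1, h2⟩

theorem forget_eq_singleton {L : List (Letter ×ₗ ℕ)} {f : Letter} (h : forget L = [f]) :
    ∃ F, L = [F] ∧ (ofLex F).1 = f := by
  obtain ⟨F, L', rfl, h1, h'⟩ := forget_eq_cons h
  exact ⟨F, by simpa [forget] using h', h1⟩

theorem forget_eq_nil {L : List (Letter ×ₗ ℕ)} (h : forget L = []) : L = [] := by
  simpa [forget] using h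

/-- This lemma and the next three gather the eight shifted plactic relations by the position of the
exchange. Within each, the cases differ only in how the remaining letters compare, ties being
resolved by the indices. -/
theorem mixEquiv_last {f e e' x : Letter} (h₁ : f ≤ e) (h₂ : e ≤ e') (h₃ : x < e) :
    MixEquiv [f, e, e', x] [f, e, x, e'] := by
  refine mixEquiv_swap (l := [f, e]) (r := []) (h₃.trans_le h₂).ne' ?_
  intro L E' X R hi hL hE' hX hR
  obtain ⟨F, E, rfl, rfl, rfl⟩ := forget_eq_pair hL
  obtain rfl := forget_eq_nil hR
  subst hE' hX
  have hi4 := IsIndexed.four hi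
  left
  rcases le_or_gt (ofLex F).1 (ofLex X).1 with h | h
  · exact .acdb (hi4.1.2.2 h) (lt_of_fst_lt h₃) (hi4.2.1.1 h₂)
  · exact .bcda (lt_of_fst_lt h) (hi4.1.1 h₁) (hi4.2.1.1 h₂)

theorem mixEquiv_up {f g b h : Letter} (h₁ : f ≤ g) (h₂ : g ≤ h) (h₃ : h < b) :
    MixEquiv [f, g, b, h] [f, b, g, h] := by
  refine mixEquiv_swap (l := [f]) (r := [h]) (h₂.trans_lt h₃).ne ?_
  intro L G B R hi hL hG hB hR
  obtain ⟨F, rfl, rfl⟩ := forget_eq_singleton hL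
  obtain ⟨H, rfl, rfl⟩ := forget_eq_singleton hR
  subst hG hB
  have hi4 := IsIndexed.four hi
  exact Or.inl (.abdc (hi4.1.1 h₁) (hi4.2.1.2 h₂) (lt_of_fst_lt h₃))

theorem mixEquiv_down {p q b h : Letter} (h₁ : q < p) (h₂ : p ≤ b) (h₃ : h < b) :
    MixEquiv [p, q, b, h] [p, b, q, h] := by
  refine mixEquiv_swap (l := [p]) (r := [h]) (h₁.trans_le h₂).ne ?_
  intro L Q B R hi hL hQ hB hR
  obtain ⟨P, rfl, rfl⟩ := forget_eq_singleton hL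
  obtain ⟨H, rfl, rfl⟩ := forget_eq_singleton hR
  subst hQ hB
  have hi4 := IsIndexed.four hi
  left
  rcases le_or_gt (ofLex P).1 (ofLex H).1 with h | h
  · exact .badc (lt_of_fst_lt h₁) (hi4.1.2.2 h) (lt_of_fst_lt h₃)
  · rcases le_or_gt (ofLex Q).1 (ofLex H).1 with h' | h'
    · exact .cadb (hi4.2.1.2 h') (lt_of_fst_lt h) (hi4.1.2.1 h₂)
    · exact .cbda (lt_of_fst_lt h') (lt_of_fst_lt h₁) (hi4.1.2.1 h₂)

theorem mixEquiv_first {e z b h : Letter} (h₁ : z ≤ b) (h₂ : b < e) (h₃ : h < b) :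
    MixEquiv [e, z, b, h] [z, e, b, h] := by
  refine mixEquiv_swap (l := []) (r := [b, h]) (h₁.trans_lt h₂).ne' ?_
  intro L E Z R hi hL hE hZ hR
  obtain rfl := forget_eq_nil hL
  obtain ⟨B, H, rfl, rfl, rfl⟩ := forget_eq_pair hR
  subst hE hZ
  have hi4 := IsIndexed.four hi
  left
  rcases le_or_gt (ofLex Z).1 (ofLex H).1 with h | h
  · exact .dacb (hi4.2.1.2 h) (lt_of_fst_lt h₃) (lt_of_fst_lt h₂)
  · exact .dbca (lt_of_fst_lt h) (hi4.2.1.1 h₁) (lt_of_fst_lt h₂)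

/-- The letter `x` moves left over the weakly increasing letters of `V`, each time with the two
preceding letters as context. -/
theorem mixEquiv_move_last {f e x : Letter} {V : List Letter}
    (hV : (f :: e :: V).Pairwise (· ≤ ·)) (hx : x < e) :
    MixEquiv (f :: e :: (V ++ [x])) (f :: e :: x :: V) := by
  induction V generalizing f e with
  | nil => exact MixEquiv.refl _
  | cons e' V ih =>
    have h := hV
    simp only [List.pairwise_cons, List.mem_cons, forall_eq_or_imp] at h
    have h1 := (ih (List.pairwise_cons.1 hV).2 (hx.trans_le h.2.1.1)).cons f
    exact h1.trans (by simpa using (mixEquiv_last h.1.1 h.2.1.1 hx).append_right V)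

/-- The letter `b` moves left over an increasing word, with one letter of context on each side; the
right one is the next letter of `V`, or `h`. -/
theorem mixEquiv_move_up {f b h : Letter} {V : List Letter} (hV : (f :: V).Pairwise (· ≤ ·))
    (hh : ∀ g ∈ V, g ≤ h) (hb : h < b) :
    MixEquiv (f :: (V ++ [b, h])) (f :: b :: (V ++ [h])) := by
  induction V generalizing f with
  | nil => exact MixEquiv.refl _
  | cons g V ih =>
    have hp := hV
    simp only [List.pairwise_cons, List.mem_cons, forall_eq_or_imp] at hp
    have h1 := (ih (List.pairwise_cons.1 hV).2 fun g' hg' => hh g' (by simp [hg'])).cons f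
    refine h1.trans ?_
    have hgh := hh g (by simp)
    cases V with
    | nil => exact mixEquiv_up hp.1.1 hgh hb
    | cons g' V =>
      simpa using (mixEquiv_up hp.1.1 (hp.2.1 g' (by simp)) ((hh g' (by simp)).trans_lt hb)).append_right
        (V ++ [h])

/-- As before, but `b` moves over a decreasing word; all its letters are below `z`, hence below `b`.
-/
theorem mixEquiv_move_down {z b h : Letter} {V : List Letter} (hV : (z :: V).Pairwise (· > ·))
    (hz : z ≤ b) (hb : h < b) :
    MixEquiv (z :: (V ++ [b, h])) (z :: b :: (V ++ [h])) := by
  induction V generalizing z with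
  | nil => exact MixEquiv.refl _
  | cons q V ih =>
    have hp := hV
    simp only [List.pairwise_cons, List.mem_cons, forall_eq_or_imp] at hp
    have h1 := (ih (List.pairwise_cons.1 hV).2 (hp.1.1.le.trans hz)).cons z
    refine h1.trans ?_
    cases V with
    | nil => exact mixEquiv_down hp.1.1 hz hb
    | cons q' V =>
      have hq' : q' < b := (hp.1.2 q' (by simp)).trans_le hz
      simpa using (mixEquiv_down hp.1.1 hz hq').append_right (V ++ [h])

/-- The letter `z` moves left to the front. The context consists of the two letters to its right:
`b, h` at first, later letters of `V` followed by `b`, which are decreasing and at least `z`. -/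
theorem mixEquiv_move_first {z b h : Letter} {V : List Letter} (hV : (V ++ [b]).Pairwise (· > ·))
    (hz : z ≤ b) (hb : h < b) :
    MixEquiv (V ++ [z, b, h]) (z :: (V ++ [b, h])) := by
  induction V with
  | nil => exact MixEquiv.refl _
  | cons e V ih =>
    have hp := List.pairwise_cons.1 hV
    refine ((ih hp.2).cons e).trans ?_
    match V, hp with
    | [], hp => exact mixEquiv_first hz (hp.1 b (by simp)) hb
    | [e'], hp =>
      have hb' : b < e' := by simpa using hp.2
      simpa using (mixEquiv_first (hz.trans hb'.le) (hp.1 e' (by simp)) hb').append_right [h]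
    | e' :: e'' :: V, hp =>
      have h1 : (e' :: e'' :: (V ++ [b])).Pairwise (· > ·) := hp.2
      rw [List.pairwise_cons] at h1
      have hb' : b < e' := h1.1 b (by simp)
      simpa using (mixEquiv_first (hz.trans hb'.le) (hp.1 e' (by simp))
        (h1.1 e'' (by simp))).append_right (V ++ [b, h])

/-- Bumping the letter `z` out of a hook word corresponds to a mixed insertion equivalence. -/
theorem mixEquiv_bump {D₁ D₂ U₁ U₂ D₀ : List Letter} {z b x f : Letter}
    (hD : (D₁ ++ z :: D₂).Pairwise (· > ·)) (hf : D₁ ++ z :: D₂ = D₀ ++ [f])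
    (hU : (f :: (U₁ ++ b :: U₂)).Pairwise (· ≤ ·)) (hb : ∀ d ∈ D₁, b < d) (hz : z ≤ b)
    (hx : ∀ u ∈ U₁, u ≤ x) (hxb : x < b) :
    MixEquiv (D₁ ++ z :: D₂ ++ (U₁ ++ b :: U₂) ++ [x])
      (z :: (D₁ ++ b :: D₂ ++ (U₁ ++ x :: U₂))) := by
  -- The new letter `x` moves left until it stands next to `b`, the letter it replaces.
  have h1 : MixEquiv (f :: (U₁ ++ b :: U₂) ++ [x]) (f :: (U₁ ++ b :: x :: U₂)) := by
    rcases List.eq_nil_or_concat (f :: U₁) with h | ⟨W, g, h⟩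
    · simp at h
    · rw [List.concat_eq_append] at h
      have h2 : MixEquiv (g :: b :: (U₂ ++ [x])) (g :: b :: x :: U₂) := by
        refine mixEquiv_move_last ?_ hxb
        rw [← List.cons_append, h, List.append_assoc] at hU
        simpa using (List.pairwise_append.1 hU).2.1
      have e : ∀ T, f :: (U₁ ++ T) = W ++ (g :: T) := by
        intro T
        rw [← List.cons_append, h]; simp
      simp only [List.cons_append, List.append_assoc]
      rw [e, e]
      simpa using h2.append_left W
  -- Then `b` leaves the increasing part and stops after `f`, the last letter of the decreasing
  -- part.
  have h2 : MixEquiv (f :: (U₁ ++ b :: x :: U₂)) (f :: b :: (U₁ ++ x :: U₂)) := by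
    have := mixEquiv_move_up (f := f) (b := b) (h := x) (V := U₁)
      (hU.sublist (by simp)) hx hxb
    simpa using this.append_right U₂
  have h12 : MixEquiv (D₁ ++ z :: D₂ ++ (U₁ ++ b :: U₂) ++ [x])
      (D₁ ++ z :: D₂ ++ b :: (U₁ ++ x :: U₂)) := by
    rw [hf]
    simpa using (h1.trans h2).append_left D₀
  refine h12.trans ?_
  obtain ⟨h, T, hT, hhb⟩ : ∃ h T, U₁ ++ x :: U₂ = h :: T ∧ h < b := by
    cases U₁ with
    | nil => exact ⟨x, U₂, rfl, hxb⟩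
    | cons g U₁ => exact ⟨g, U₁ ++ x :: U₂, rfl, (hx g (by simp)).trans_lt hxb⟩
  rw [hT]
  have hp := List.pairwise_append.1 hD
  -- Next `b` moves up the decreasing part until it meets `z`, whose place it takes.
  have h3 : MixEquiv (D₁ ++ z :: D₂ ++ b :: h :: T) (D₁ ++ z :: b :: (D₂ ++ h :: T)) := by
    simpa using (mixEquiv_move_down hp.2.1 hz hhb).append D₁ T
  refine h3.trans ?_
  obtain ⟨h', T', hT', hhb'⟩ : ∃ h' T', D₂ ++ h :: T = h' :: T' ∧ h' < b := by
    cases D₂ with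
    | nil => exact ⟨h, T, rfl, hhb⟩
    | cons q D₂ =>
      exact ⟨q, D₂ ++ h :: T, rfl, ((List.pairwise_cons.1 hp.2.1).1 q (by simp)).trans_le hz⟩
  have hDb : (D₁ ++ [b]).Pairwise (· > ·) :=
    List.pairwise_append.2 ⟨hp.1, by simp, by simpa using hb⟩
  -- Finally `z` moves over `D₁` to the front: it has been bumped out.
  have h4 := (mixEquiv_move_first hDb hz hhb').append_right T'
  rw [hT']
  simpa [hT'] using h4

/-! ### Insertion into a hook word -/

/-- The comparison at the junction need not be prescribed: if the first letter of the increasing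
part is below the last one of the decreasing part, it may be counted in the latter. -/
theorem isHookWord_iff {w : List Letter} : IsHookWord w ↔ w ≠ [] ∧
    ∃ D U, w = D ++ U ∧ D.Pairwise (· > ·) ∧ U.Pairwise (· ≤ ·) := by
  constructor
  · rintro ⟨k, hk, h1, h2⟩
    rw [Finset.mem_Icc] at hk
    refine ⟨by rintro rfl; simp at hk; omega, w.take k, w.drop k, by simp, h1, ?_⟩
    have : w.drop k = (w.drop (k - 1)).drop 1 := by rw [List.drop_drop]; congr 1; omega
    rw [this]
    exact h2.sublist (List.drop_sublist _ _)
  · rintro ⟨hne, D, U, rfl, h1, h2⟩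
    cases U with
    | nil =>
      have : 1 ≤ D.length := List.length_pos_iff.2 (by simpa using hne)
      refine ⟨D.length, by simp [this], by simpa using h1, ?_⟩
      have : ((D ++ []).drop (D.length - 1)).length ≤ 1 := by simp; omega
      match (D ++ []).drop (D.length - 1), this with
      | [], _ => simp
      | [a], _ => simp
    | cons v U =>
      rcases List.eq_nil_or_concat D with rfl | ⟨D, d, rfl⟩
      · exact ⟨1, by simp, by simp, by simpa using h2⟩
      · rw [List.concat_eq_append] at h1 ⊢
        rcases le_or_gt d v with h | h
        · refine ⟨D.length + 1, by simp, ?_, ?_⟩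
          · rw [List.take_left' (by simp)]; exact h1
          · have h3 : (D ++ [d] ++ v :: U).drop (D.length + 1 - 1) = d :: v :: U := by simp
            rw [h3, List.pairwise_cons]
            refine ⟨fun y hy => ?_, h2⟩
            rcases List.mem_cons.1 hy with rfl | hy
            · exact h
            · exact h.trans ((List.pairwise_cons.1 h2).1 y hy)
        · refine ⟨D.length + 2, by simp, ?_, ?_⟩
          · have h3 : (D ++ [d] ++ v :: U).take (D.length + 2) = D ++ [d] ++ [v] := by
              rw [show D ++ [d] ++ v :: U = (D ++ [d] ++ [v]) ++ U by simp]
              exact List.take_left' (by simp)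
            rw [h3, List.pairwise_append]
            refine ⟨h1, by simp, ?_⟩
            intro y hy y' hy'
            rw [List.mem_singleton] at hy'
            subst hy'
            rcases List.mem_append.1 hy with hy | hy
            · exact h.trans ((List.pairwise_append.1 h1).2.2 y hy d (by simp))
            · rw [List.mem_singleton] at hy; subst hy; exact h
          · have h3 : (D ++ [d] ++ v :: U).drop (D.length + 2 - 1) = v :: U := by
              exact List.drop_left' (by simp)
            rw [h3]; exact h2

theorem set_findIdx_append {α : Type} {p : α → Bool} {l₁ l₂ : List α} {a : α} (ha : p a = true)
    (h : ∀ b ∈ l₁, p b = false) (c : α) :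
    (l₁ ++ a :: l₂).set ((l₁ ++ a :: l₂).findIdx p) c = l₁ ++ c :: l₂ := by
  induction l₁ with
  | nil => simp [List.findIdx_cons, ha]
  | cons b l₁ ih =>
    have hb := h b (by simp)
    simp [List.findIdx_cons, hb, ih fun b hb => h b (by simp [hb])]

/-- The outcome of the insertion of a letter into a hook word. -/
theorem skRowInsert_cases {u : List Letter} {x : Letter} (hu : IsHookWord u) :
    IsHookWord (u ++ [x]) ∧ skRowInsert u x = (u ++ [x], none) ∨
    ∃ u' z, skRowInsert u x = (u', some z) ∧ IsHookWord u' ∧ u'.length = u.length ∧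
      MixEquiv (u ++ [x]) (z :: u') ∧ ∃ v y' y, u = v ++ [y', y] ∧ y' ≤ y ∧ x < y := by
  by_cases hx : IsHookWord (u ++ [x])
  · exact Or.inl ⟨hx, by simp [skRowInsert, hx]⟩
  right
  obtain ⟨k, hk, hdown, hup⟩ := hu
  obtain ⟨hd, hv⟩ := parts_eq hk hdown hup
  rw [Finset.mem_Icc] at hk
  obtain ⟨D₀, f, U, hD, hU, rfl⟩ : ∃ D₀ f U, u.take k = D₀ ++ [f] ∧ u.drop k = U ∧
      u = D₀ ++ [f] ++ U := by
    rcases List.eq_nil_or_concat (u.take k) with h | ⟨D₀, f, h⟩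
    · have := congrArg List.length h
      rw [List.length_take] at this
      simp only [List.length_nil] at this; omega
    · rw [List.concat_eq_append] at h
      exact ⟨D₀, f, u.drop k, h, rfl, by rw [← h, List.take_append_drop]⟩
  have hfU : (f :: U).Pairwise (· ≤ ·) := by
    have hk' : k = D₀.length + 1 := by
      have := congrArg List.length hD
      simp at this hk; omega
    have : (D₀ ++ [f] ++ U).drop (k - 1) = f :: U := by simp [hk']
    rwa [this] at hup
  rw [hD] at hdown hd
  rw [hU] at hv
  clear hk hup hD hU k
  have hex : ∃ y ∈ U, x < y := by
    by_contra! hcon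
    refine hx (isHookWord_iff.2 ⟨by simp, D₀ ++ [f], U ++ [x], by simp, hdown, ?_⟩)
    exact List.pairwise_append.2 ⟨(List.pairwise_cons.1 hfU).2, by simp, by simpa using hcon⟩
  obtain ⟨b, hb⟩ : ∃ b, U.find? (fun y => x < y) = some b := by
    rw [← Option.isSome_iff_exists, List.find?_isSome]
    simpa using hex
  obtain ⟨hxb, U₁, U₂, rfl, hU₁⟩ := List.find?_eq_some_iff_append.1 hb
  have hfb : f ≤ b := (List.pairwise_cons.1 hfU).1 b (by simp)
  obtain ⟨z, hz⟩ : ∃ z, (D₀ ++ [f]).find? (fun z => z ≤ b) = some z := by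
    rw [← Option.isSome_iff_exists, List.find?_isSome]
    exact ⟨f, by simp, by simpa using hfb⟩
  obtain ⟨hzb, D₁, D₂, hD, hD₁⟩ := List.find?_eq_some_iff_append.1 hz
  have hset₁ := set_findIdx_append (p := fun z => decide (z ≤ b)) (l₂ := D₂) hzb (fun d hd => by simpa using hD₁ d hd) b
  have hset₂ := set_findIdx_append (p := fun y => decide (x < y)) (l₂ := U₂) hxb (fun d hd => by simpa using hU₁ d hd) x
  simp only [decide_eq_true_eq] at hxb hzb
  simp only [Bool.not_eq_true', decide_eq_false_iff_not, not_lt, not_le]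
    at hU₁ hD₁
  have hdown' := hdown
  rw [hD] at hdown'
  refine ⟨D₁ ++ b :: D₂ ++ (U₁ ++ x :: U₂), z, ?_, ?_, ?_, ?_, ?_⟩
  · simp only [skRowInsert, if_neg hx, hv, hd, hb, hz]
    rw [hset₂, hD, hset₁]
  · refine isHookWord_iff.2 ⟨by simp, _, _, rfl, ?_, ?_⟩
    · rw [List.pairwise_append, List.pairwise_cons] at hdown' ⊢
      refine ⟨hdown'.1, ⟨fun d hd => (hdown'.2.1.1 d hd).trans_le hzb, hdown'.2.1.2⟩, ?_⟩
      intro d hmem d' hd'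
      rcases List.mem_cons.1 hd' with rfl | hd'
      · exact hD₁ d hmem
      · exact hdown'.2.2 d hmem d' (by simp [hd'])
    · have h := (List.pairwise_cons.1 hfU).2
      rw [List.pairwise_append, List.pairwise_cons] at h ⊢
      refine ⟨h.1, ⟨fun d hd => hxb.le.trans (h.2.1.1 d hd), h.2.1.2⟩, ?_⟩
      intro d hmem d' hd'
      rcases List.mem_cons.1 hd' with rfl | hd'
      · exact hU₁ d hmem
      · exact h.2.2 d hmem d' (by simp [hd'])
  · rw [hD]; simp
  · rw [hD]
    exact mixEquiv_bump hdown' hD.symm hfU hD₁ hzb hU₁ hxb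
  -- A bump means that the last two letters of `u` form a peak with `x`; `y'` may be the letter `f`
  -- that ends the decreasing part.
  · obtain ⟨V, y, hy⟩ := (List.eq_nil_or_concat (U₁ ++ b :: U₂)).resolve_left (by simp)
    obtain ⟨V', y', hy'⟩ := (List.eq_nil_or_concat (f :: V)).resolve_left (by simp)
    rw [List.concat_eq_append] at hy hy'
    have e : f :: (U₁ ++ b :: U₂) = V' ++ [y', y] := by
      rw [hy, ← List.cons_append, hy']; simp
    refine ⟨D₀ ++ V', y', y, ?_, ?_, ?_⟩
    · rw [List.append_assoc, List.append_assoc, ← e]; simp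
    · rw [e, List.pairwise_append] at hfU
      simpa using hfU.2.1
    · have hp := (List.pairwise_append.1 (List.pairwise_cons.1 hfU).2).2.1
      have h2 : (b :: U₂).getLast (by simp) = y := by
        have : (U₁ ++ b :: U₂).getLast (by simp) = y := by simp [hy]
        rwa [List.getLast_append_of_ne_nil] at this
      have h3 : y ∈ b :: U₂ := h2 ▸ List.getLast_mem _
      rcases List.mem_cons.1 h3 with rfl | h3
      · exact hxb
      · exact hxb.trans_le ((List.pairwise_cons.1 hp).1 y h3)

end ShiftedInsertion

namespace ShiftedInsertion

/-! ### The first row of the SK tableau -/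

/-- Insert a letter into the hook word `s.1` and append the bumped letter, if any, to `s.2`. -/
def rowStep (s : List Letter × List Letter) (x : Letter) : List Letter × List Letter :=
  ((skRowInsert s.1 x).1, s.2 ++ (skRowInsert s.1 x).2.toList)

/-- The first row of the SK tableau of `w`, and the word of the letters bumped out of it. -/
def rowRun (w : List Letter) : List Letter × List Letter := w.foldl rowStep ([], [])

theorem rowRun_append_singleton (w : List Letter) (x : Letter) :
    rowRun (w ++ [x]) = rowStep (rowRun w) x := by
  simp [rowRun]

theorem skRows_append_singleton (w : List Letter) (x : Letter) :
    skRows (w ++ [x]) = skInsert (skRows w) x := by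
  simp [skRows]

theorem isHookWord_singleton (x : Letter) : IsHookWord [x] :=
  isHookWord_iff.2 ⟨by simp, [x], [], by simp⟩

theorem rowRun_singleton (x : Letter) : rowRun [x] = ([x], []) := by
  simp [rowRun, rowStep, skRowInsert, isHookWord_singleton]

/-- Each bumped letter is moved to the left of the current hook word by an equivalence. The bumped
letters thus accumulate, in order, as the word that the remaining rows receive. -/
theorem rowRun_spec {w : List Letter} (hw : w ≠ []) : IsHookWord (rowRun w).1 ∧
    (rowRun w).1.length + (rowRun w).2.length = w.length ∧
    skRows w = (rowRun w).1 :: skRows (rowRun w).2 ∧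
    MixEquiv w ((rowRun w).2 ++ (rowRun w).1) := by
  induction w using List.reverseRecOn with
  | nil => exact absurd rfl hw
  | append_singleton w x ih =>
    by_cases hw' : w = []
    · subst hw'
      rw [List.nil_append, rowRun_singleton]
      exact ⟨isHookWord_singleton x, rfl, rfl, MixEquiv.refl _⟩
    · obtain ⟨h1, h2, h3, h4⟩ := ih hw'
      rw [rowRun_append_singleton, skRows_append_singleton, h3]
      generalize rowRun w = s at *
      obtain ⟨u, v⟩ := s
      simp only at *
      have h5 := h4.append_right [x]
      rcases skRowInsert_cases (x := x) h1 with ⟨h6, h7⟩ | ⟨u', z, h6, h7, h8, h9, -⟩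
      · simp only [rowStep, h7, skInsert, Option.toList_none, List.append_nil]
        exact ⟨h6, by simp; omega, trivial, by simpa using h5⟩
      · simp only [rowStep, h6, skInsert, Option.toList_some, skRows_append_singleton]
        refine ⟨h7, by simp; omega, trivial, h5.trans ?_⟩
        simpa using h9.append_left v

theorem Filling.mem_ofRows {α : Type} {R : List (List α)} {p : Cell} :
    p ∈ (Filling.ofRows R).shape ↔ p.1 ≤ p.2 ∧ p.2 - p.1 < (R.getD p.1 []).length := by
  rw [(Filling.ofRows R).mem_shape]
  by_cases h : p.1 ≤ p.2 <;> simp [Filling.ofRows, h]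

theorem Filling.mem_ofRows_cons {α : Type} {u : List α} {R : List (List α)} {p : Cell} :
    p ∈ (Filling.ofRows (u :: R)).shape ↔ (p.1 = 0 ∧ p.2 < u.length) ∨
      ∃ q ∈ (Filling.ofRows R).shape, p = (q.1 + 1, q.2 + 1) := by
  obtain ⟨r, c⟩ := p
  cases r with
  | zero => simp [mem_ofRows]
  | succ r =>
    cases c with
    | zero => simp [mem_ofRows]
    | succ c => simp [mem_ofRows]

/-! ### Shapes of mixed insertion and SK insertion tableaux -/

theorem mem_addCells {A : Set Cell} {cs : List Cell} {p : Cell} :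
    p ∈ addCells A cs ↔ p ∈ A ∨ p ∈ cs := Iff.rfl

theorem IsShiftedPath.ncard {A : Set Cell} {cs : List Cell} (h : IsShiftedPath A cs)
    (hA : A.Finite) : (addCells A cs).ncard = A.ncard + cs.length := by
  induction cs generalizing A with
  | nil => simp
  | cons c cs ih =>
    rw [addCells_cons, ih h.2 (hA.insert c), Set.ncard_insert_of_notMem h.1.2.1 hA,
      List.length_cons]
    omega

/-- Without a peak, a step to the right is never followed by a step down: the path is a vertical
strip followed by a horizontal strip. -/
theorem IsShiftedPath.exists_split {A : Set Cell} {cs : List Cell} (h : IsShiftedPath A cs)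
    (hpeak : ∀ l x y z r, cs = l ++ [x, y, z] ++ r → ¬ (x.2 < y.2 ∧ y.1 < z.1)) :
    ∃ D U, cs = D ++ U ∧ D.Pairwise (fun p q => p.1 < q.1) ∧
      U.Pairwise (fun p q => p.2 < q.2) := by
  induction cs generalizing A with
  | nil => exact ⟨[], [], by simp⟩
  | cons a cs ih =>
    have hpeak' : ∀ l x y z r, cs = l ++ [x, y, z] ++ r → ¬ (x.2 < y.2 ∧ y.1 < z.1) :=
      fun l x y z r e => hpeak (a :: l) x y z r (by rw [e]; rfl)
    obtain ⟨D, U, rfl, hD, hU⟩ := ih h.2 hpeak'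
    match D, hD with
    | [], _ => exact ⟨[a], U, rfl, by simp, hU⟩
    | b :: D, hD =>
      by_cases hab : a.1 < b.1
      · refine ⟨a :: b :: D, U, rfl, List.pairwise_cons.2 ⟨?_, hD⟩, hU⟩
        intro p hp
        rcases List.mem_cons.1 hp with rfl | hp
        · exact hab
        · exact hab.trans ((List.pairwise_cons.1 hD).1 p hp)
      · have hab' : a.2 < b.2 := h.col_lt_iff.2 (not_lt.1 hab)
        match D, hD with
        | [], _ =>
          cases U with
          | nil => exact ⟨[], [a, b], rfl, by simp, by simpa using hab'⟩
          | cons c U =>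
            have hbc : b.2 < c.2 := by
              have h1 := hpeak [] a b c U rfl
              have h2 := h.2.col_lt_iff
              omega
            have hbU : (b :: c :: U).Pairwise (fun p q : Cell => p.2 < q.2) := by
              refine List.pairwise_cons.2 ⟨?_, hU⟩
              intro p hp
              rcases List.mem_cons.1 hp with rfl | hp
              · exact hbc
              · exact hbc.trans ((List.pairwise_cons.1 hU).1 p hp)
            refine ⟨[], a :: b :: c :: U, rfl, by simp, List.pairwise_cons.2 ⟨?_, hbU⟩⟩
            intro p hp
            rcases List.mem_cons.1 hp with rfl | hp
            · exact hab'
            · exact hab'.trans ((List.pairwise_cons.1 hbU).1 p hp)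
        | d :: D, hD =>
          have h1 := (List.pairwise_cons.1 hD).1 d (by simp)
          exact absurd ⟨hab', h1⟩ (hpeak [] a b d (D ++ U) rfl)

theorem eq_of_pairwise_lt {f : Cell → ℕ} {l : List Cell}
    (h : l.Pairwise (fun p q => f p < f q)) {p q : Cell} (hp : p ∈ l) (hq : q ∈ l)
    (e : f p = f q) : p = q := by
  refine List.Pairwise.forall_of_forall_of_flip (R := fun p q => f p = f q → p = q) (by simp)
    (h.imp ?_) (h.imp ?_) hp hq e
  · intro a b hab e
    exact absurd e hab.ne
  · intro a b hab e
    exact absurd e hab.ne'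

/-- A path without peaks does not contain two consecutive cells of a diagonal. -/
theorem IsShiftedPath.mem_of_diag {A : Set Cell} {cs : List Cell} (h : IsShiftedPath A cs)
    (hA : ShiftedLow A)
    (hpeak : ∀ l x y z r, cs = l ++ [x, y, z] ++ r → ¬ (x.2 < y.2 ∧ y.1 < z.1)) {r c : ℕ}
    (hrc : (r + 1, c + 1) ∈ addCells A cs) : (r, c) ∈ A := by
  obtain ⟨D, U, rfl, hD, hU⟩ := h.exists_split hpeak
  have hlow := h.low hA
  rw [isShiftedPath_append] at h
  have hlowD := h.1.low hA
  have hle : r ≤ c := by have := hlow.1 _ _ hrc; omega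
  by_contra hn
  -- The vertical strip has at most one cell in each row, so it cannot contain both `(r, c)` and
  -- `(r, c + 1)`. Then `(r, c + 1)` and `(r + 1, c + 1)` would both belong to the horizontal strip,
  -- in one column.
  have key : (r, c + 1) ∉ addCells A D := by
    intro h1
    have h2 := hlowD.2 _ _ h1 r le_rfl c (by omega) hle
    have h3 : (r, c + 1) ∉ A := fun h3 => hn (hA.2 _ _ h3 r le_rfl c (by omega) hle)
    have h1' := (mem_addCells.1 h1).resolve_left h3
    have h2' := (mem_addCells.1 h2).resolve_left hn
    have := eq_of_pairwise_lt hD h1' h2' rfl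
    simp at this
  have h1 := hlow.2 _ _ hrc r (by omega) (c + 1) le_rfl (by omega)
  have h2 : (r + 1, c + 1) ∉ addCells A D :=
    fun h2 => key (hlowD.2 _ _ h2 r (by omega) (c + 1) le_rfl (by omega))
  rw [addCells_append] at h1 hrc
  have h1' := (mem_addCells.1 h1).resolve_left key
  have h2' := (mem_addCells.1 hrc).resolve_left h2
  have := eq_of_pairwise_lt hU h1' h2' rfl
  simp at this

theorem IsHookWord.not_peak {u l r : List Letter} {x y z : Letter} (hu : IsHookWord u)
    (h : u = l ++ [x, y, z] ++ r) : ¬ (x ≤ y ∧ z < y) := by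
  obtain ⟨-, D, U, rfl, hD, hU⟩ := isHookWord_iff.1 hu
  rintro ⟨h1, h2⟩
  have e : D ++ U = (l ++ [x]) ++ y :: z :: r := by simpa using h
  rcases List.append_eq_append_iff.1 e with ⟨c, e1, rfl⟩ | ⟨c, rfl, e2⟩
  · have := (List.pairwise_cons.1 (List.pairwise_append.1 hU).2.1).1 z (by simp)
    exact h2.not_ge this
  · cases c with
    | nil =>
      rw [List.nil_append] at e2
      rw [← e2] at hU
      exact h2.not_ge ((List.pairwise_cons.1 hU).1 z (by simp))
    | cons y' c =>
      obtain ⟨rfl, -⟩ : y = y' ∧ _ := by simpa using e2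
      have := (List.pairwise_append.1 hD).2.2 x (by simp) y (by simp)
      exact h1.not_gt this

theorem IsMixPath.split {v u : List Letter} {cs : List Cell} (h : IsMixPath (v ++ u) cs) :
    ∃ ps ds, cs = ps ++ ds ∧ ps.length = v.length ∧ ds.length = u.length ∧
      ((mixTableau v).shape : Set Cell) = addCells ∅ ps ∧ IsShiftedPath (addCells ∅ ps) ds := by
  have hl := h.length_eq
  rw [List.length_append] at hl
  have e := (List.take_append_drop v.length cs).symm
  have hp : (cs.take v.length).length = v.length := by simp; omega
  have hr := h.run
  have hpath := h.path
  rw [e] at hr hpath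
  rw [mixRun_append hp] at hr
  rw [isShiftedPath_append] at hpath
  refine ⟨_, _, e, hp, by simp; omega, ?_, hpath.2⟩
  rw [mixTableau, hr.1.shape_eq]
  simp [Filling.empty]

theorem card_shape_mixTableau (w : List Letter) : (mixTableau w).shape.card = w.length := by
  obtain ⟨cs, h⟩ := exists_isMixPath w
  rw [← Set.ncard_coe_finset, h.shape_eq, h.path.ncard Set.finite_empty, h.length_eq]
  simp

/-- The new cells along a hook word form no peak, so below the first row the diagram grows by at
most one step along each diagonal. -/
theorem mem_of_diag_mem_mixTableau {v u : List Letter} (hu : IsHookWord u) {r c : ℕ}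
    (h : (r + 1, c + 1) ∈ (mixTableau (v ++ u)).shape) : (r, c) ∈ (mixTableau v).shape := by
  obtain ⟨cs, hcs⟩ := exists_isMixPath (v ++ u)
  obtain ⟨ps, ds, rfl, hps, hds, hv, hpath⟩ := hcs.split
  rw [← Finset.mem_coe, hcs.shape_eq, addCells_append] at h
  have hlow : ShiftedLow (addCells ∅ ps) :=
    (isShiftedPath_append.1 hcs.path).1.low shiftedLow_empty
  rw [← Finset.mem_coe, hv]
  refine hpath.mem_of_diag hlow ?_ h
  rintro l a b c r rfl hpk
  obtain ⟨u₁, u₂, u₃, rfl, hl, hu₂⟩ : ∃ u₁ u₂ u₃, u = u₁ ++ u₂ ++ u₃ ∧ u₁.length = l.length ∧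
      u₂.length = 3 := by
    simp at hds
    exact ⟨u.take l.length, (u.drop l.length).take 3, (u.drop l.length).drop 3,
      by rw [List.append_assoc, List.take_append_drop, List.take_append_drop],
      by simp; omega, by simp; omega⟩
  obtain ⟨x, y, z, rfl⟩ := List.length_eq_three.1 hu₂
  exact hu.not_peak rfl ((hcs.peak (v ++ u₁) x y z u₃ (ps ++ l) a b c r (by simp) (by simp)
    (by simp [hps, hl])).2 hpk)

/-- The first row of the mixed insertion tableau is not longer than that of the SK tableau. -/
theorem lt_length_of_mem_mixTableau {w : List Letter} {x : Letter}
    (ih : (mixTableau w).shape = (skTableau w).shape) {j : ℕ}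
    (hj : (0, j) ∈ (mixTableau (w ++ [x])).shape) : j < (rowRun (w ++ [x])).1.length := by
  have hw : ∀ j, (0, j) ∈ (mixTableau w).shape → j < (rowRun w).1.length := by
    intro j hj
    by_cases hw : w = []
    · subst hw; simp [mixTableau, Filling.empty] at hj
    · rw [ih, skTableau, (rowRun_spec hw).2.2.1, Filling.mem_ofRows_cons] at hj
      simpa using hj
  -- If the SK row becomes longer, there is nothing to lose: a single insertion lengthens the mixed
  -- first row by at most one cell.
  by_cases hne : (skRowInsert (rowRun w).1 x).1.length = (rowRun w).1.length + 1
  · rw [rowRun_append_singleton, rowStep, hne]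
    obtain ⟨cs, hcs⟩ := exists_isMixPath (w ++ [x])
    obtain ⟨ps, ds, rfl, -, hds, hv, hpath⟩ := hcs.split
    obtain ⟨c, rfl⟩ := List.length_eq_one_iff.1 hds
    rw [← Finset.mem_coe, hcs.shape_eq, addCells_append] at hj
    rcases mem_addCells.1 hj with h | h
    · rw [← hv] at h
      have := hw j h
      omega
    · rw [List.mem_singleton] at h
      subst h
      by_contra hlt
      have h1 := hpath.1.lt_mem (i := 0) (j := j - 1) (by omega) le_rfl (by simp)
        (by simp; omega)
      rw [← hv] at h1
      have := hw _ h1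
      omega
  · have hw' : w ≠ [] := by
      rintro rfl
      simp [rowRun, skRowInsert, isHookWord_singleton] at hne
    obtain ⟨h1, -, -, h4⟩ := rowRun_spec hw'
    rcases skRowInsert_cases (x := x) h1 with ⟨-, h⟩ | ⟨u', z, h, -, hl, -, l, y', y, hu, h5, h6⟩
    · rw [h] at hne; simp at hne
    rw [rowRun_append_singleton, rowStep, h, hl]
    refine hw j ?_
    have e1 : (mixTableau (w ++ [x])).shape =
        (mixTableau ((rowRun w).2 ++ (rowRun w).1 ++ [x])).shape := by
      simpa using h4 [] [x]
    have e2 : (mixTableau w).shape = (mixTableau ((rowRun w).2 ++ (rowRun w).1)).shape := by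
      simpa using h4 [] []
    rw [e1] at hj
    rw [e2]
    rw [hu] at hj ⊢
    generalize (rowRun w).2 = v at hj ⊢
    obtain ⟨cs, hcs⟩ := exists_isMixPath (v ++ (l ++ [y', y]) ++ [x])
    obtain ⟨ps, ds, rfl, hps, hds, hv, hpath⟩ := hcs.split
    obtain ⟨c, rfl⟩ := List.length_eq_one_iff.1 hds
    rw [← Finset.mem_coe, hcs.shape_eq, addCells_append] at hj
    rw [← Finset.mem_coe, hv]
    refine (mem_addCells.1 hj).resolve_right ?_
    rw [List.mem_singleton]
    rintro rfl
    obtain ⟨es, fs, rfl, hes, hfs⟩ : ∃ es fs, ps = es ++ fs ∧ es.length = (v ++ l).length ∧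
        fs.length = 2 := by
      simp at hps
      exact ⟨ps.take (v ++ l).length, ps.drop (v ++ l).length, (List.take_append_drop _ _).symm,
        by simp; omega, by simp; omega⟩
    obtain ⟨a, b, rfl⟩ := List.length_eq_two.1 hfs
    -- If a letter is bumped, the word may be replaced by `v u x`, which ends in a peak. The last
    -- new cell is then strictly below the one before it, hence not in row `0`.
    have := (hcs.peak (v ++ l) y' y x [] es a b (0, j) [] (by simp) (by simp) hes).1 ⟨h5, h6⟩
    simp at this

/-- Mixed insertion and SK insertion lead to tableaux of the same shape. -/
theorem shape_mixTableau (w : List Letter) : (mixTableau w).shape = (skTableau w).shape := by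
  induction hn : w.length using Nat.strong_induction_on generalizing w with
  | _ n ih =>
    rcases List.eq_nil_or_concat w with rfl | ⟨w₀, x, hw⟩
    · simp [mixTableau, skTableau, skRows, Filling.empty, Filling.ofRows]
    rw [List.concat_eq_append] at hw
    have hne : w ≠ [] := by rw [hw]; simp
    obtain ⟨h1, h2, h3, h4⟩ := rowRun_spec hne
    have hpos := List.length_pos_iff.2 (isHookWord_iff.1 h1).1
    have hv := ih _ (by omega) (rowRun w).2 rfl
    have hw₀ := ih _ (by rw [hw] at hn; simp at hn; omega) w₀ rfl
    have e : (mixTableau w).shape = (mixTableau ((rowRun w).2 ++ (rowRun w).1)).shape := by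
      simpa using h4 [] []
    -- The SK shape of `w`, rewritten by induction: the first SK row together with the mixed shape
    -- of the bumped word, moved one step down the diagonal.
    set S := (Finset.range (rowRun w).1.length).image (fun j => ((0, j) : Cell)) ∪
      (mixTableau (rowRun w).2).shape.image (fun q => ((q.1 + 1, q.2 + 1) : Cell)) with hS
    have hsub : (mixTableau w).shape ⊆ S := by
      rintro ⟨r, c⟩ hrc
      cases r with
      | zero =>
        rw [hw] at hrc
        have := lt_length_of_mem_mixTableau hw₀ hrc
        rw [← hw] at this
        simp [hS, this]
      | succ r =>
        obtain ⟨c, rfl⟩ : ∃ c', c = c' + 1 := by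
          obtain ⟨cs, hcs⟩ := exists_isMixPath w
          have hlow := hcs.path.low shiftedLow_empty
          rw [← hcs.shape_eq] at hlow
          have := hlow.1 _ _ hrc
          exact ⟨c - 1, by omega⟩
        rw [e] at hrc
        have := mem_of_diag_mem_mixTableau h1 hrc
        simp [hS, this]
    -- A mixed tableau has as many cells as its word has letters, and no letter is lost between the
    -- first row and the bumped word. The inclusion is therefore an equality.
    have hcard : S.card ≤ (mixTableau w).shape.card := by
      rw [card_shape_mixTableau, ← h2]
      refine (Finset.card_union_le _ _).trans (Nat.add_le_add ?_ ?_)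
      · exact Finset.card_image_le.trans (by simp)
      · exact Finset.card_image_le.trans (card_shape_mixTableau _).le
    rw [Finset.eq_of_subset_of_card_le hsub hcard, skTableau, h3]
    ext p
    rw [Filling.mem_ofRows_cons, ← skTableau, ← hv]
    simp only [hS, Finset.mem_union, Finset.mem_image, Finset.mem_range]
    refine or_congr ⟨?_, ?_⟩ ⟨?_, ?_⟩
    · rintro ⟨j, hj, rfl⟩
      exact ⟨rfl, hj⟩
    · rintro ⟨hp, hj⟩
      exact ⟨p.2, hj, by rw [← hp]⟩
    · rintro ⟨q, hq, rfl⟩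
      exact ⟨q, hq, rfl⟩
    · rintro ⟨q, hq, rfl⟩
      exact ⟨q, hq, rfl⟩

end ShiftedInsertion

/-- `recording` only looks at the shapes of prefixes, so equality of shapes for all words is enough.
-/
theorem mainTheorem11 (w : List ShiftedInsertion.Letter) :
    ShiftedInsertion.mixRecording w = ShiftedInsertion.skRecording w := by
  simp only [ShiftedInsertion.mixRecording, ShiftedInsertion.skRecording,
    ShiftedInsertion.shape_mixTableau]
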